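/- Let $\mathbb{N}^*=\{1,2,3,\dots\}$ and let $\mathfrak{S}_\infty$ be the set of bijections of $\mathbb{N}^*$, with the $\sigma$-algebra generated by the evaluations $\sigma\mapsto\sigma(i)$. For $\sigma\in\mathfrak{S}_\infty$ and $i\in\mathbb{N}^*$ let $r_i(\sigma)=\#\{j>i:\sigma(j)<\sigma(i)\}$ be its right-inversion counts. For $q\in[0,1)$, a random $\Sigma\in\mathfrak{S}_\infty$ has the $\mathrm{Mallows}(\mathbb{N}^*,q)$ distribution if the variables $r_i(\Sigma)+1$, $i\ge1$, are i.i.d. geometric, with mass $(1-q)q^{k-1}$ at each $k\in\mathbb{N}^*$. A process $X:[0,1)\to\mathbb{N}$ is a *birth process* with birth rates $p(j,t)\ge0$ if it is Markov (possibly time-inhomogeneous), almost surely càdlàg, has no fixed time of discontinuity (for each fixed $t$, almost surely $X$ is continuous at $t$), and for all $t\in[0,1)$ and all $j\in\mathbb{N}$ with $\mathbb{P}(X_t=j)>0$, $$\mathbb{P}(X_{t+h}=j\mid X_t=j)=1-h\,p(j,t)+o(h),\qquad \mathbb{P}(X_{t+h}=j+1\mid X_t=j)=h\,p(j,t)+o(h)\qquad\text{as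 } h\downarrow0.$$ A *geometric birth process* is a birth process $R$ with $R_0=1$ almost surely and birth rates $p(j,t)=\frac{j}{1-t}$. **Theorem.** There exists a time-inhomogeneous Markov process $\Sigma=(\Sigma_t)_{t\in[0,1)}$ with values in $\mathfrak{S}_\infty$, unique in law (as a random element of $\mathfrak{S}_\infty^{[0,1)}$ with the product $\sigma$-algebra), such that: 1. for all $t\in[0,1)$, $\Sigma_t$ has the $\mathrm{Mallows}(\mathbb{N}^*,t)$ distribution; 2. the processes $(r_i(\Sigma_t))_{t\in[0,1)}$, $i\ge1$, are independent birth processes (with some birth rates). Furthermore, for any such process, one can write $r_i(\Sigma_t)=R_{i,t}-1$ for all $i\ge1$ and $t\in[0,1)$, where $(R_{1,t})_{t\in[0,1)},(R_{2,t})_{t\in[0,1)},\dots$ are i.i.d. geometric birth processes. -/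

import Mathlib

open MeasureTheory ProbabilityTheory Filter Topology Set Asymptotics

universe u v

noncomputable section

/-- The time interval `[0,1)`. -/
abbrev UnitTime : Type := Set.Ico (0 : ℝ) 1

/-- The set of infinite permutations, i.e. bijections of `{1, 2, 3, …}`. -/
abbrev InfPerm : Type := Equiv.Perm ℕ+

/-- The product (evaluation) σ-algebra on infinite permutations: the smallest one for which every
`σ ↦ σ(i)` is measurable. -/
instance InfPerm.instMeasurableSpace : MeasurableSpace InfPerm :=
  ⨆ i : ℕ+, MeasurableSpace.comap (fun σ : InfPerm => (σ i : ℕ)) ⊤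

/-- The right-inversion count `r_i(σ) = #{j > i : σ(j) < σ(i)}` (the set is always finite). -/
def rightInv (i : ℕ+) (σ : InfPerm) : ℕ :=
  Set.ncard {j : ℕ+ | i < j ∧ σ j < σ i}

/-- `μ` is the infinite Mallows distribution with parameter `q ∈ [0,1)`: under `μ`, the variables
`r_i + 1`, `i ≥ 1`, are independent with the geometric distribution on `{1, 2, …}` giving mass
`(1 - q) q ^ (k - 1)` to `k`. -/
structure IsInfMallows (q : UnitTime) (μ : Measure InfPerm) : Prop where
  indep : iIndepFun (fun (i : ℕ+) (σ : InfPerm) => rightInv i σ) μ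
  geometric : ∀ (i : ℕ+) (k : ℕ),
    μ {σ | rightInv i σ = k} = ENNReal.ofReal ((1 - (q : ℝ)) * (q : ℝ) ^ k)

section Processes

variable {Ω : Type*} [MeasurableSpace Ω] {E : Type*} [MeasurableSpace E]

/-- `X` is a (possibly time-inhomogeneous) Markov process on `[0,1)` with respect to its own
filtration: given the past up to time `s`, the conditional law of `X_t` depends on `X_s` only. -/
structure IsMarkov (X : UnitTime → Ω → E) (P : Measure Ω) : Prop where
  measurable : ∀ t, Measurable (X t)
  markov : ∀ s t : UnitTime, s ≤ t → ∀ A : Set E, MeasurableSet A →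
    P⟦X t ⁻¹' A | ⨆ r : Set.Iic s, MeasurableSpace.comap (X r) inferInstance⟧
      =ᵐ[P] P⟦X t ⁻¹' A | MeasurableSpace.comap (X s) inferInstance⟧

/-- A right-continuous path with left limits, with values in the discrete space `ℕ`. -/
def IsCadlagPath (x : UnitTime → ℕ) : Prop :=
  ∀ t, ContinuousWithinAt x (Set.Ici t) t ∧ ∃ l : ℕ, Tendsto x (𝓝[<] t) (𝓝 l)

/-- The conditional probability `P(X_u = k | X_t = j)`. -/
def transProb (X : UnitTime → Ω → ℕ) (P : Measure Ω) (t u : UnitTime) (j k : ℕ) : ℝ :=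
  (P[|X t ⁻¹' {j}]).real (X u ⁻¹' {k})

/-- `X` is a birth process on `[0,1)`, with values in `ℕ` (hence non-explosive) and with
infinitesimal birth rates `p j t`: a càdlàg Markov process, with no deterministic jump time, such
that for every `t` and every state `j` with `P(X_t = j) > 0`, as `h = u - t` decreases to `0`,
`P(X_{t+h} = j | X_t = j) = 1 - h p(j,t) + o(h)` and
`P(X_{t+h} = j+1 | X_t = j) = h p(j,t) + o(h)`. -/
structure IsBirthProcessWithRates (X : UnitTime → Ω → ℕ) (p : ℕ → UnitTime → ℝ)
    (P : Measure Ω) : Prop where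
  markov : IsMarkov X P
  cadlag : ∀ᵐ ω ∂P, IsCadlagPath (fun t => X t ω)
  no_fixed_jump : ∀ t, ∀ᵐ ω ∂P, ContinuousAt (fun s => X s ω) t
  rate_nonneg : ∀ j t, 0 ≤ p j t
  rate_stay : ∀ (t : UnitTime) (j : ℕ), P (X t ⁻¹' {j}) ≠ 0 →
    (fun u : UnitTime => transProb X P t u j j - (1 - ((u : ℝ) - t) * p j t))
      =o[𝓝[>] t] (fun u : UnitTime => (u : ℝ) - t)
  rate_birth : ∀ (t : UnitTime) (j : ℕ), P (X t ⁻¹' {j}) ≠ 0 →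
    (fun u : UnitTime => transProb X P t u j (j + 1) - ((u : ℝ) - t) * p j t)
      =o[𝓝[>] t] (fun u : UnitTime => (u : ℝ) - t)

/-- `X` is a birth process, for some infinitesimal birth rates. -/
def IsBirthProcess (X : UnitTime → Ω → ℕ) (P : Measure Ω) : Prop :=
  ∃ p : ℕ → UnitTime → ℝ, IsBirthProcessWithRates X p P

/-- The geometric birth process: the birth process started at `1` with birth rates
`p(j,t) = j / (1 - t)`. -/
structure IsGeometricBirthProcess (R : UnitTime → Ω → ℕ) (P : Measure Ω) : Prop where
  birth : IsBirthProcessWithRates R (fun j t => (j : ℝ) / (1 - (t : ℝ))) P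
  start : ∀ᵐ ω ∂P, R ⟨0, by norm_num⟩ ω = 1

/-- A Markov process of infinite permutations, indexed by `[0,1)`, with infinite Mallows
marginals and with right-inversion counts that are independent birth processes. -/
structure IsInfMallowsProcess (S : UnitTime → Ω → InfPerm) (P : Measure Ω) : Prop where
  markov : IsMarkov S P
  marginal : ∀ t : UnitTime, IsInfMallows t (P.map (S t))
  birth : ∀ i : ℕ+, IsBirthProcess (fun t ω => rightInv i (S t ω)) P
  indep : iIndepFun (fun (i : ℕ+) (ω : Ω) (t : UnitTime) => rightInv i (S t ω)) P

end Processes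

end

/-! A permutation is recovered from its right-inversion counts: its value at a position is
determined by its rank among the values not used at earlier positions, and this rank is the count.
Conversely, any sequence of counts with infinitely many zeros comes from a permutation
(`rightInv_permOfCode`), and the counts generate the σ-algebra
(`InfPerm.measurableSpace_eq_comap_code`). Everything thus reduces to independent birth processes
`X` on ℕ with P(X_t = k) = (1 - t) t^k.

Uniqueness: these marginals determine the law of `X`. The rates only control transitions from a
fixed time, so monotonicity of the paths needs an argument: downward jumps are o(h) near each
positive time (`IsGeomBirth.jumpSet_isLittleO`), hence their probability, as a function of the right
endpoint, has zero right derivative and vanishes (`IsGeomBirth.measure_jumpSet_eq_zero`). Monotone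
paths give a forward equation with finitely many terms, also on an event of the past
(`IsGeomBirth.hasDerivWithinAt_rates`). Comparison with the derivative of (1 - t) t^k forces the
rate (k + 1)/(1 - t) in every state of positive mass (`IsGeomBirth.rate_mul_eq`). The forward
equation is then a triangular linear system with a unique solution, and induction on the number of
times gives the finite-dimensional laws (`IsGeomBirth.finiteDim_eq`). The same rate computation,
shifted by one, identifies the geometric birth processes.

Existence: the Yule process leaving state j at rate j + 1, run at time -log(1 - t), has exactly
these marginals and rates. It is built from i.i.d. exponential variables; lack of memory yields the
Markov property (`expSeq_inState_inter`) and explicit transition probabilities (`expSeq_inState`).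
For an independent sequence of such processes, the second Borel–Cantelli lemma and monotonicity
give, almost surely, infinitely many processes in state 0 at every time simultaneously, so the
counts define permutations throughout [0,1). The Markov property of the permutations holds because
transition kernels multiply over independent coordinates (`isMarkov_of_rightInv`). -/

noncomputable section

/-! ### Coding infinite permutations by their right-inversion counts -/

/-- The permutation read on `{0, 1, 2, …}`. -/
def InfPerm.shift (σ : InfPerm) (n : ℕ) : ℕ := (σ n.succPNat).natPred

lemma InfPerm.shift_injective (σ : InfPerm) : Function.Injective σ.shift := fun m n h => by
  have := PNat.natPred_injective h
  simpa using this

/-- A value below σ(n) not used before position n is taken at a later position, by surjectivity. So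
the inversions at n correspond, through σ, to the smaller values still available: the count is the
rank of σ(n) among available values. -/
lemma rightInv_succPNat (n : ℕ) (σ : InfPerm) [DecidablePred fun v => ∀ j < n, v ≠ σ.shift j] :
    rightInv n.succPNat σ = Nat.count (fun v => ∀ j < n, v ≠ σ.shift j) (σ.shift n) := by
  have hs : (((Finset.range (σ.shift n)).filter fun v => ∀ j < n, v ≠ σ.shift j : Finset ℕ) : Set ℕ)
      = {v | v < (σ n.succPNat).natPred ∧ ∀ j < n, v ≠ (σ j.succPNat).natPred} := by
    ext v
    rw [Finset.mem_coe, Finset.mem_filter, Finset.mem_range]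
    rfl
  rw [Nat.count_eq_card_filter_range, ← Set.ncard_coe_finset, rightInv, hs]
  refine Set.ncard_congr (fun j _ => (σ j).natPred) ?_ ?_ ?_
  · rintro j ⟨hj, hσ⟩
    refine ⟨PNat.natPred_lt_natPred.2 hσ, fun m hm h => ?_⟩
    have := σ.injective (PNat.natPred_injective h)
    subst this
    exact absurd (Nat.succPNat_lt_succPNat.1 hj) (by omega)
  · intro a b _ _ h
    exact σ.injective (PNat.natPred_injective h)
  · intro v hv
    refine ⟨σ.symm v.succPNat, ⟨?_, ?_⟩, by simp⟩
    · by_contra hle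
      obtain ⟨m, hm⟩ : ∃ m : ℕ, σ.symm v.succPNat = m.succPNat :=
        ⟨(σ.symm v.succPNat).natPred, by simp⟩
      have hv' : v = (σ m.succPNat).natPred := by rw [← hm]; simp
      rw [hm, not_lt, Nat.succPNat_le_succPNat] at hle
      rcases hle.lt_or_eq with h | h
      · exact hv.2 m h hv'
      · subst h
        exact absurd hv.1 (by omega)
    · rw [Equiv.apply_symm_apply]
      have := Nat.succPNat_lt_succPNat.2 hv.1
      simpa using this

lemma infinite_ofPred_forall_ne (n : ℕ) (a : ℕ → ℕ) : (Set.ofPred fun v => ∀ j < n, v ≠ a j).Infinite := by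
  have h : (Set.ofPred fun v => ∀ j < n, v ≠ a j) = (a '' Set.Iio n)ᶜ := by
    ext v
    simp only [Set.mem_ofPred_eq, Set.mem_compl_iff, Set.mem_image, Set.mem_Iio, not_exists, not_and]
    exact forall₂_congr fun j _ => ne_comm
  rw [h]
  exact ((Set.finite_Iio n).image a).infinite_compl

/-- The sequence with code `c`: its `n`-th value is the `c n`-th number not used before. -/
def decode (c : ℕ → ℕ) (n : ℕ) : ℕ :=
  Nat.nth (fun v => ∀ j, ∀ _ : j < n, v ≠ decode c j) (c n)
termination_by n

lemma decode_eq (c : ℕ → ℕ) (n : ℕ) :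
    decode c n = Nat.nth (fun v => ∀ j < n, v ≠ decode c j) (c n) := by
  rw [decode]

lemma decode_ne (c : ℕ → ℕ) {j n : ℕ} (h : j < n) : decode c n ≠ decode c j := by
  have := Nat.nth_mem_of_infinite (infinite_ofPred_forall_ne n (decode c)) (c n)
  rw [← decode_eq] at this
  exact this j h

lemma decode_injective (c : ℕ → ℕ) : Function.Injective (decode c) := fun m n h => by
  rcases lt_trichotomy m n with h' | h' | h'
  · exact absurd h.symm (decode_ne c h')
  · exact h'
  · exact absurd h (decode_ne c h')

lemma count_decode (c : ℕ → ℕ) (n : ℕ) [DecidablePred fun v => ∀ j < n, v ≠ decode c j] :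
    Nat.count (fun v => ∀ j < n, v ≠ decode c j) (decode c n) = c n := by
  conv_lhs => rw [decode_eq]
  exact Nat.count_nth_of_infinite (infinite_ofPred_forall_ne n (decode c)) (c n)

/-- A value `v` that is never taken stays available forever, so each zero of `c` selects a value at
most `v`. Infinitely many zeros contradict injectivity. -/
lemma decode_surjective {c : ℕ → ℕ} (hc : ∃ᶠ n in atTop, c n = 0) :
    Function.Surjective (decode c) := by
  intro v
  by_contra! hv
  have hle : ∀ n ∈ {n | c n = 0}, decode c n ∈ Set.Iic v := fun n hn => by
    rw [Set.mem_ofPred_eq] at hn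
    rw [decode_eq, hn, Nat.nth_zero]
    exact Nat.sInf_le fun j _ => (hv j).symm
  exact ((Nat.frequently_atTop_iff_infinite.1 hc).mono hle).elim
    ((Set.finite_Iic v).preimage (decode_injective c).injOn)

open Classical in
lemma decode_rightInv (σ : InfPerm) : decode (fun n => rightInv n.succPNat σ) = σ.shift := by
  funext n
  induction n using Nat.strong_induction_on with
  | _ n ih =>
    have hp : (fun v => ∀ j < n, v ≠ decode (fun n => rightInv n.succPNat σ) j)
        = fun v => ∀ j < n, v ≠ σ.shift j := by
      funext v
      exact propext (forall₂_congr fun j hj => by rw [ih j hj])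
    rw [decode_eq, hp, rightInv_succPNat]
    exact Nat.nth_count fun j hj h => hj.ne' (σ.shift_injective h)

/-- The permutation with a given code, or the identity if there is none. -/
def permOfCode (c : ℕ+ → ℕ) : InfPerm :=
  open Classical in
  if h : ∃ᶠ n in atTop, c (Nat.succPNat n) = 0 then
    (Equiv.pnatEquivNat.trans (Equiv.ofBijective (decode fun n => c n.succPNat)
      ⟨decode_injective _, decode_surjective h⟩)).trans Equiv.pnatEquivNat.symm
  else 1

open Classical in
lemma rightInv_permOfCode {c : ℕ+ → ℕ} (h : ∃ᶠ n in atTop, c (Nat.succPNat n) = 0) (i : ℕ+) :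
    rightInv i (permOfCode c) = c i := by
  obtain ⟨n, rfl⟩ : ∃ n : ℕ, i = n.succPNat := ⟨i.natPred, by simp⟩
  have hs : (permOfCode c).shift = decode fun n => c n.succPNat := by
    funext m
    simp only [InfPerm.shift, permOfCode, h, dite_true]
    rfl
  rw [rightInv_succPNat]
  simp only [hs]
  exact count_decode (fun n => c n.succPNat) n

/-- The code of a permutation. -/
def InfPerm.code (σ : InfPerm) (i : ℕ+) : ℕ := rightInv i σ

/-- Such a function factors through finitely many ℕ-valued coordinates, a countable discrete space.
-/
lemma measurable_of_forall_le_congr {f : (ℕ → ℕ) → ℕ} (n : ℕ)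
    (hf : ∀ c c' : ℕ → ℕ, (∀ m ≤ n, c m = c' m) → f c = f c') : Measurable f := by
  have : f = (fun x : Fin (n + 1) → ℕ => f fun m => if h : m < n + 1 then x ⟨m, h⟩ else 0)
      ∘ fun c m => c m := by
    funext c
    refine hf _ _ fun m hm => ?_
    simp [Nat.lt_succ_of_le hm]
  rw [this]
  exact (measurable_of_countable _).comp (by fun_prop)

lemma decode_congr {c c' : ℕ → ℕ} (n : ℕ) (h : ∀ m ≤ n, c m = c' m) : decode c n = decode c' n := by
  induction n using Nat.strong_induction_on with
  | _ n ih =>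
    rw [decode_eq, decode_eq, h n le_rfl]
    congr 1
    funext v
    exact propext (forall₂_congr fun j hj => by
      rw [ih j hj fun m hm => h m (hm.trans hj.le)])

lemma measurable_decode (n : ℕ) : Measurable fun c => decode c n :=
  measurable_of_forall_le_congr n fun _ _ h => decode_congr n h

lemma InfPerm.measurable_apply (i : ℕ+) : Measurable fun σ : InfPerm => (σ i : ℕ) :=
  Measurable.of_comap_le (le_iSup (fun i : ℕ+ =>
    MeasurableSpace.comap (fun σ : InfPerm => (σ i : ℕ)) ⊤) i)

open Classical in
lemma measurable_rightInv (i : ℕ+) : Measurable (rightInv i) := by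
  obtain ⟨n, rfl⟩ : ∃ n : ℕ, i = n.succPNat := ⟨i.natPred, by simp⟩
  have hf : Measurable fun a : ℕ → ℕ => Nat.count (fun v => ∀ j < n, v ≠ a j) (a n) := by
    refine measurable_of_forall_le_congr n fun c c' h => ?_
    have : (fun v => ∀ j < n, v ≠ c j) = fun v => ∀ j < n, v ≠ c' j := by
      funext v
      exact propext (forall₂_congr fun j hj => by rw [h j hj.le])
    simp only [this, h n le_rfl]
  have hg : Measurable fun σ : InfPerm => σ.shift := by
    refine measurable_pi_iff.2 fun m => ?_
    have : (fun σ : InfPerm => σ.shift m) = (fun k : ℕ => k - 1) ∘ fun σ : InfPerm =>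
      (σ m.succPNat : ℕ) := rfl
    rw [this]
    exact (measurable_of_countable _).comp (InfPerm.measurable_apply _)
  rw [show rightInv n.succPNat = _ from funext fun σ => rightInv_succPNat n σ]
  exact hf.comp hg

lemma measurable_code : Measurable InfPerm.code :=
  measurable_pi_iff.2 measurable_rightInv

/-- Decoding computes each value of σ from finitely many counts. Questions about laws and generated
σ-algebras of permutations therefore transfer to the counts. -/
lemma InfPerm.measurableSpace_eq_comap_code :
    InfPerm.instMeasurableSpace = MeasurableSpace.comap InfPerm.code inferInstance := by
  refine le_antisymm (iSup_le fun i => ?_) measurable_code.comap_le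
  obtain ⟨n, rfl⟩ : ∃ n : ℕ, i = n.succPNat := ⟨i.natPred, by simp⟩
  have : (fun σ : InfPerm => (σ n.succPNat : ℕ))
      = (fun c : ℕ+ → ℕ => decode (fun n => c n.succPNat) n + 1) ∘ InfPerm.code := by
    funext σ
    simp only [Function.comp_apply, InfPerm.code]
    rw [decode_rightInv]
    simp [InfPerm.shift, PNat.natPred_add_one]
  rw [this, ← MeasurableSpace.comap_comp]
  refine MeasurableSpace.comap_mono ?_
  have hm : Measurable fun c : ℕ+ → ℕ => decode (fun n => c n.succPNat) n + 1 :=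
    ((measurable_decode n).comp (by fun_prop)).add_const 1
  exact hm.comap_le

/-! ### Birth processes indexed by real times -/

section RealTime

set_option linter.unusedSectionVars false

variable {Ω : Type*}

/-- The σ-algebra of the past of a process up to time `s`. -/
@[reducible] def pastAlg (X : ℝ → Ω → ℕ) (s : ℝ) : MeasurableSpace Ω :=
  ⨆ r : Set.Icc 0 s, MeasurableSpace.comap (X r) ⊤

/-- The process is in state `k` throughout the interval `[a, b]`. -/
def stayEvent (X : ℝ → Ω → ℕ) (k : ℕ) (a b : ℝ) : Set Ω :=
  {ω | ∀ w ∈ Icc a b, X w ω = k}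

variable [MeasurableSpace Ω]

/-- A birth process on `[0,1)` given by a family indexed by `ℝ`, with shifted geometric marginals:
the Markov property, the path properties and the rates are expressed by joint probabilities. -/
structure IsGeomBirth (X : ℝ → Ω → ℕ) (p : ℕ → ℝ → ℝ) (P : Measure Ω) : Prop where
  meas : ∀ t, Measurable (X t)
  markov : ∀ s t, 0 ≤ s → s ≤ t → t < 1 → ∀ B, MeasurableSet[pastAlg X s] B → ∀ i k,
    P.real (B ∩ X s ⁻¹' {i} ∩ X t ⁻¹' {k}) * P.real (X s ⁻¹' {i})
      = P.real (B ∩ X s ⁻¹' {i}) * P.real (X s ⁻¹' {i} ∩ X t ⁻¹' {k})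
  right_cont : ∀ᵐ ω ∂P, ∀ t, 0 ≤ t → t < 1 → ∀ᶠ w in 𝓝[>] t, X w ω = X t ω
  left_lim : ∀ᵐ ω ∂P, ∀ t, 0 < t → t < 1 → ∃ l, ∀ᶠ w in 𝓝[<] t, X w ω = l
  no_fixed_jump : ∀ t, 0 < t → t < 1 → ∀ᵐ ω ∂P, ∀ᶠ w in 𝓝[<] t, X w ω = X t ω
  marginal : ∀ t, 0 ≤ t → t < 1 → ∀ k, P.real (X t ⁻¹' {k}) = (1 - t) * t ^ k
  stay : ∀ t, 0 ≤ t → t < 1 → ∀ j,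
    (fun u => P.real (X t ⁻¹' {j} ∩ X u ⁻¹' {j}) - P.real (X t ⁻¹' {j}) * (1 - (u - t) * p j t))
      =o[𝓝[>] t] fun u => u - t
  birth : ∀ t, 0 ≤ t → t < 1 → ∀ j,
    (fun u => P.real (X t ⁻¹' {j} ∩ X u ⁻¹' {j + 1}) - P.real (X t ⁻¹' {j}) * ((u - t) * p j t))
      =o[𝓝[>] t] fun u => u - t

/-- The path jumps from `j` to `k` at some time in `(a, b]`. -/
def jumpSet (X : ℝ → Ω → ℕ) (j k : ℕ) (a b : ℝ) : Set Ω :=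
  {ω | ∃ w ∈ Ioc a b, (∀ᶠ r in 𝓝[<] w, X r ω = j) ∧ X w ω = k}

/-- The process is equal to `k` at the times `v a, …, v b`. -/
def constSet (X : ℝ → Ω → ℕ) (v : ℕ → ℝ) (k a b : ℕ) : Set Ω :=
  {ω | ∀ m, a ≤ m → m ≤ b → X (v m) ω = k}

variable {X : ℝ → Ω → ℕ} {p : ℕ → ℝ → ℝ} {P : Measure Ω}

lemma measurableSet_pastAlg {r s : ℝ} (hr : 0 ≤ r) (hrs : r ≤ s) (D : Set ℕ) :
    MeasurableSet[pastAlg X s] (X r ⁻¹' D) :=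
  le_iSup (fun r : Set.Icc 0 s => MeasurableSpace.comap (X r) ⊤) ⟨r, hr, hrs⟩ _ ⟨D, trivial, rfl⟩

lemma pastAlg_mono {s t : ℝ} (h : s ≤ t) : pastAlg X s ≤ pastAlg X t :=
  iSup_le fun r => le_iSup (fun r : Set.Icc 0 t => MeasurableSpace.comap (X r) ⊤)
    ⟨r, r.2.1, r.2.2.trans h⟩

lemma pastAlg_le (hX : ∀ t, Measurable (X t)) (s : ℝ) : pastAlg X s ≤ ‹MeasurableSpace Ω› :=
  iSup_le fun r => (hX r).comap_le

lemma constSet_eq (v : ℕ → ℝ) (k a b : ℕ) :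
    constSet X v k a b = ⋂ m ∈ Finset.Icc a b, X (v m) ⁻¹' {k} := by
  ext ω
  simp [constSet]

lemma constSet_self (v : ℕ → ℝ) (k a : ℕ) : constSet X v k a a = X (v a) ⁻¹' {k} := by
  simp [constSet_eq]

lemma constSet_succ (v : ℕ → ℝ) (k : ℕ) {a b : ℕ} (h : a ≤ b) :
    constSet X v k a (b + 1) = constSet X v k a b ∩ X (v b) ⁻¹' {k} ∩ X (v (b + 1)) ⁻¹' {k} := by
  ext ω
  constructor
  · exact fun hω => ⟨⟨fun m h1 h2 => hω m h1 (by omega), hω b h (by omega)⟩,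
      hω (b + 1) (by omega) le_rfl⟩
  · rintro ⟨⟨h1, -⟩, h2⟩ m hm hm'
    rcases hm'.lt_or_eq with h' | rfl
    · exact h1 m hm (by omega)
    · exact h2

lemma constSet_subset (v : ℕ → ℝ) (k : ℕ) {a b m : ℕ} (h : a ≤ m) (h' : m ≤ b) :
    constSet X v k a b ⊆ X (v m) ⁻¹' {k} := fun _ hω => hω m h h'

lemma measurableSet_constSet_pastAlg {v : ℕ → ℝ} (hv : Monotone v) (hv0 : 0 ≤ v 0) (k a : ℕ)
    {b : ℕ} {s : ℝ} (hs : v b ≤ s) : MeasurableSet[pastAlg X s] (constSet X v k a b) := by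
  rw [constSet_eq]
  refine Finset.measurableSet_biInter _ fun m hm => measurableSet_pastAlg
    (hv0.trans (hv m.zero_le)) ((hv (Finset.mem_Icc.1 hm).2).trans hs) _

variable [IsProbabilityMeasure P]

/-! ### Absence of downward jumps -/

namespace IsGeomBirth

/-- The Markov property at `v (m + 1)` and at `v m` gives equality up to the factors P(X_{v(m+1)} =
k) and P(X_{v m} = j) on the right, which are at most one. -/
lemma grid_mul_le (hX : IsGeomBirth X p P) {v : ℕ → ℝ} (hv : Monotone v) (hv0 : 0 ≤ v 0)
    {n m : ℕ} (hvn : v n < 1) (hm : m < n) (j k : ℕ) :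
    P.real (constSet X v j 0 m) * P.real (X (v m) ⁻¹' {j} ∩ X (v (m + 1)) ⁻¹' {k})
      * P.real (constSet X v k (m + 1) n)
      ≤ P.real (constSet X v j 0 m ∩ constSet X v k (m + 1) n) := by
  have hnn : ∀ l, 0 ≤ v l := fun l => hv0.trans (hv l.zero_le)
  set J := constSet X v j 0 m
  -- Independence of past and future given X_{v(m+1)} = k. The hypothesis `markov` treats one future
  -- time, so the future is extended one grid point at a time.
  have key : ∀ l, m + 1 ≤ l → l ≤ n →
      P.real (J ∩ constSet X v k (m + 1) l) * P.real (X (v (m + 1)) ⁻¹' {k})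
        = P.real (J ∩ X (v (m + 1)) ⁻¹' {k}) * P.real (constSet X v k (m + 1) l) := by
    intro l hl
    induction l, hl using Nat.le_induction with
    | base => intro _; rw [constSet_self]
    | succ l hl ih =>
      intro hln
      have ih := ih (by omega)
      have h1 := hX.markov (v l) (v (l + 1)) (hnn l) (hv (by omega)) ((hv hln).trans_lt hvn)
        (J ∩ constSet X v k (m + 1) l)
        ((measurableSet_constSet_pastAlg hv hv0 _ _ (hv (by omega))).inter
          (measurableSet_constSet_pastAlg hv hv0 _ _ le_rfl)) k k
      have h2 := hX.markov (v l) (v (l + 1)) (hnn l) (hv (by omega)) ((hv hln).trans_lt hvn)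
        (constSet X v k (m + 1) l) (measurableSet_constSet_pastAlg hv hv0 _ _ le_rfl) k k
      have hc : constSet X v k (m + 1) l ∩ X (v l) ⁻¹' {k} = constSet X v k (m + 1) l :=
        inter_eq_left.2 (constSet_subset v k hl le_rfl)
      rw [constSet_succ v k hl, ← inter_assoc, ← inter_assoc]
      rw [inter_assoc J, hc] at h1 ⊢
      -- The next case split is on the mass to be cancelled; when it vanishes, both sides vanish.
      rw [hc] at h2
      by_cases hy : P.real (X (v l) ⁻¹' {k}) = 0
      · have hz : ∀ S : Set Ω, S ⊆ constSet X v k (m + 1) l → P.real S = 0 := fun S hS =>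
          le_antisymm (hy ▸ measureReal_mono (hS.trans (constSet_subset v k hl le_rfl)))
            measureReal_nonneg
        rw [hz _ (inter_subset_left.trans inter_subset_right), hz _ inter_subset_left]
        ring
      · refine mul_right_cancel₀ hy ?_
        linear_combination P.real (X (v (m + 1)) ⁻¹' {k}) * h1
          - P.real (J ∩ X (v (m + 1)) ⁻¹' {k}) * h2
          + P.real (X (v l) ⁻¹' {k} ∩ X (v (l + 1)) ⁻¹' {k}) * ih
  have h1 := key n hm le_rfl
  have h2 := hX.markov (v m) (v (m + 1)) (hnn m) (hv (by omega)) ((hv hm).trans_lt hvn)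
    J (measurableSet_constSet_pastAlg hv hv0 _ _ le_rfl) j k
  have hJ : J ∩ X (v m) ⁻¹' {j} = J := inter_eq_left.2 (constSet_subset v j (Nat.zero_le _) le_rfl)
  rw [hJ] at h2
  calc _ = P.real (J ∩ constSet X v k (m + 1) n) *
        (P.real (X (v (m + 1)) ⁻¹' {k}) * P.real (X (v m) ⁻¹' {j})) := by
        linear_combination - P.real (constSet X v k (m + 1) n) * h2 - P.real (X (v m) ⁻¹' {j}) * h1
    _ ≤ _ := mul_le_of_le_one_right measureReal_nonneg
        (mul_le_one₀ measureReal_le_one measureReal_nonneg measureReal_le_one)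

/-- The events "at j up to grid point m, at k from grid point m + 1 on" are disjoint for different m
and all lie in the endpoint event. Each has at least c² times the probability of the corresponding
one-step transition, so the bound does not depend on the mesh. -/
lemma grid_sum_le (hX : IsGeomBirth X p P) {v : ℕ → ℝ} (hv : Monotone v) (hv0 : 0 ≤ v 0)
    {n : ℕ} (hvn : v n < 1) {j k : ℕ} (hjk : j ≠ k) {c : ℝ} (hc : 0 ≤ c)
    (hcj : c ≤ P.real (stayEvent X j (v 0) (v n))) (hck : c ≤ P.real (stayEvent X k (v 0) (v n))) :
    c * c * P.real (⋃ m ∈ Finset.range n, X (v m) ⁻¹' {j} ∩ X (v (m + 1)) ⁻¹' {k})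
      ≤ P.real (X (v 0) ⁻¹' {j} ∩ X (v n) ⁻¹' {k}) := by
  have hmeas : ∀ l a b, MeasurableSet (constSet X v l a b) := fun l a b =>
    pastAlg_le hX.meas _ _ (measurableSet_constSet_pastAlg hv hv0 l a le_rfl)
  have hstay : ∀ l a b, b ≤ n → stayEvent X l (v 0) (v n) ⊆ constSet X v l a b :=
    fun l a b hb ω hω m _ hm => hω _ ⟨hv (Nat.zero_le _), hv (hm.trans hb)⟩
  calc c * c * P.real (⋃ m ∈ Finset.range n, X (v m) ⁻¹' {j} ∩ X (v (m + 1)) ⁻¹' {k})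
      ≤ c * c * ∑ m ∈ Finset.range n, P.real (X (v m) ⁻¹' {j} ∩ X (v (m + 1)) ⁻¹' {k}) := by
        gcongr
        exact measureReal_biUnion_finset_le _ _
    _ = ∑ m ∈ Finset.range n, c * P.real (X (v m) ⁻¹' {j} ∩ X (v (m + 1)) ⁻¹' {k}) * c := by
        rw [Finset.mul_sum]
        exact Finset.sum_congr rfl fun m _ => by ring
    _ ≤ ∑ m ∈ Finset.range n, P.real (constSet X v j 0 m ∩ constSet X v k (m + 1) n) := by
        refine Finset.sum_le_sum fun m hm => ?_
        have hm := Finset.mem_range.1 hm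
        refine le_trans ?_ (hX.grid_mul_le hv hv0 hvn hm j k)
        gcongr
        · exact hcj.trans (measureReal_mono (hstay _ _ _ hm.le))
        · exact hck.trans (measureReal_mono (hstay _ _ _ le_rfl))
    _ = P.real (⋃ m ∈ Finset.range n, constSet X v j 0 m ∩ constSet X v k (m + 1) n) := by
        refine (measureReal_biUnion_finset ?_ fun m _ => (hmeas _ _ _).inter (hmeas _ _ _)).symm
        have hd : ∀ a b, a < b → b < n → Disjoint (constSet X v j 0 a ∩ constSet X v k (a + 1) n)
            (constSet X v j 0 b ∩ constSet X v k (b + 1) n) := fun a b hab hb =>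
          Set.disjoint_left.2 fun ω h1 h2 => hjk <|
            (h2.1 b (Nat.zero_le _) le_rfl).symm.trans (h1.2 b hab hb.le)
        intro a ha b hb hab
        rcases lt_or_gt_of_ne hab with h | h
        · exact hd a b h (by simpa using hb)
        · exact (hd b a h (by simpa using ha)).symm
    _ ≤ _ := by
        refine measureReal_mono (iUnion₂_subset fun m hm ω hω => ⟨hω.1 0 le_rfl (Nat.zero_le _),
          hω.2 n (Finset.mem_range.1 hm) le_rfl⟩)

lemma eventually_mem_grid {x : ℝ → ℕ} {a h w : ℝ} {j k : ℕ} (hh : 0 < h) (hw : w ∈ Ioc a (a + h))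
    (hl : ∀ᶠ r in 𝓝[<] w, x r = j) (hr : ∀ᶠ r in 𝓝[>] w, x r = k) (hk : x w = k) :
    ∀ᶠ n : ℕ in atTop, ∃ m < n, x (a + h * m / n) = j ∧ x (a + h * (m + 1 : ℕ) / n) = k := by
  obtain ⟨l, hl', hl⟩ := mem_nhdsLT_iff_exists_Ioo_subset.1 hl
  obtain ⟨r, hr', hr⟩ := mem_nhdsGT_iff_exists_Ioo_subset.1 hr
  have ht : Tendsto (fun n : ℕ => h / (n : ℝ)) atTop (𝓝 0) := tendsto_const_div_atTop_nhds_zero_nat h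
  filter_upwards [ht.eventually (gt_mem_nhds (sub_pos.2 hl')),
    ht.eventually (gt_mem_nhds (sub_pos.2 hr')), eventually_gt_atTop 0] with n h1 h2 hn
  have hn' : (0 : ℝ) < n := by exact_mod_cast hn
  -- The position of `w` in units of the mesh. With m = ⌈y⌉ - 1, the cell containing `w` is open on
  -- the left and closed on the right, as the left limit and the value at `w` require.
  set y := (w - a) * n / h
  have hy : 0 < y := div_pos (mul_pos (sub_pos.2 hw.1) hn') hh
  have hyn : y ≤ n := by
    rw [div_le_iff₀ hh, mul_comm]
    exact mul_le_mul_of_nonneg_left (by linarith [hw.2]) hn'.le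
  have hwy : w = a + h * y / n := by simp only [y]; field_simp; ring
  obtain ⟨m, hm⟩ : ∃ m : ℕ, ⌈y⌉₊ = m + 1 := ⟨⌈y⌉₊ - 1, by have := Nat.ceil_pos.2 hy; omega⟩
  have hm1 : (m : ℝ) < y := Nat.lt_ceil.1 (by omega)
  have hm2 : y ≤ (m + 1 : ℕ) := hm ▸ Nat.le_ceil y
  have hmn : m < n := by
    have : ⌈y⌉₊ ≤ n := Nat.ceil_le.2 hyn
    omega
  have hlt : a + h * m / n < w := by
    rw [hwy]; gcongr
  have hle : w ≤ a + h * (m + 1 : ℕ) / n := by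
    rw [hwy]; gcongr
  have hstep : a + h * (m + 1 : ℕ) / n = a + h * m / n + h / n := by push_cast; ring
  refine ⟨m, hmn, hl ⟨by linarith, hlt⟩, ?_⟩
  rcases hle.lt_or_eq with h' | h'
  · exact hr ⟨h', by linarith⟩
  · rw [← h', hk]

/-- A jump in continuous time is seen as a one-step transition by every sufficiently fine grid, and
`grid_sum_le` is uniform in the grid. -/
lemma jumpSet_le (hX : IsGeomBirth X p P) {a h : ℝ} (ha : 0 ≤ a) (hh : 0 < h) (hah : a + h < 1)
    {j k : ℕ} (hjk : j ≠ k) {c : ℝ} (hc : 0 < c)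
    (hcj : c ≤ P.real (stayEvent X j a (a + h))) (hck : c ≤ P.real (stayEvent X k a (a + h))) :
    P.real (jumpSet X j k a (a + h)) ≤
      P.real (X a ⁻¹' {j} ∩ X (a + h) ⁻¹' {k}) / (c * c) := by
  set E : ℕ → Set Ω := fun n => ⋃ m ∈ Finset.range n,
    X (a + h * m / n) ⁻¹' {j} ∩ X (a + h * (m + 1 : ℕ) / n) ⁻¹' {k}
  have hE : ∀ n, 0 < n → P.real (E n) ≤ P.real (X a ⁻¹' {j} ∩ X (a + h) ⁻¹' {k}) / (c * c) := by
    intro n hn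
    have hn' : (n : ℝ) ≠ 0 := by positivity
    have hv : Monotone fun m : ℕ => a + h * m / n := fun m m' hm => by
      dsimp only; gcongr
    have h0 : a + h * (0 : ℕ) / n = a := by simp
    have h1 : a + h * n / n = a + h := by field_simp
    have := hX.grid_sum_le hv (by simpa using ha) (by rw [h1]; exact hah) hjk hc.le
      (by simpa only [h0, h1] using hcj) (by simpa only [h0, h1] using hck)
    rw [le_div_iff₀ (mul_pos hc hc), mul_comm]
    simpa only [h0, h1] using this
  -- The jump event lies in the liminf of the grid events; the shift by `1` discards the meaningless
  -- grid with `n = 0`.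
  have hsub : jumpSet X j k a (a + h) ≤ᵐ[P] ⋃ N : ℕ, ⋂ n : ℕ, E (n + N + 1) := by
    filter_upwards [hX.right_cont] with ω hω hj
    obtain ⟨w, hw, hl, hk⟩ := hj
    have hr := hω w (ha.trans hw.1.le) (hw.2.trans_lt hah)
    rw [hk] at hr
    obtain ⟨N, hN⟩ := eventually_atTop.1 (eventually_mem_grid hh hw hl hr hk)
    refine mem_iUnion.2 ⟨N, mem_iInter.2 fun n => ?_⟩
    obtain ⟨m, hm, h1, h2⟩ := hN (n + N + 1) (by omega)
    exact mem_iUnion₂.2 ⟨m, Finset.mem_range.2 hm, h1, h2⟩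
  have hmono : Monotone fun N : ℕ => ⋂ n : ℕ, E (n + N + 1) := fun N N' hN ω hω =>
    mem_iInter.2 fun n => by
      have := mem_iInter.1 hω (n + N' - N)
      rwa [show n + N' - N + N + 1 = n + N' + 1 by omega] at this
  refine ENNReal.toReal_le_of_le_ofReal (by positivity) ((measure_mono_ae hsub).trans ?_)
  rw [hmono.measure_iUnion]
  refine iSup_le fun N => (measure_mono (iInter_subset _ 0)).trans ?_
  rw [← ENNReal.ofReal_toReal (measure_ne_top P (E (0 + N + 1)))]
  exact ENNReal.ofReal_le_ofReal (hE _ (by omega))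

/-- By right-continuity, {X_t = j} is almost surely covered by the events of staying at j during [t,
t + 1/(n + 1)], so one of these has positive probability. -/
lemma exists_stayEvent_pos (hX : IsGeomBirth X p P) {t : ℝ} (ht : 0 ≤ t) (ht1 : t < 1) {j : ℕ}
    (hj : P.real (X t ⁻¹' {j}) ≠ 0) :
    ∃ c > 0, ∃ δ > 0, ∀ h, h ≤ δ → c ≤ P.real (stayEvent X j t (t + h)) := by
  by_contra! H
  have hnull : ∀ n : ℕ, P (stayEvent X j t (t + 1 / (n + 1))) = 0 := by
    intro n
    by_contra hn
    have hpos : 0 < P.real (stayEvent X j t (t + 1 / (n + 1))) :=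
      ENNReal.toReal_pos hn (measure_ne_top _ _)
    obtain ⟨h, hh, hlt⟩ := H _ hpos (1 / (n + 1)) (by positivity)
    exact hlt.not_ge (measureReal_mono fun ω hω w hw => hω w ⟨hw.1, hw.2.trans (by linarith)⟩)
  refine hj ?_
  have : X t ⁻¹' {j} ≤ᵐ[P] ⋃ n : ℕ, stayEvent X j t (t + 1 / (n + 1)) := by
    filter_upwards [hX.right_cont] with ω hω hj
    obtain ⟨r, hr, hsub⟩ := mem_nhdsGT_iff_exists_Ioo_subset.1 (hω t ht ht1)
    obtain ⟨n, hn⟩ := exists_nat_one_div_lt (K := ℝ) (sub_pos.2 (mem_Ioi.1 hr))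
    refine mem_iUnion.2 ⟨n, fun w hw => ?_⟩
    rcases hw.1.eq_or_lt with h | h
    · rw [← h]; exact hj
    · exact (hsub ⟨h, by linarith [hw.2]⟩).trans hj
  rw [measureReal_def, measure_mono_null_ae this (measure_iUnion_null hnull), ENNReal.toReal_zero]

/-- The first-order terms of `stay` and `birth` cancel: staying and moving up by one already exhaust
the mass of {X_t = j} up to o(h). -/
lemma isLittleO_of_ne (hX : IsGeomBirth X p P) {t : ℝ} (ht : 0 ≤ t) (ht1 : t < 1) {j : ℕ}
    {D : Set ℕ} (h0 : j ∉ D) (h1 : j + 1 ∉ D) :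
    (fun u => P.real (X t ⁻¹' {j} ∩ X u ⁻¹' D)) =o[𝓝[>] t] fun u => u - t := by
  have hsum := ((hX.stay t ht ht1 j).add (hX.birth t ht ht1 j))
  refine IsBigO.trans_isLittleO (IsBigO.of_bound 1 (Eventually.of_forall fun u => ?_)) hsum
  have hms : ∀ s D, MeasurableSet (X s ⁻¹' D) := fun s D => hX.meas s (MeasurableSet.of_discrete (s := D))
  have hle : P.real (X t ⁻¹' {j} ∩ X u ⁻¹' {j}) + P.real (X t ⁻¹' {j} ∩ X u ⁻¹' {j + 1})
      + P.real (X t ⁻¹' {j} ∩ X u ⁻¹' D) ≤ P.real (X t ⁻¹' {j}) := by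
    rw [← measureReal_union _ ((hms _ _).inter (hms _ _)),
      ← measureReal_union _ ((hms _ _).inter (hms _ _))]
    · exact measureReal_mono (by
        rintro ω ((h | h) | h)
        exacts [h.1, h.1, h.1])
    · refine Set.disjoint_left.2 ?_
      rintro ω (h | h) h'
      · exact h0 (by have := h'.2; rw [mem_preimage, h.2] at this; exact this)
      · exact h1 (by have := h'.2; rw [mem_preimage, h.2] at this; exact this)
    · refine Set.disjoint_left.2 fun ω h h' => ?_
      have := h.2.symm.trans h'.2
      omega
  have h0 : 0 ≤ P.real (X t ⁻¹' {j} ∩ X u ⁻¹' D) := measureReal_nonneg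
  rw [Real.norm_of_nonneg h0, one_mul, Real.norm_eq_abs]
  refine le_trans ?_ (neg_le_abs _)
  linarith

lemma jumpSet_mono (j k : ℕ) {a a' b b' : ℝ} (ha : a' ≤ a) (hb : b ≤ b') :
    jumpSet X j k a b ⊆ jumpSet X j k a' b' := fun _ ⟨w, hw, h⟩ =>
  ⟨w, ⟨ha.trans_lt hw.1, hw.2.trans hb⟩, h⟩

lemma jumpSet_isLittleO (hX : IsGeomBirth X p P) {t : ℝ} (ht : 0 < t) (ht1 : t < 1) {j k : ℕ}
    (hjk : k < j) : (fun u => P.real (jumpSet X j k t u)) =o[𝓝[>] t] fun u => u - t := by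
  have hne : ∀ i, P.real (X t ⁻¹' {i}) ≠ 0 := fun i => by
    rw [hX.marginal t ht.le ht1]
    have : 0 < 1 - t := by linarith
    positivity
  obtain ⟨c, hc, δ, hδ, hcj⟩ := hX.exists_stayEvent_pos ht.le ht1 (hne j)
  obtain ⟨c', hc', δ', hδ', hck⟩ := hX.exists_stayEvent_pos ht.le ht1 (hne k)
  set d := min c c'
  have hd : 0 < d := lt_min hc hc'
  have ho := hX.isLittleO_of_ne ht.le ht1 (j := j) (D := {k}) (by simp; omega) (by simp; omega)
  refine IsBigO.trans_isLittleO (IsBigO.of_bound (1 / (d * d)) ?_) ho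
  have hev : ∀ᶠ u in 𝓝[>] t, u ∈ Ioo t (min 1 (t + min δ δ')) :=
    Ioo_mem_nhdsGT (lt_min ht1 (by have := lt_min hδ hδ'; linarith))
  filter_upwards [hev] with u hu
  have hu1 : u < 1 := hu.2.trans_le (min_le_left _ _)
  have hu2 : u < t + min δ δ' := hu.2.trans_le (min_le_right _ _)
  have := hX.jumpSet_le ht.le (sub_pos.2 hu.1) (by linarith) hjk.ne' hd
    ((min_le_left _ _).trans (hcj (u - t) (by linarith [min_le_left δ δ'])))
    ((min_le_right _ _).trans (hck (u - t) (by linarith [min_le_right δ δ'])))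
  rw [add_sub_cancel] at this
  rw [Real.norm_of_nonneg measureReal_nonneg, Real.norm_of_nonneg measureReal_nonneg]
  exact this.trans (by rw [div_eq_mul_inv, mul_comm, one_div])

/-- The estimate o(h) is not uniform in t, so it cannot be summed over a partition. Instead, the
jump probability as a function of the right endpoint is continuous with zero right derivative, hence
constant, and it starts at 0. -/
lemma measure_jumpSet_eq_zero (hX : IsGeomBirth X p P) {a b : ℝ} (ha : 0 < a) (hb : b < 1)
    {j k : ℕ} (hjk : k < j) : P (jumpSet X j k a b) = 0 := by
  rcases lt_or_ge b a with hab | hab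
  · have : jumpSet X j k a b = ∅ := by
      refine eq_empty_of_forall_notMem ?_
      rintro ω ⟨w, hw, -⟩
      exact absurd (hw.1.trans_le hw.2) (by linarith)
    rw [this, measure_empty]
  set f : ℝ → ℝ := fun u => P.real (jumpSet X j k a u)
  have hfm : Monotone f := fun u u' h => measureReal_mono (jumpSet_mono j k le_rfl h)
  have hfle : ∀ u u', f u' ≤ f u + P.real (jumpSet X j k u u') := fun u u' => by
    refine (measureReal_mono ?_).trans (measureReal_union_le _ _)
    rintro ω ⟨w, hw, h⟩
    rcases le_or_gt w u with h' | h'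
    · exact Or.inl ⟨w, ⟨hw.1, h'⟩, h⟩
    · exact Or.inr ⟨w, ⟨h', hw.2⟩, h⟩
  have hderiv : ∀ x ∈ Ico a b, HasDerivWithinAt f 0 (Ici x) x := by
    intro x hx
    rw [← hasDerivWithinAt_Ioi_iff_Ici, hasDerivWithinAt_iff_isLittleO]
    refine IsBigO.trans_isLittleO (IsBigO.of_bound 1 ?_)
      (hX.jumpSet_isLittleO (ha.trans_le hx.1) (hx.2.trans hb) hjk)
    filter_upwards [self_mem_nhdsWithin] with u hu
    rw [smul_zero, sub_zero, one_mul, Real.norm_of_nonneg (sub_nonneg.2 (hfm (le_of_lt hu))),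
      Real.norm_of_nonneg measureReal_nonneg]
    linarith [hfle x u]
  -- Left-continuity fails only through a jump exactly at `x`, which is excluded almost surely by
  -- `no_fixed_jump`.
  have hleft : ∀ x ∈ Ioc a b, Tendsto f (𝓝[<] x) (𝓝 (f x)) := by
    intro x hx
    obtain ⟨y, hy, hyx, hyt⟩ := exists_seq_strictMono_tendsto x
    have hsub : jumpSet X j k a x ≤ᵐ[P] ⋃ n, jumpSet X j k a (y n) := by
      filter_upwards [hX.no_fixed_jump x (ha.trans hx.1) (hx.2.trans_lt hb)] with ω hω hj
      obtain ⟨w, hw, h1, h2⟩ := hj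
      rcases hw.2.lt_or_eq with h | rfl
      · obtain ⟨n, hn⟩ := (hyt.eventually (lt_mem_nhds h)).exists
        exact mem_iUnion.2 ⟨n, w, ⟨hw.1, hn.le⟩, h1, h2⟩
      · obtain ⟨r, hr1, hr2⟩ := (h1.and hω).exists
        omega
    have hmono : Monotone fun n => jumpSet X j k a (y n) := fun n m h =>
      jumpSet_mono j k le_rfl (hy.monotone h)
    have hle : P (jumpSet X j k a x) ≤ ⨆ n, P (jumpSet X j k a (y n)) :=
      (measure_mono_ae hsub).trans hmono.measure_iUnion.le
    rw [tendsto_order]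
    refine ⟨fun l hl => ?_, fun l hl => ?_⟩
    · by_cases hl0 : l < 0
      · exact Eventually.of_forall fun u => hl0.trans_le measureReal_nonneg
      have hl' : ENNReal.ofReal l < P (jumpSet X j k a x) :=
        (ENNReal.ofReal_lt_iff_lt_toReal (not_lt.1 hl0) (measure_ne_top _ _)).2 hl
      obtain ⟨n, hn⟩ := lt_iSup_iff.1 (hl'.trans_le hle)
      have hn' : l < f (y n) :=
        (ENNReal.ofReal_lt_iff_lt_toReal (not_lt.1 hl0) (measure_ne_top _ _)).1 hn
      filter_upwards [Ioo_mem_nhdsLT (hyx n)] with u hu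
      exact hn'.trans_le (hfm hu.1.le)
    · filter_upwards [self_mem_nhdsWithin] with u hu
      exact (hfm (le_of_lt hu)).trans_lt hl
  have hcont : ContinuousOn f (Icc a b) := by
    intro x hx
    rcases hx.1.eq_or_lt with rfl | hax
    · rcases hx.2.eq_or_lt with h | h
      · rw [← h, Icc_self]; exact continuousWithinAt_singleton
      · exact (hderiv _ ⟨le_rfl, h⟩).continuousWithinAt.mono Icc_subset_Ici_self
    · have hl : ContinuousWithinAt f (Iic x) x :=
        continuousWithinAt_Iio_iff_Iic.1 (hleft x ⟨hax, hx.2⟩)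
      rcases hx.2.eq_or_lt with h | h
      · subst h; exact hl.mono Icc_subset_Iic_self
      · exact (continuousAt_iff_continuous_left_right.2
          ⟨hl, (hderiv x ⟨hx.1, h⟩).continuousWithinAt⟩).continuousWithinAt
  have hconst := constant_of_has_deriv_right_zero hcont hderiv b ⟨hab, le_rfl⟩
  have h0 : f a = 0 := by
    have : jumpSet X j k a a = ∅ := by
      refine eq_empty_of_forall_notMem ?_
      rintro ω ⟨w, hw, -⟩
      exact absurd (hw.1.trans_le hw.2) (lt_irrefl _)
    simp only [f, this, measureReal_empty]
  exact (measureReal_eq_zero_iff).1 (hconst.trans h0)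

end IsGeomBirth

end RealTime

/-- A càdlàg path in `ℕ` without downward jumps is nondecreasing. -/
lemma monotone_of_no_down_jump {x : ℝ → ℕ}
    (hr : ∀ t, 0 ≤ t → t < 1 → ∀ᶠ w in 𝓝[>] t, x w = x t)
    (hl : ∀ t, 0 < t → t < 1 → ∃ l, ∀ᶠ w in 𝓝[<] t, x w = l)
    (hj : ∀ t, 0 < t → t < 1 → ∀ l, (∀ᶠ w in 𝓝[<] t, x w = l) → l ≤ x t)
    {s t : ℝ} (hs : 0 ≤ s) (hst : s ≤ t) (ht : t < 1) : x s ≤ x t := by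
  -- Approach from the left uses that the left limit does not exceed the value; approach from the
  -- right uses right-continuity.
  have hclosed : IsClosed ({w | x s ≤ x w} ∩ Icc s t) := by
    refine isClosed_of_closure_subset fun w hw => ?_
    have hwI : w ∈ Icc s t := closure_minimal inter_subset_right isClosed_Icc hw
    refine ⟨?_, hwI⟩
    have hw0 : 0 ≤ w := hs.trans hwI.1
    have hw1 : w < 1 := hwI.2.trans_lt ht
    rw [mem_closure_iff_frequently, ← nhdsNE_sup_pure, frequently_sup,
      ← nhdsLT_sup_nhdsGT, frequently_sup] at hw
    rcases hw with (hw | hw) | hw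
    · obtain ⟨w', hw', hlt⟩ := (hw.and_eventually self_mem_nhdsWithin).exists
      have h0 : 0 < w := (hs.trans hw'.2.1).trans_lt hlt
      obtain ⟨l, hl⟩ := hl w h0 hw1
      obtain ⟨w'', h1, h2⟩ := (hw.and_eventually hl).exists
      have h1 : x s ≤ x w'' := h1.1
      exact (h1.trans h2.le).trans (hj w h0 hw1 l hl)
    · obtain ⟨w', h1, h2⟩ := (hw.and_eventually (hr w hw0 hw1)).exists
      have h1 : x s ≤ x w' := h1.1
      exact h1.trans h2.le
    · exact (frequently_pure.1 hw).1
  -- Continuous induction along [s, t]: right-continuity supplies points of the set just beyond each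
  -- of its points.
  have := hclosed.Icc_subset_of_forall_exists_gt (le_refl (x s)) ?_
  · exact this ⟨hst, le_rfl⟩
  · intro w hw y hy
    have h1 : x s ≤ x w := hw.1
    obtain ⟨z, hz, hz'⟩ := ((hr w (hs.trans hw.2.1) (hw.2.2.trans ht)).and
      (Ioc_mem_nhdsGT hy)).exists
    exact ⟨z, h1.trans hz.ge, hz'⟩

/-- A triangular linear system of ordinary differential equations has at most one solution. -/
lemma triangular_ode_eq_zero {g : ℕ → ℝ → ℝ} {s t : ℝ} (ht : t < 1)
    (hc : ∀ k, ContinuousOn (g k) (Icc s t))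
    (hd : ∀ k, ∀ u ∈ Ico s t, HasDerivWithinAt (g k)
      (k / (1 - u) * g (k - 1) u - (k + 1) / (1 - u) * g k u) (Ici u) u)
    (h0 : ∀ k, g k s = 0) (k : ℕ) : ∀ u ∈ Icc s t, g k u = 0 := by
  -- The factor `k` in the hypothesis makes it vacuous for k = 0, where `k - 1` is truncated.
  have hstep : ∀ k : ℕ, (∀ u ∈ Icc s t, (k : ℝ) * g (k - 1) u = 0) → ∀ u ∈ Icc s t, g k u = 0 := by
    intro k hk u hu
    have hne : ∀ w ∈ Icc s t, 1 - w ≠ 0 := fun w hw => by linarith [hw.2]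
    -- Integrating factor: without its inhomogeneous term the equation is g' = -(k + 1)/(1 - u) g,
    -- solved by multiples of (1 - u)^(k + 1).
    have := constant_of_has_deriv_right_zero (f := fun w => g k w / (1 - w) ^ (k + 1))
      ((hc k).div (by fun_prop) fun w hw => pow_ne_zero _ (hne w hw)) (fun w hw => by
        have hw' := hne w ⟨hw.1, hw.2.le⟩
        have h1 : HasDerivWithinAt (fun w : ℝ => (1 - w) ^ (k + 1))
            (((k + 1 : ℕ) : ℝ) * (1 - w) ^ k * (-1)) (Ici w) w :=
          (((hasDerivAt_id w).const_sub 1).pow (k + 1)).hasDerivWithinAt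
        have h2 := (hd k w hw).div h1 (pow_ne_zero _ hw')
        refine h2.congr_deriv ?_
        have := hk w ⟨hw.1, hw.2.le⟩
        rw [div_eq_zero_iff]
        left
        rw [div_mul_eq_mul_div, this]
        push_cast
        field_simp
        ring) u hu
    rw [h0, zero_div, div_eq_zero_iff] at this
    exact this.resolve_right (pow_ne_zero _ (hne u hu))
  induction k with
  | zero => exact hstep 0 fun u _ => by simp
  | succ k ih => exact hstep (k + 1) fun u hu => by rw [Nat.add_sub_cancel, ih u hu, mul_zero]

/-! ### Forward equation, rates and finite-dimensional laws -/

section RealTime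

set_option linter.unusedSectionVars false

variable {Ω : Type*} [MeasurableSpace Ω] {X : ℝ → Ω → ℕ} {p : ℕ → ℝ → ℝ} {P : Measure Ω}
  [IsProbabilityMeasure P]

namespace IsGeomBirth

lemma ae_monotone (hX : IsGeomBirth X p P) :
    ∀ᵐ ω ∂P, ∀ s t, 0 ≤ s → s ≤ t → t < 1 → X s ω ≤ X t ω := by
  -- Countably many null sets suffice: these intervals exhaust (0,1).
  have hnull : ∀ᵐ ω ∂P, ∀ (n j k : ℕ), k < j →
      ω ∉ jumpSet X j k (1 / (n + 1)) (1 - 1 / (n + 1)) := by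
    refine ae_all_iff.2 fun n => ae_all_iff.2 fun j => ae_all_iff.2 fun k => ?_
    by_cases hjk : k < j
    · filter_upwards [measure_eq_zero_iff_ae_notMem.1 (hX.measure_jumpSet_eq_zero
        (a := 1 / ((n : ℝ) + 1)) (b := 1 - 1 / ((n : ℝ) + 1)) (by positivity)
        (by have : 0 < 1 / ((n : ℝ) + 1) := by positivity
            linarith) hjk)] with ω hω _ using hω
    · exact Eventually.of_forall fun ω h => absurd h hjk
  filter_upwards [hX.right_cont, hX.left_lim, hnull] with ω hr hl hn s t hs hst ht
  refine monotone_of_no_down_jump (x := fun w => X w ω) hr hl (fun w hw hw1 l hlw => ?_) hs hst ht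
  by_contra! hlt
  obtain ⟨n, h⟩ := exists_nat_one_div_lt (lt_min hw (sub_pos.2 hw1))
  have h1 := h.trans_le (min_le_left _ _)
  have h2 := h.trans_le (min_le_right _ _)
  exact hn n l _ hlt ⟨w, ⟨h1, by linarith⟩, hlw, rfl⟩

lemma measurableSet_preimage (hX : IsGeomBirth X p P) (t : ℝ) (D : Set ℕ) :
    MeasurableSet (X t ⁻¹' D) := hX.meas t (MeasurableSet.of_discrete (s := D))

/-- By the Markov property, intersecting with the past event `B` multiplies the unconditional
expansion by the constant P(B, X_t = j)/P(X_t = j). -/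
lemma transition_isLittleO (hX : IsGeomBirth X p P) {t : ℝ} (ht : 0 ≤ t) (ht1 : t < 1)
    {B : Set Ω} (hB : MeasurableSet[pastAlg X t] B) (j k : ℕ) :
    (fun u => P.real (B ∩ X t ⁻¹' {j} ∩ X u ⁻¹' {k})
      - (if j = k then P.real (B ∩ X t ⁻¹' {j}) else 0)
      - (u - t) * (((if j + 1 = k then p j t else 0) - (if j = k then p j t else 0))
        * P.real (B ∩ X t ⁻¹' {j}))) =o[𝓝[>] t] fun u => u - t := by
  by_cases hm : P.real (X t ⁻¹' {j}) = 0
  · have hz : ∀ S ⊆ X t ⁻¹' {j}, P.real S = 0 := fun S hS =>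
      le_antisymm (hm ▸ measureReal_mono hS) measureReal_nonneg
    have h1 := hz _ (inter_subset_right (s := B))
    have h2 : ∀ u, P.real (B ∩ X t ⁻¹' {j} ∩ X u ⁻¹' {k}) = 0 := fun u =>
      hz _ (inter_subset_left.trans inter_subset_right)
    simp only [h1, h2, ite_self, mul_zero, sub_zero]
    exact isLittleO_zero _ _
  · set β := P.real (B ∩ X t ⁻¹' {j})
    have hmain : (fun u => P.real (X t ⁻¹' {j} ∩ X u ⁻¹' {k})
      - (if j = k then P.real (X t ⁻¹' {j}) else 0)
      - (u - t) * (((if j + 1 = k then p j t else 0) - (if j = k then p j t else 0))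
        * P.real (X t ⁻¹' {j}))) =o[𝓝[>] t] fun u => u - t := by
      by_cases h1 : j = k
      · subst h1
        refine (hX.stay t ht ht1 j).congr_left fun u => ?_
        simp only [if_true, Nat.succ_ne_self, if_false]
        ring
      by_cases h2 : j + 1 = k
      · subst h2
        refine (hX.birth t ht ht1 j).congr_left fun u => ?_
        simp only [if_true, h1, if_false]
        ring
      · refine (hX.isLittleO_of_ne ht ht1 (j := j) (D := {k}) (by simpa using h1)
          (by simpa using h2)).congr_left fun u => ?_
        simp only [h1, h2, if_false]
        ring
    refine ((hmain.const_mul_left (β / P.real (X t ⁻¹' {j})))).congr' ?_ EventuallyEq.rfl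
    filter_upwards [Ioo_mem_nhdsGT ht1] with u hu
    have := hX.markov t u ht hu.1.le hu.2 B hB j k
    rw [← eq_div_iff hm] at this
    rw [this]
    split_ifs <;> field_simp <;> ring

/-- Monotone paths reach k only from states j ≤ k. The sum is finite, so o(h) errors can be added.
-/
lemma eq_sum_transition (hX : IsGeomBirth X p P) {t u : ℝ} (ht : 0 ≤ t) (htu : t ≤ u)
    (hu : u < 1) (B : Set Ω) (k : ℕ) (hB : MeasurableSet B) :
    P.real (B ∩ X u ⁻¹' {k})
      = ∑ j ∈ Finset.range (k + 1), P.real (B ∩ X t ⁻¹' {j} ∩ X u ⁻¹' {k}) := by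
  rw [← measureReal_biUnion_finset]
  · refine measureReal_congr ?_
    filter_upwards [hX.ae_monotone] with ω hω
    refine propext ⟨fun h => ?_, fun h => ?_⟩
    · refine mem_iUnion₂.2 ⟨X t ω, ?_, ⟨h.1, rfl⟩, h.2⟩
      have h2 : X u ω = k := h.2
      exact Finset.mem_range.2 (by have := hω t u ht htu hu; omega)
    · obtain ⟨j, -, hj⟩ := mem_iUnion₂.1 h
      exact ⟨hj.1.1, hj.2⟩
  · intro a _ b _ hab
    exact Set.disjoint_left.2 fun ω h1 h2 => hab (h1.1.2.symm.trans h2.1.2)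
  · exact fun j _ => (hB.inter (hX.measurableSet_preimage _ _)).inter (hX.measurableSet_preimage _ _)

/-- Kolmogorov's forward equation, on an event of the past and with a one-sided derivative. -/
lemma hasDerivWithinAt_rates (hX : IsGeomBirth X p P) {t : ℝ} (ht : 0 ≤ t) (ht1 : t < 1)
    {B : Set Ω} (hB : MeasurableSet[pastAlg X t] B) (k : ℕ) :
    HasDerivWithinAt (fun u => P.real (B ∩ X u ⁻¹' {k}))
      (∑ j ∈ Finset.range (k + 1), ((if j + 1 = k then p j t else 0) - (if j = k then p j t else 0))
        * P.real (B ∩ X t ⁻¹' {j})) (Ici t) t := by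
  rw [← hasDerivWithinAt_Ioi_iff_Ici, hasDerivWithinAt_iff_isLittleO]
  have := IsLittleO.sum (s := Finset.range (k + 1)) fun j _ =>
    hX.transition_isLittleO ht ht1 hB j k
  refine this.congr' ?_ EventuallyEq.rfl
  filter_upwards [Ioo_mem_nhdsGT ht1] with u hu
  rw [Finset.sum_apply, Finset.sum_sub_distrib, Finset.sum_sub_distrib,
    ← hX.eq_sum_transition ht hu.1.le hu.2 B k (pastAlg_le hX.meas t _ hB), ← Finset.mul_sum,
    Finset.sum_ite_eq' , if_pos (Finset.self_mem_range_succ k), smul_eq_mul]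

lemma sum_rates_succ (q β : ℕ → ℝ) (k : ℕ) :
    ∑ j ∈ Finset.range (k + 1), ((if j + 1 = k then q j else 0) - (if j = k then q j else 0)) * β j
      = (if k = 0 then 0 else q (k - 1) * β (k - 1)) - q k * β k := by
  simp only [sub_mul, Finset.sum_sub_distrib, ite_mul, zero_mul, Finset.sum_ite_eq',
    Finset.self_mem_range_succ, if_true]
  congr 1
  rcases k with _ | k
  · simp
  · simp [Finset.sum_ite_eq']

lemma hasDerivAt_marginal (t : ℝ) (k : ℕ) :
    HasDerivAt (fun u : ℝ => (1 - u) * u ^ k) (-1 * t ^ k + (1 - t) * (k * t ^ (k - 1))) t :=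
  ((hasDerivAt_id t).const_sub 1).mul (hasDerivAt_pow k t)

/-- The birth rates are determined by the marginals. -/
lemma rate_mul_eq (hX : IsGeomBirth X p P) {t : ℝ} (ht : 0 ≤ t) (ht1 : t < 1) (k : ℕ) :
    p k t * ((1 - t) * t ^ k) = (k + 1) / (1 - t) * ((1 - t) * t ^ k) := by
  have h1t : 1 - t ≠ 0 := by linarith
  -- The right derivative of P(X_u = k) computed twice, from the explicit marginal and from the
  -- forward equation. This gives a recursion in k for the rates weighted by the marginals.
  have key : ∀ k : ℕ, -1 * t ^ k + (1 - t) * (k * t ^ (k - 1))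
      = (if k = 0 then 0 else p (k - 1) t * ((1 - t) * t ^ (k - 1))) - p k t * ((1 - t) * t ^ k) := by
    intro k
    have h1 := hX.hasDerivWithinAt_rates ht ht1 (MeasurableSet.univ) k
    simp only [univ_inter] at h1
    rw [sum_rates_succ (fun j => p j t) (fun j => P.real (X t ⁻¹' {j})),
      hX.marginal t ht ht1, hX.marginal t ht ht1] at h1
    have h2 : HasDerivWithinAt (fun u => P.real (X u ⁻¹' {k})) _ (Ici t) t :=
      (hasDerivAt_marginal t k).hasDerivWithinAt.congr_of_eventuallyEq_of_mem (by
        filter_upwards [Ico_mem_nhdsGE ht1] with u hu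
        exact hX.marginal u (ht.trans hu.1) hu.2 k) self_mem_Ici
    exact (uniqueDiffWithinAt_Ici t).eq_deriv _ h2 h1
  induction k with
  | zero =>
    have := key 0
    simp only [pow_zero, Nat.cast_zero, zero_mul, mul_zero, add_zero, if_true, zero_sub] at this ⊢
    field_simp
    linarith
  | succ k ih =>
    have := key (k + 1)
    rw [if_neg (Nat.succ_ne_zero k), Nat.add_sub_cancel, ih] at this
    have h2 : p (k + 1) t * ((1 - t) * t ^ (k + 1)) =
      (k + 1) / (1 - t) * ((1 - t) * t ^ k) + t ^ (k + 1) - (1 - t) * ((k + 1 : ℕ) * t ^ k) := by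
      linarith
    rw [h2]
    push_cast
    field_simp
    ring

lemma rate_eq (hX : IsGeomBirth X p P) {t : ℝ} (ht : 0 ≤ t) (ht1 : t < 1) {k : ℕ}
    (hk : P.real (X t ⁻¹' {k}) ≠ 0) : p k t = (k + 1) / (1 - t) := by
  rw [hX.marginal t ht ht1] at hk
  exact mul_right_cancel₀ hk (hX.rate_mul_eq ht ht1 k)

lemma hasDerivWithinAt (hX : IsGeomBirth X p P) {t : ℝ} (ht : 0 ≤ t) (ht1 : t < 1)
    {B : Set Ω} (hB : MeasurableSet[pastAlg X t] B) (k : ℕ) :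
    HasDerivWithinAt (fun u => P.real (B ∩ X u ⁻¹' {k}))
      (k / (1 - t) * P.real (B ∩ X t ⁻¹' {k - 1}) - (k + 1) / (1 - t) * P.real (B ∩ X t ⁻¹' {k}))
      (Ici t) t := by
  -- Rates are known only at states of positive mass; at the others the weight vanishes.
  have hp : ∀ j, p j t * P.real (B ∩ X t ⁻¹' {j}) = (j + 1) / (1 - t) * P.real (B ∩ X t ⁻¹' {j}) := by
    intro j
    by_cases hj : P.real (X t ⁻¹' {j}) = 0
    · have : P.real (B ∩ X t ⁻¹' {j}) = 0 :=
        le_antisymm (hj ▸ measureReal_mono inter_subset_right) measureReal_nonneg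
      rw [this, mul_zero, mul_zero]
    · rw [hX.rate_eq ht ht1 hj]
  have := hX.hasDerivWithinAt_rates ht ht1 hB k
  rw [sum_rates_succ (fun j => p j t) (fun j => P.real (B ∩ X t ⁻¹' {j}))] at this
  convert this using 1
  rw [hp, hp]
  rcases k with _ | k
  · simp
  · simp

/-- Right-continuity comes from the right derivative, left-continuity from the absence of fixed
jumps and convergence of indicators. -/
lemma continuousOn (hX : IsGeomBirth X p P) {s t : ℝ} (hs : 0 ≤ s) (ht1 : t < 1)
    {B : Set Ω} (hB : MeasurableSet[pastAlg X s] B) (k : ℕ) :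
    ContinuousOn (fun u => P.real (B ∩ X u ⁻¹' {k})) (Icc s t) := by
  intro x hx
  have hx1 := hx.2.trans_lt ht1
  have hr : ContinuousWithinAt (fun u => P.real (B ∩ X u ⁻¹' {k})) (Ici x) x :=
    (hX.hasDerivWithinAt (hs.trans hx.1) hx1 (pastAlg_mono hx.1 _ hB) k).continuousWithinAt
  have hB' := pastAlg_le hX.meas s _ hB
  rcases hx.1.eq_or_lt with rfl | hsx
  · exact hr.mono Icc_subset_Ici_self
  have hl : ContinuousWithinAt (fun u => P.real (B ∩ X u ⁻¹' {k})) (Iio x) x := by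
    refine (ENNReal.tendsto_toReal (measure_ne_top _ _)).comp
      (tendsto_measure_of_ae_tendsto_indicator_of_isFiniteMeasure (𝓝[<] x)
        (hB'.inter (hX.measurableSet_preimage _ _))
        (fun u => hB'.inter (hX.measurableSet_preimage _ _)) ?_)
    filter_upwards [hX.no_fixed_jump x (hs.trans_lt hsx) hx1] with ω hω
    filter_upwards [hω] with u hu
    simp only [mem_inter_iff, mem_preimage, hu]
  exact (continuousAt_iff_continuous_left_right.2
    ⟨continuousWithinAt_Iio_iff_Iic.1 hl, hr⟩).continuousWithinAt

end IsGeomBirth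

lemma setOf_forall_insert {Ω : Type*} (Z : ℝ → Ω → ℕ) (f : ℝ → ℕ) (t : ℝ) (J : Finset ℝ) :
    {ω | ∀ r ∈ insert t J, Z r ω = f r} = {ω | ∀ r ∈ J, Z r ω = f r} ∩ Z t ⁻¹' {f t} := by
  ext ω
  simp [and_comm]

lemma measurableSet_pastAlg_finiteDim {Ω : Type*} [MeasurableSpace Ω] (Z : ℝ → Ω → ℕ) (f : ℝ → ℕ) {s : ℝ}
    {J : Finset ℝ} (hJ : ∀ r ∈ J, r ∈ Icc 0 s) :
    MeasurableSet[pastAlg Z s] {ω | ∀ r ∈ J, Z r ω = f r} := by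
  have : {ω | ∀ r ∈ J, Z r ω = f r} = ⋂ r ∈ J, Z r ⁻¹' {f r} := by ext ω; simp
  rw [this]
  exact Finset.measurableSet_biInter _ fun r hr => measurableSet_pastAlg (hJ r hr).1 (hJ r hr).2 _

/-- Two processes with the same marginals have the same finite-dimensional distributions. -/
theorem IsGeomBirth.finiteDim_eq {Ω' : Type*} [MeasurableSpace Ω'] {Y : ℝ → Ω' → ℕ}
    {p' : ℕ → ℝ → ℝ} {P' : Measure Ω'} [IsProbabilityMeasure P'] (hX : IsGeomBirth X p P)
    (hY : IsGeomBirth Y p' P') (f : ℝ → ℕ) (J : Finset ℝ) (hJ : ∀ t ∈ J, t ∈ Ico (0 : ℝ) 1) :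
    P.real {ω | ∀ t ∈ J, X t ω = f t} = P'.real {ω | ∀ t ∈ J, Y t ω = f t} := by
  induction J using Finset.induction_on_max with
  | empty => simp
  | insert t J hmax ih =>
    have ih := ih fun r hr => hJ r (Finset.mem_insert_of_mem hr)
    have htI := hJ t (Finset.mem_insert_self t J)
    rw [setOf_forall_insert X, setOf_forall_insert Y]
    rcases J.eq_empty_or_nonempty with rfl | hne
    · simp only [Finset.notMem_empty, false_imp_iff, implies_true, ofPred_true, univ_inter]
      rw [hX.marginal t htI.1 htI.2, hY.marginal t htI.1 htI.2]
    · set s := J.max' hne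
      have hsJ : s ∈ J := J.max'_mem hne
      have hsI := hJ s (Finset.mem_insert_of_mem hsJ)
      have hst : s < t := hmax s hsJ
      have hpast := measurableSet_pastAlg_finiteDim (s := s) X f fun r hr =>
        ⟨(hJ r (Finset.mem_insert_of_mem hr)).1, J.le_max' r hr⟩
      have hpast' := measurableSet_pastAlg_finiteDim (s := s) Y f fun r hr =>
        ⟨(hJ r (Finset.mem_insert_of_mem hr)).1, J.le_max' r hr⟩
      have h0 : ∀ k, P.real ({ω | ∀ r ∈ J, X r ω = f r} ∩ X s ⁻¹' {k})
          = P'.real ({ω | ∀ r ∈ J, Y r ω = f r} ∩ Y s ⁻¹' {k}) := by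
        intro k
        by_cases hk : f s = k
        · rw [inter_eq_left.2 fun ω hω => (hω s hsJ).trans hk,
            inter_eq_left.2 fun ω hω => (hω s hsJ).trans hk, ih]
        · have e1 : {ω | ∀ r ∈ J, X r ω = f r} ∩ X s ⁻¹' {k} = ∅ :=
            eq_empty_of_forall_notMem fun ω hω => hk ((hω.1 s hsJ).symm.trans hω.2)
          have e2 : {ω | ∀ r ∈ J, Y r ω = f r} ∩ Y s ⁻¹' {k} = ∅ :=
            eq_empty_of_forall_notMem fun ω hω => hk ((hω.1 s hsJ).symm.trans hω.2)
          rw [e1, e2, measureReal_empty, measureReal_empty]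
      -- With the values at the earlier times fixed, both families solve the same forward system on
      -- [s, t] with the same data at the last earlier time `s`.
      have := triangular_ode_eq_zero (s := s) htI.2
        (g := fun k u => P.real ({ω | ∀ r ∈ J, X r ω = f r} ∩ X u ⁻¹' {k})
          - P'.real ({ω | ∀ r ∈ J, Y r ω = f r} ∩ Y u ⁻¹' {k}))
        (fun k => (hX.continuousOn hsI.1 htI.2 hpast k).sub
          (hY.continuousOn hsI.1 htI.2 hpast' k))
        (fun k u hu => by
          have h1 := hX.hasDerivWithinAt (hsI.1.trans hu.1) (hu.2.trans htI.2)
            (pastAlg_mono hu.1 _ hpast) k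
          have h2 := hY.hasDerivWithinAt (hsI.1.trans hu.1) (hu.2.trans htI.2)
            (pastAlg_mono hu.1 _ hpast') k
          exact (h1.sub h2).congr_deriv (by ring))
        (fun k => sub_eq_zero.2 (h0 k)) (f t) t ⟨hst.le, le_rfl⟩
      exact sub_eq_zero.1 this

end RealTime

/-! ### Birth processes indexed by `[0,1)` -/

/-- The point of `[0,1)` with a given value (and `0` outside of `[0,1)`). -/
def toUnitTime (w : ℝ) : UnitTime :=
  open Classical in if h : w ∈ Ico (0 : ℝ) 1 then ⟨w, h⟩ else ⟨0, by norm_num⟩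

lemma coe_toUnitTime {w : ℝ} (h : w ∈ Ico (0 : ℝ) 1) : (toUnitTime w : ℝ) = w := by
  simp only [toUnitTime, dif_pos h]

lemma toUnitTime_of_mem {w : ℝ} (h : w ∈ Ico (0 : ℝ) 1) : toUnitTime w = ⟨w, h⟩ :=
  Subtype.ext (coe_toUnitTime h)

lemma toUnitTime_coe (t : UnitTime) : toUnitTime t = t := Subtype.ext (coe_toUnitTime t.2)

lemma tendsto_toUnitTime_right {t : ℝ} (ht : t ∈ Ico (0 : ℝ) 1) :
    Tendsto toUnitTime (𝓝[>] t) (𝓝[>] ⟨t, ht⟩) := by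
  have hev : ∀ᶠ w in 𝓝[>] t, w ∈ Ioo t 1 := Ioo_mem_nhdsGT ht.2
  refine tendsto_nhdsWithin_iff.2 ⟨tendsto_subtype_rng.2 ?_, ?_⟩
  · refine (tendsto_id.mono_left nhdsWithin_le_nhds).congr' ?_
    filter_upwards [hev] with w hw using (coe_toUnitTime ⟨ht.1.trans hw.1.le, hw.2⟩).symm
  · filter_upwards [hev] with w hw
    rw [toUnitTime_of_mem ⟨ht.1.trans hw.1.le, hw.2⟩]
    exact hw.1

lemma tendsto_toUnitTime_left {t : ℝ} (ht : t ∈ Ico (0 : ℝ) 1) (h0 : 0 < t) :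
    Tendsto toUnitTime (𝓝[<] t) (𝓝[<] ⟨t, ht⟩) := by
  have hev : ∀ᶠ w in 𝓝[<] t, w ∈ Ioo 0 t := Ioo_mem_nhdsLT h0
  refine tendsto_nhdsWithin_iff.2 ⟨tendsto_subtype_rng.2 ?_, ?_⟩
  · refine (tendsto_id.mono_left nhdsWithin_le_nhds).congr' ?_
    filter_upwards [hev] with w hw using (coe_toUnitTime ⟨hw.1.le, hw.2.trans ht.2⟩).symm
  · filter_upwards [hev] with w hw
    rw [toUnitTime_of_mem ⟨hw.1.le, hw.2.trans ht.2⟩]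
    exact hw.2

/-- The set S is an atom of G (`hatom`), so the conditional probability of A given G is a constant c
on S. Integrating over C ∩ S with C in F gives P(C ∩ S ∩ A) = c P(C ∩ S), used for C = B and for the
whole space. -/
lemma real_inter_mul_of_condExp_eq {Ω : Type*} {F G : MeasurableSpace Ω} [mΩ : MeasurableSpace Ω]
    {P : Measure Ω} [IsProbabilityMeasure P] (hF : F ≤ mΩ) (hGF : G ≤ F) {A B S : Set Ω}
    (hA : MeasurableSet A) (hB : MeasurableSet[F] B) (hS : MeasurableSet[G] S)
    (hcond : P⟦A | F⟧ =ᵐ[P] P⟦A | G⟧)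
    (hatom : ∀ D, MeasurableSet[G] D → ∀ ω ∈ S, ∀ ω' ∈ S, ω ∈ D → ω' ∈ D) :
    P.real (B ∩ S ∩ A) * P.real S = P.real (B ∩ S) * P.real (S ∩ A) := by
  set h : Ω → ℝ := P⟦A | G⟧
  have hint : ∀ C, MeasurableSet[F] C → ∫ ω in C, h ω ∂P = P.real (C ∩ A) := by
    intro C hC
    rw [← setIntegral_congr_ae (g := h) (f := P⟦A | F⟧) (hF _ hC) (hcond.mono fun ω hω _ => hω),
      setIntegral_condExp hF ((integrable_const 1).indicator hA) hC, setIntegral_indicator hA]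
    simp
  obtain ⟨c, hc⟩ : ∃ c, ∀ ω ∈ S, h ω = c := by
    rcases S.eq_empty_or_nonempty with he | ⟨ω₀, h₀⟩
    · exact ⟨0, by simp [he]⟩
    · have hm : MeasurableSet[G] (h ⁻¹' {h ω₀}) :=
        (stronglyMeasurable_condExp.measurable) (measurableSet_singleton _)
      exact ⟨h ω₀, fun ω hω => hatom _ hm ω₀ h₀ ω hω rfl⟩
  have hconst : ∀ C, MeasurableSet[F] C → P.real (C ∩ S ∩ A) = c * P.real (C ∩ S) := by
    intro C hC
    have hCS := hC.inter (hGF _ hS)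
    rw [← hint _ hCS, setIntegral_congr_fun (hF _ hCS) (fun ω hω => hc ω hω.2)]
    simp [mul_comm]
  have h1 := hconst B hB
  have h2 := hconst univ MeasurableSet.univ
  rw [univ_inter] at h2
  rw [h1, h2]
  ring

section

variable {Ω : Type*} [MeasurableSpace Ω] {P : Measure Ω} [IsProbabilityMeasure P]

/-- The elementary form of the Markov property. -/
lemma IsMarkov.real_inter_mul {X : UnitTime → Ω → ℕ} (hX : IsMarkov X P) {s t : UnitTime}
    (hst : s ≤ t) {B : Set Ω}
    (hB : MeasurableSet[⨆ r : Set.Iic s, MeasurableSpace.comap (X r) inferInstance] B) (i k : ℕ) :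
    P.real (B ∩ X s ⁻¹' {i} ∩ X t ⁻¹' {k}) * P.real (X s ⁻¹' {i})
      = P.real (B ∩ X s ⁻¹' {i}) * P.real (X s ⁻¹' {i} ∩ X t ⁻¹' {k}) := by
  refine real_inter_mul_of_condExp_eq
    (F := ⨆ r : Set.Iic s, MeasurableSpace.comap (X r) inferInstance)
    (G := MeasurableSpace.comap (X s) inferInstance) (iSup_le fun r => (hX.measurable r).comap_le)
    (le_iSup (fun r : Set.Iic s => MeasurableSpace.comap (X r) inferInstance) ⟨s, mem_Iic.2 le_rfl⟩)
    (hX.measurable t (measurableSet_singleton k)) hB ⟨{i}, measurableSet_singleton i, rfl⟩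
    (hX.markov s t hst {k} (measurableSet_singleton k)) ?_
  rintro _ ⟨D, -, rfl⟩ ω hω ω' hω' h
  rw [mem_preimage, show X s ω' = i from hω', ← show X s ω = i from hω]
  exact h

/-- A birth process on `[0,1)` with shifted geometric marginals. -/
structure IsGeomMarginalBirth (X : UnitTime → Ω → ℕ) (p : ℕ → UnitTime → ℝ) (P : Measure Ω) :
    Prop where
  birth : IsBirthProcessWithRates X p P
  marginal : ∀ (t : UnitTime) (k : ℕ), P.real (X t ⁻¹' {k}) = (1 - (t : ℝ)) * (t : ℝ) ^ k

lemma real_mul_transProb {X : UnitTime → Ω → ℕ} (hX : ∀ t, Measurable (X t)) (t u : UnitTime)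
    (j k : ℕ) : P.real (X t ⁻¹' {j}) * transProb X P t u j k
      = P.real (X t ⁻¹' {j} ∩ X u ⁻¹' {k}) := by
  rw [transProb, mul_comm,
    measureReal_def, measureReal_def, measureReal_def, ← ENNReal.toReal_mul,
    cond_mul_eq_inter (hX t (measurableSet_singleton j))]

lemma IsGeomMarginalBirth.isGeomBirth {X : UnitTime → Ω → ℕ} {p : ℕ → UnitTime → ℝ}
    (h : IsGeomMarginalBirth X p P) :
    IsGeomBirth (fun w => X (toUnitTime w)) (fun j w => p j (toUnitTime w)) P where
  meas w := h.birth.markov.measurable _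
  markov s t hs hst ht B hB i k := by
    have hsI : s ∈ Ico (0 : ℝ) 1 := ⟨hs, hst.trans_lt ht⟩
    have htI : t ∈ Ico (0 : ℝ) 1 := ⟨hs.trans hst, ht⟩
    rw [toUnitTime_of_mem hsI, toUnitTime_of_mem htI]
    refine h.birth.markov.real_inter_mul (s := ⟨s, hsI⟩) (t := ⟨t, htI⟩) hst ?_ i k
    refine (iSup_le fun r => ?_ : pastAlg (fun w => X (toUnitTime w)) s ≤ _) _ hB
    have hr : (r : ℝ) ∈ Ico (0 : ℝ) 1 := ⟨r.2.1, r.2.2.trans_lt hsI.2⟩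
    refine le_trans ?_ (le_iSup (fun r : Set.Iic (⟨s, hsI⟩ : UnitTime) =>
      MeasurableSpace.comap (X r) inferInstance) ⟨⟨r, hr⟩, r.2.2⟩)
    show MeasurableSpace.comap (X (toUnitTime r)) ⊤ ≤ _
    rw [toUnitTime_of_mem hr]
    exact le_rfl
  right_cont := by
    filter_upwards [h.birth.cadlag] with ω hω t h0 h1
    have := ((hω ⟨t, h0, h1⟩).1.mono Ioi_subset_Ici_self).tendsto.comp
      (tendsto_toUnitTime_right ⟨h0, h1⟩)
    rw [nhds_discrete, tendsto_pure] at this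
    rw [toUnitTime_of_mem ⟨h0, h1⟩]
    exact this
  left_lim := by
    filter_upwards [h.birth.cadlag] with ω hω t h0 h1
    obtain ⟨l, hl⟩ := (hω ⟨t, h0.le, h1⟩).2
    have := hl.comp (tendsto_toUnitTime_left ⟨h0.le, h1⟩ h0)
    rw [nhds_discrete, tendsto_pure] at this
    exact ⟨l, this⟩
  no_fixed_jump t h0 h1 := by
    filter_upwards [h.birth.no_fixed_jump ⟨t, h0.le, h1⟩] with ω hω
    have := hω.tendsto.comp ((tendsto_toUnitTime_left ⟨h0.le, h1⟩ h0).mono_right nhdsWithin_le_nhds)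
    rw [nhds_discrete, tendsto_pure] at this
    rw [toUnitTime_of_mem ⟨h0.le, h1⟩]
    exact this
  marginal t h0 h1 k := by
    rw [h.marginal, coe_toUnitTime ⟨h0, h1⟩]
  stay t h0 h1 j := by
    -- No rate is prescribed at a state of mass zero, but there all terms vanish.
    by_cases hj : P (X (toUnitTime t) ⁻¹' {j}) = 0
    · have hz : ∀ S ⊆ X (toUnitTime t) ⁻¹' {j}, P.real S = 0 := fun S hS => by
        rw [measureReal_def, measure_mono_null hS hj, ENNReal.toReal_zero]
      simp only [hz _ Subset.rfl, hz _ inter_subset_left, zero_mul, sub_zero]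
      exact isLittleO_zero _ _
    rw [toUnitTime_of_mem ⟨h0, h1⟩] at hj ⊢
    have := ((h.birth.rate_stay ⟨t, h0, h1⟩ j hj).comp_tendsto
      (tendsto_toUnitTime_right ⟨h0, h1⟩)).const_mul_left (P.real (X ⟨t, h0, h1⟩ ⁻¹' {j}))
    refine this.congr' ?_ ?_ <;> filter_upwards [Ioo_mem_nhdsGT h1] with u hu
    · simp only [Function.comp_apply, mul_sub, real_mul_transProb h.birth.markov.measurable,
        coe_toUnitTime (w := u) ⟨h0.trans hu.1.le, hu.2⟩]
    · simp only [Function.comp_apply, coe_toUnitTime (w := u) ⟨h0.trans hu.1.le, hu.2⟩]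
  birth t h0 h1 j := by
    by_cases hj : P (X (toUnitTime t) ⁻¹' {j}) = 0
    · have hz : ∀ S ⊆ X (toUnitTime t) ⁻¹' {j}, P.real S = 0 := fun S hS => by
        rw [measureReal_def, measure_mono_null hS hj, ENNReal.toReal_zero]
      simp only [hz _ Subset.rfl, hz _ inter_subset_left, zero_mul, sub_zero]
      exact isLittleO_zero _ _
    rw [toUnitTime_of_mem ⟨h0, h1⟩] at hj ⊢
    have := ((h.birth.rate_birth ⟨t, h0, h1⟩ j hj).comp_tendsto
      (tendsto_toUnitTime_right ⟨h0, h1⟩)).const_mul_left (P.real (X ⟨t, h0, h1⟩ ⁻¹' {j}))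
    refine this.congr' ?_ ?_ <;> filter_upwards [Ioo_mem_nhdsGT h1] with u hu
    · simp only [Function.comp_apply, mul_sub, real_mul_transProb h.birth.markov.measurable,
        coe_toUnitTime (w := u) ⟨h0.trans hu.1.le, hu.2⟩]
    · simp only [Function.comp_apply, coe_toUnitTime (w := u) ⟨h0.trans hu.1.le, hu.2⟩]

lemma IsGeomMarginalBirth.rate_eq {X : UnitTime → Ω → ℕ} {p : ℕ → UnitTime → ℝ}
    (h : IsGeomMarginalBirth X p P) {t : UnitTime} {k : ℕ} (hk : P (X t ⁻¹' {k}) ≠ 0) :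
    p k t = (k + 1) / (1 - (t : ℝ)) := by
  have hk' : P.real (X t ⁻¹' {k}) ≠ 0 := (measureReal_ne_zero_iff).2 hk
  have := h.isGeomBirth.rate_eq t.2.1 t.2.2 (k := k) (by rwa [toUnitTime_coe])
  rwa [toUnitTime_coe] at this

lemma setOf_forall_image_toUnitTime {Ω : Type*} (Z : UnitTime → Ω → ℕ) [DecidableEq UnitTime]
    {I : Finset UnitTime} (x : I → ℕ) : {ω | ∀ t ∈ I.image fun t : UnitTime => (t : ℝ),
      Z (toUnitTime t) ω = if hw : toUnitTime t ∈ I then x ⟨_, hw⟩ else 0}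
      = (fun ω => I.restrict fun t => Z t ω) ⁻¹' {x} := by
  ext ω
  constructor
  · intro h
    funext t
    have := h t (Finset.mem_image_of_mem _ t.2)
    rw [toUnitTime_coe, dif_pos t.2] at this
    exact this
  · rintro h t ht
    obtain ⟨t, htI, rfl⟩ := Finset.mem_image.1 ht
    rw [toUnitTime_coe, dif_pos htI]
    exact congrFun h ⟨t, htI⟩

/-- The law of a birth process with shifted geometric marginals is unique. -/
theorem IsGeomMarginalBirth.map_eq {Ω' : Type*} [MeasurableSpace Ω'] {P' : Measure Ω'}
    [IsProbabilityMeasure P'] {X : UnitTime → Ω → ℕ} {p : ℕ → UnitTime → ℝ}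
    {Y : UnitTime → Ω' → ℕ} {p' : ℕ → UnitTime → ℝ} (hX : IsGeomMarginalBirth X p P)
    (hY : IsGeomMarginalBirth Y p' P') :
    P.map (fun ω t => X t ω) = P'.map (fun ω t => Y t ω) := by
  have hXm := hX.birth.markov.measurable
  have hYm := hY.birth.markov.measurable
  have h1 := isProjectiveLimit_map (P := P) (X := X) (measurable_pi_iff.2 hXm).aemeasurable
  have h2 := isProjectiveLimit_map (P := P') (X := Y) (measurable_pi_iff.2 hYm).aemeasurable
  refine h1.unique (P := _) ?_
  convert h2 using 2 with I
  have hmX : Measurable fun ω => I.restrict fun t => X t ω :=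
    (Finset.measurable_restrict I).comp (measurable_pi_iff.2 hXm)
  have hmY : Measurable fun ω => I.restrict fun t => Y t ω :=
    (Finset.measurable_restrict I).comp (measurable_pi_iff.2 hYm)
  have := Measure.isProbabilityMeasure_map (μ := P) hmX.aemeasurable
  have := Measure.isProbabilityMeasure_map (μ := P') hmY.aemeasurable
  refine Measure.ext_of_singleton fun x => ?_
  rw [Measure.map_apply hmX (measurableSet_singleton x),
    Measure.map_apply hmY (measurableSet_singleton x)]
  classical
  have key := hX.isGeomBirth.finiteDim_eq hY.isGeomBirth
    (fun w => if hw : toUnitTime w ∈ I then x ⟨_, hw⟩ else 0) (I.image fun t : UnitTime => (t : ℝ))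
    (fun t ht => by
      obtain ⟨t, -, rfl⟩ := Finset.mem_image.1 ht
      exact t.2)
  rw [setOf_forall_image_toUnitTime X x, setOf_forall_image_toUnitTime Y x] at key
  exact (ENNReal.toReal_eq_toReal_iff' (measure_ne_top _ _) (measure_ne_top _ _)).1 key

end

/-! ### Uniqueness in law and identification of the birth rates -/

/-- Every event of the path space is an event about the counts, so the joint law of the count
processes determines the law of the permutation process. -/
lemma measurableSpace_pi_le_comap_rightInv :
    (MeasurableSpace.pi : MeasurableSpace (UnitTime → InfPerm))
      ≤ MeasurableSpace.comap (fun (x : UnitTime → InfPerm) (i : ℕ+) (t : UnitTime) =>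
        rightInv i (x t)) inferInstance := by
  refine iSup_le fun t => ?_
  rw [InfPerm.measurableSpace_eq_comap_code, MeasurableSpace.comap_comp]
  have : InfPerm.code ∘ (fun x : UnitTime → InfPerm => x t)
      = (fun (y : ℕ+ → UnitTime → ℕ) (i : ℕ+) => y i t) ∘
        fun (x : UnitTime → InfPerm) (i : ℕ+) (t : UnitTime) => rightInv i (x t) := rfl
  rw [this, ← MeasurableSpace.comap_comp]
  refine MeasurableSpace.comap_mono ?_
  have hm : Measurable fun (y : ℕ+ → UnitTime → ℕ) (i : ℕ+) => y i t := by fun_prop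
  exact hm.comap_le

section

set_option linter.unusedSectionVars false

variable {Ω : Type*} [MeasurableSpace Ω] {P : Measure Ω} [IsProbabilityMeasure P]
  {S : UnitTime → Ω → InfPerm}

lemma IsInfMallowsProcess.exists_rates (hS : IsInfMallowsProcess S P) (i : ℕ+) :
    ∃ p, IsGeomMarginalBirth (fun t ω => rightInv i (S t ω)) p P := by
  obtain ⟨p, hp⟩ := hS.birth i
  refine ⟨p, hp, fun t k => ?_⟩
  have := (hS.marginal t).geometric i k
  have hm : MeasurableSet {σ : InfPerm | rightInv i σ = k} :=
    measurable_rightInv i (measurableSet_singleton k)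
  rw [Measure.map_apply (hS.markov.measurable t) hm] at this
  have hs : (fun ω => rightInv i (S t ω)) ⁻¹' {k} = S t ⁻¹' {σ : InfPerm | rightInv i σ = k} := rfl
  have h0 : (0 : ℝ) ≤ t := t.2.1
  have h1 : (0 : ℝ) ≤ 1 - t := sub_nonneg.2 t.2.2.le
  rw [measureReal_def, hs, this, ENNReal.toReal_ofReal (by positivity)]

lemma IsInfMallowsProcess.measurable_rightInv (hS : IsInfMallowsProcess S P) (i : ℕ+) :
    Measurable fun ω (t : UnitTime) => rightInv i (S t ω) :=
  measurable_pi_iff.2 fun t => (_root_.measurable_rightInv i).comp (hS.markov.measurable t)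

/-- Independence makes the joint law of the counts the product of the coordinate laws, each
determined by its geometric marginals. -/
theorem IsInfMallowsProcess.map_eq {Ω' : Type*} [MeasurableSpace Ω'] {P' : Measure Ω'}
    [IsProbabilityMeasure P'] {S' : UnitTime → Ω' → InfPerm} (hS : IsInfMallowsProcess S P)
    (hS' : IsInfMallowsProcess S' P') :
    P.map (fun ω t => S t ω) = P'.map (fun ω t => S' t ω) := by
  have hm := measurable_pi_iff.2 hS.markov.measurable
  have hm' := measurable_pi_iff.2 hS'.markov.measurable
  have hcode : P.map (fun ω (i : ℕ+) (t : UnitTime) => rightInv i (S t ω))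
      = P'.map (fun ω (i : ℕ+) (t : UnitTime) => rightInv i (S' t ω)) := by
    rw [hS.indep.map_fun_eq_infinitePi_map hS.measurable_rightInv,
      hS'.indep.map_fun_eq_infinitePi_map hS'.measurable_rightInv]
    congr 1
    funext i
    obtain ⟨p, hp⟩ := hS.exists_rates i
    obtain ⟨p', hp'⟩ := hS'.exists_rates i
    exact hp.map_eq hp'
  refine Measure.ext fun E hE => ?_
  obtain ⟨D, hD, rfl⟩ := measurableSpace_pi_le_comap_rightInv E hE
  rw [Measure.map_apply hm hE, Measure.map_apply hm' hE]
  have h1 := Measure.map_apply (μ := P) (measurable_pi_iff.2 hS.measurable_rightInv) hD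
  have h2 := Measure.map_apply (μ := P') (measurable_pi_iff.2 hS'.measurable_rightInv) hD
  rw [hcode] at h1
  exact h1.symm.trans h2

/-- The shift n ↦ n + 1 is injective, so it preserves the generated σ-algebras and the transition
probabilities. The new rates need only match at states of positive mass. -/
lemma IsBirthProcessWithRates.add_one {X : UnitTime → Ω → ℕ} {p p' : ℕ → UnitTime → ℝ}
    (h : IsBirthProcessWithRates X p P) (hp0 : ∀ j t, 0 ≤ p' j t)
    (hp : ∀ j t, P (X t ⁻¹' {j}) ≠ 0 → p' (j + 1) t = p j t) :
    IsBirthProcessWithRates (fun t ω => X t ω + 1) p' P := by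
  have hpre : ∀ t j, (fun ω => X t ω + 1) ⁻¹' {j + 1} = X t ⁻¹' {j} := fun t j => by
    ext ω; simp
  have hpre0 : ∀ t, (fun ω => X t ω + 1) ⁻¹' {0} = ∅ := fun t => by
    ext ω; simp
  have hcomap : ∀ t, MeasurableSpace.comap (fun ω => X t ω + 1) inferInstance
      = MeasurableSpace.comap (X t) inferInstance := by
    intro t
    refine le_antisymm ?_ ?_
    · exact (((comap_measurable (X t)).add_const 1)).comap_le
    · have : X t = (fun n => n - 1) ∘ fun ω => X t ω + 1 := rfl
      conv_lhs => rw [this]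
      exact ((measurable_of_countable fun n : ℕ => n - 1).comp
        (comap_measurable fun ω => X t ω + 1)).comap_le
  have htrans : ∀ t u j k, transProb (fun t ω => X t ω + 1) P t u (j + 1) (k + 1)
      = transProb X P t u j k := fun t u j k => by
    rw [transProb, transProb, hpre, hpre]
  refine ⟨⟨fun t => (h.markov.measurable t).add_const 1, fun s t hst A hA => ?_⟩, ?_, fun t => ?_,
    hp0, fun t j hj => ?_, fun t j hj => ?_⟩
  · have hA' : MeasurableSet ((fun n : ℕ => n + 1) ⁻¹' A) := MeasurableSet.of_discrete
    have := h.markov.markov s t hst _ hA'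
    simp only [hcomap]
    exact this
  · filter_upwards [h.cadlag] with ω hω t
    refine ⟨(continuous_of_discreteTopology (f := fun n : ℕ => n + 1)).continuousAt.comp_continuousWithinAt
      (hω t).1, ?_⟩
    obtain ⟨l, hl⟩ := (hω t).2
    exact ⟨l + 1, ((continuous_of_discreteTopology (f := fun n : ℕ => n + 1)).tendsto l).comp hl⟩
  · filter_upwards [h.no_fixed_jump t] with ω hω
    exact (continuous_of_discreteTopology (f := fun n : ℕ => n + 1)).continuousAt.comp hω
  · rcases j with _ | j
    · simp [hpre0] at hj
    · rw [hpre] at hj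
      simp only [htrans, hp j t hj]
      exact h.rate_stay t j hj
  · rcases j with _ | j
    · simp [hpre0] at hj
    · rw [hpre] at hj
      simp only [htrans, hp j t hj]
      exact h.rate_birth t j hj

lemma IsInfMallowsProcess.isGeometricBirthProcess (hS : IsInfMallowsProcess S P) (i : ℕ+) :
    IsGeometricBirthProcess (fun t ω => rightInv i (S t ω) + 1) P := by
  obtain ⟨p, hp⟩ := hS.exists_rates i
  refine ⟨hp.birth.add_one (fun j t => ?_) fun j t hj => ?_, ?_⟩
  · exact div_nonneg (Nat.cast_nonneg j) (sub_nonneg.2 t.2.2.le)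
  · rw [hp.rate_eq hj]
    push_cast
    rfl
  · have h := hp.marginal ⟨0, by norm_num⟩ 0
    simp only [sub_zero, pow_zero, mul_one] at h
    have hae := (prob_compl_eq_zero_iff (μ := P)
      (hp.birth.markov.measurable ⟨0, by norm_num⟩ (measurableSet_singleton 0))).2
      ((ENNReal.toReal_eq_one_iff _).1 h)
    filter_upwards [measure_eq_zero_iff_ae_notMem.1 hae] with ω hω
    have : rightInv i (S ⟨0, by norm_num⟩ ω) = 0 := by
      by_contra hne
      exact hω hne
    rw [this]

lemma IsInfMallowsProcess.iIndepFun_add_one (hS : IsInfMallowsProcess S P) :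
    iIndepFun (fun (i : ℕ+) ω (t : UnitTime) => rightInv i (S t ω) + 1) P :=
  hS.indep.comp (fun _ x t => x t + 1) fun _ => by fun_prop

lemma IsInfMallowsProcess.map_add_one_eq (hS : IsInfMallowsProcess S P) (i j : ℕ+) :
    P.map (fun ω (t : UnitTime) => rightInv i (S t ω) + 1)
      = P.map (fun ω (t : UnitTime) => rightInv j (S t ω) + 1) := by
  obtain ⟨p, hp⟩ := hS.exists_rates i
  obtain ⟨p', hp'⟩ := hS.exists_rates j
  have hg : Measurable fun (x : UnitTime → ℕ) t => x t + 1 := by fun_prop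
  have := congrArg (Measure.map fun (x : UnitTime → ℕ) t => x t + 1) (hp.map_eq hp')
  rwa [Measure.map_map hg (hS.measurable_rightInv i),
    Measure.map_map hg (hS.measurable_rightInv j)] at this

end

/-! ### The Yule process -/

/-- The standard exponential distribution. -/
def stdExp : Measure ℝ := (volume.restrict (Ioi 0)).withDensity fun x => ENNReal.ofReal (Real.exp (-x))

lemma measurable_ofReal_exp_neg : Measurable fun x : ℝ => ENNReal.ofReal (Real.exp (-x)) := by
  fun_prop

lemma lintegral_stdExp {f : ℝ → ENNReal} (hf : Measurable f) :
    ∫⁻ x, f x ∂stdExp = ∫⁻ x in Ioi 0, ENNReal.ofReal (Real.exp (-x)) * f x := by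
  rw [stdExp, lintegral_withDensity_eq_lintegral_mul _ measurable_ofReal_exp_neg hf]
  rfl

instance : IsProbabilityMeasure stdExp := ⟨by
  rw [stdExp, withDensity_apply _ MeasurableSet.univ, Measure.restrict_univ,
    ← ofReal_integral_eq_lintegral_ofReal (integrableOn_exp_neg_Ioi 0)
      (ae_of_all _ fun x => (Real.exp_pos _).le), integral_exp_neg_Ioi_zero, ENNReal.ofReal_one]⟩

/-- Lack of memory of the exponential distribution. -/
lemma lintegral_stdExp_memoryless {f : ℝ → ENNReal} (hf : Measurable f) {a : ℝ} (ha : 0 ≤ a) :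
    ∫⁻ x, (Ioi a).indicator (fun x => f (x - a)) x ∂stdExp
      = ENNReal.ofReal (Real.exp (-a)) * ∫⁻ x, f x ∂stdExp := by
  have hfa : Measurable fun x => f (x - a) := hf.comp (measurable_id.sub_const a)
  have hm : Measurable fun x => ENNReal.ofReal (Real.exp (-x)) * f x :=
    measurable_ofReal_exp_neg.mul hf
  rw [lintegral_stdExp hf, lintegral_stdExp (hfa.indicator measurableSet_Ioi),
    ← lintegral_const_mul _ hm,
    ← lintegral_indicator measurableSet_Ioi, ← lintegral_indicator measurableSet_Ioi,
    ← lintegral_add_right_eq_self _ a]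
  refine lintegral_congr fun x => ?_
  simp only [indicator, mem_Ioi]
  by_cases hx : 0 < x
  · rw [if_pos (by linarith), if_pos (by linarith), if_pos hx, add_sub_cancel_right, ← mul_assoc,
      ← ENNReal.ofReal_mul (Real.exp_pos _).le, ← Real.exp_add]
    congr 3
    ring
  · rw [if_neg hx]
    split_ifs
    · linarith
    · simp
    · rfl

/-- The law of an i.i.d. sequence of standard exponential variables. -/
def expSeq : Measure (ℕ → ℝ) := Measure.infinitePi fun _ => stdExp

instance : IsProbabilityMeasure expSeq := by unfold expSeq; infer_instance

/-- The sequence with first term `x` and remainder `e`. -/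
def seqCons (x : ℝ) (e : ℕ → ℝ) : ℕ → ℝ
  | 0 => x
  | n + 1 => e n

lemma measurable_seqCons : Measurable fun p : ℝ × (ℕ → ℝ) => seqCons p.1 p.2 := by
  refine measurable_pi_iff.2 fun n => ?_
  cases n with
  | zero => exact measurable_fst
  | succ n => exact (measurable_pi_apply n).comp measurable_snd

lemma map_seqCons : (stdExp.prod expSeq).map (fun p => seqCons p.1 p.2) = expSeq := by
  refine Measure.eq_infinitePi _ fun s t ht => ?_
  classical
  -- Padding by `univ` turns the constrained coordinates into an initial segment, from which
  -- coordinate `0` can be split off.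
  set t' : ℕ → Set ℝ := fun i => if i ∈ s then t i else univ
  have ht' : ∀ i, MeasurableSet (t' i) := fun i => by
    simp only [t']; split_ifs
    exacts [ht i, MeasurableSet.univ]
  obtain ⟨N, hN⟩ : ∃ N, s ⊆ Finset.range (N + 1) :=
    ⟨s.sup id, fun i hi => Finset.mem_range.2 (Nat.lt_succ_of_le (Finset.le_sup (f := id) hi))⟩
  have hprod : ∏ i ∈ s, stdExp (t i) = ∏ i ∈ Finset.range (N + 1), stdExp (t' i) := by
    rw [← Finset.prod_subset hN fun i _ hi => by simp [t', hi]]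
    exact Finset.prod_congr rfl fun i hi => by simp [t', hi]
  have hset : (fun p : ℝ × (ℕ → ℝ) => seqCons p.1 p.2) ⁻¹' (s : Set ℕ).pi t
      = t' 0 ×ˢ ((Finset.range N : Set ℕ).pi fun i => t' (i + 1)) := by
    ext ⟨x, e⟩
    constructor
    · intro h
      refine ⟨?_, fun i _ => ?_⟩
      · by_cases h0 : 0 ∈ s
        · simpa [t', h0, seqCons] using h 0 h0
        · simp [t', h0]
      · by_cases h0 : i + 1 ∈ s
        · simpa [t', h0, seqCons] using h (i + 1) h0
        · simp [t', h0]
    · rintro ⟨h0, h⟩ i hi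
      cases i with
      | zero => simpa [t', Finset.mem_coe.1 hi, seqCons] using h0
      | succ i =>
        have := h i (by
          have := Finset.mem_range.1 (hN hi)
          simp only [Finset.coe_range, mem_Iio]; omega)
        simpa [t', Finset.mem_coe.1 hi, seqCons] using this
  rw [Measure.map_apply measurable_seqCons
    (MeasurableSet.pi s.countable_toSet fun i _ => ht i), hset, Measure.prod_prod, hprod,
    Finset.prod_range_succ', mul_comm]
  congr 1
  exact Measure.infinitePi_pi _ fun i _ => ht' _

/-- Conditioning on the first holding time, the device behind the inductions on the number of jumps.
-/
lemma expSeq_apply {Q : Set (ℕ → ℝ)} (hQ : MeasurableSet Q) :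
    expSeq Q = ∫⁻ x, expSeq {e | seqCons x e ∈ Q} ∂stdExp := by
  conv_lhs => rw [← map_seqCons]
  rw [Measure.map_apply measurable_seqCons hQ, Measure.prod_apply (measurable_seqCons hQ)]
  rfl

lemma measurable_expSeq_seqCons {Q : Set (ℕ → ℝ)} (hQ : MeasurableSet Q) :
    Measurable fun x => expSeq {e | seqCons x e ∈ Q} :=
  measurable_measure_prodMk_left (measurable_seqCons hQ)

/-- In the Yule process started at time `0` in state `i`, with state-`j` holding times
`e (j - i) / (j + 1)`, the state at time `t` is `i + n`. -/
def inState : ℕ → ℕ → (ℕ → ℝ) → ℝ → Prop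
  | 0, i, e, t => t < e 0 / (i + 1)
  | n + 1, i, e, t => e 0 / (i + 1) ≤ t ∧ inState n (i + 1) (fun m => e (m + 1)) (t - e 0 / (i + 1))

lemma inState_succ_seqCons (n i : ℕ) (x : ℝ) (e : ℕ → ℝ) (t : ℝ) :
    inState (n + 1) i (seqCons x e) t ↔ x / (i + 1) ≤ t ∧ inState n (i + 1) e (t - x / (i + 1)) :=
  Iff.rfl

lemma inState_zero_seqCons (i : ℕ) (x : ℝ) (e : ℕ → ℝ) (t : ℝ) :
    inState 0 i (seqCons x e) t ↔ t < x / (i + 1) :=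
  Iff.rfl

/-- Measurability must be joint in clocks and time, because the recursion evaluates the remaining
process at a time that depends on the clocks. -/
lemma measurableSet_inState_prod (n i : ℕ) :
    MeasurableSet {p : (ℕ → ℝ) × ℝ | inState n i p.1 p.2} := by
  induction n generalizing i with
  | zero =>
    exact measurableSet_lt (f := fun p : (ℕ → ℝ) × ℝ => p.2) (by fun_prop) (by fun_prop)
  | succ n ih =>
    refine MeasurableSet.inter (measurableSet_le (f := fun p : (ℕ → ℝ) × ℝ => p.1 0 / (i + 1))
      (g := fun p : (ℕ → ℝ) × ℝ => p.2) (by fun_prop) (by fun_prop)) ?_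
    have hm : Measurable fun p : (ℕ → ℝ) × ℝ => ((fun m => p.1 (m + 1) : ℕ → ℝ),
        p.2 - p.1 0 / (i + 1)) := by fun_prop
    exact hm (ih (i + 1))

lemma measurableSet_inState (n i : ℕ) (t : ℝ) : MeasurableSet {e | inState n i e t} := by
  have hm : Measurable fun e : ℕ → ℝ => (e, t) := by fun_prop
  exact hm (measurableSet_inState_prod n i)

lemma inState_mono {n m i : ℕ} {e : ℕ → ℝ} {s t : ℝ} (hst : s ≤ t) (hs : inState m i e s)
    (ht : inState n i e t) : m ≤ n := by
  induction n generalizing m i e s t with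
  | zero =>
    cases m with
    | zero => exact le_rfl
    | succ m => exact absurd (hs.1.trans hst) (not_le.2 ht)
  | succ n ih =>
    cases m with
    | zero => exact Nat.zero_le _
    | succ m => exact Nat.succ_le_succ (ih (by linarith) hs.2 ht.2)

lemma inState_unique {n m i : ℕ} {e : ℕ → ℝ} {t : ℝ} (hm : inState m i e t)
    (hn : inState n i e t) : m = n :=
  le_antisymm (inState_mono le_rfl hm hn) (inState_mono le_rfl hn hm)

lemma inState_right {n i : ℕ} {e : ℕ → ℝ} {t : ℝ} (h : inState n i e t) :
    ∃ δ > 0, ∀ u, t ≤ u → u < t + δ → inState n i e u := by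
  induction n generalizing i e t with
  | zero => exact ⟨e 0 / (i + 1) - t, sub_pos.2 h, fun u _ hu => by
      have : u < e 0 / (i + 1) := by linarith
      exact this⟩
  | succ n ih =>
    obtain ⟨δ, hδ, H⟩ := ih h.2
    exact ⟨δ, hδ, fun u h1 h2 => ⟨h.1.trans h1, H _ (by linarith) (by linarith)⟩⟩

lemma exists_inState_of_le {n i : ℕ} {e : ℕ → ℝ} {s t : ℝ} (hst : s ≤ t) (h : inState n i e t) :
    ∃ m, inState m i e s := by
  induction n generalizing i e s t with
  | zero => exact ⟨0, hst.trans_lt h⟩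
  | succ n ih =>
    rcases lt_or_ge s (e 0 / (i + 1)) with h' | h'
    · exact ⟨0, h'⟩
    · obtain ⟨m, hm⟩ := ih (by linarith) h.2 (s := s - e 0 / (i + 1))
      exact ⟨m + 1, h', hm⟩

lemma measurableSet_forall_inState (t : ℝ) (j : ℕ) (L : Finset (ℝ × ℕ)) (n : ℕ) :
    MeasurableSet {e | ∀ p ∈ L, inState (n + p.2) j e (t + p.1)} := by
  have : {e | ∀ p ∈ L, inState (n + p.2) j e (t + p.1)}
      = ⋂ p ∈ L, {e | inState (n + p.2) j e (t + p.1)} := by ext; simp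
  rw [this]
  exact Finset.measurableSet_biInter _ fun p _ => measurableSet_inState _ _ _

/-- The Markov property of the Yule process. -/
lemma expSeq_inState_inter (n i : ℕ) {t : ℝ} (ht : 0 ≤ t) (L : Finset (ℝ × ℕ))
    (hL : ∀ p ∈ L, 0 ≤ p.1) :
    expSeq {e | inState n i e t ∧ ∀ p ∈ L, inState (n + p.2) i e (t + p.1)}
      = expSeq {e | inState n i e t} * expSeq {e | ∀ p ∈ L, inState p.2 (i + n) e p.1} := by
  have hinter : ∀ n i t, {e | inState n i e t ∧ ∀ p ∈ L, inState (n + p.2) i e (t + p.1)}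
      = {e | inState n i e t} ∩ {e | ∀ p ∈ L, inState (n + p.2) i e (t + p.1)} := fun _ _ _ => rfl
  induction n generalizing i t with
  -- No jump before t. Given x > (i + 1) t, the excess x - (i + 1) t is again standard exponential,
  -- and the process seen from time t is the one whose first clock is this excess.
  | zero =>
    have hi : (0 : ℝ) < i + 1 := by positivity
    have ha : 0 ≤ (i + 1) * t := by positivity
    have hF : MeasurableSet {e | ∀ p ∈ L, inState p.2 i e p.1} := by
      simpa using measurableSet_forall_inState 0 i L 0
    have hlt : ∀ x, t < x / (i + 1) ↔ (i + 1) * t < x := fun x => by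
      rw [lt_div_iff₀ hi, mul_comm]
    have h1 : expSeq {e | inState 0 i e t} = ENNReal.ofReal (Real.exp (-((i + 1) * t))) := by
      rw [expSeq_apply (measurableSet_inState 0 i t)]
      have := lintegral_stdExp_memoryless (f := fun _ => 1) measurable_const ha
      rw [lintegral_one, measure_univ, mul_one] at this
      rw [← this]
      refine lintegral_congr fun x => ?_
      simp only [mem_ofPred_eq, inState_zero_seqCons, hlt, indicator, mem_Ioi]
      split_ifs with h <;> simp [h]
    rw [h1, add_zero, hinter, expSeq_apply hF, ← lintegral_stdExp_memoryless
      (measurable_expSeq_seqCons hF) ha, expSeq_apply ((measurableSet_inState 0 i t).inter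
      (measurableSet_forall_inState t i L 0))]
    refine lintegral_congr fun x => ?_
    simp only [indicator, mem_Ioi]
    split_ifs with h
    · congr 1
      ext e
      simp only [mem_ofPred_eq, inState_zero_seqCons, mem_inter_iff, hlt, h, true_and, zero_add]
      refine forall₂_congr fun p hp => ?_
      obtain ⟨r, m⟩ := p
      have hx : (x - (i + 1) * t) / (i + 1) = x / (i + 1) - t := by field_simp
      cases m with
      | zero =>
        rw [inState_zero_seqCons, inState_zero_seqCons, hx]
        constructor <;> intro h <;> linarith
      | succ m =>
        rw [inState_succ_seqCons, inState_succ_seqCons, hx,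
          show r - (x / (i + 1) - t) = t + r - x / (i + 1) by ring]
        refine and_congr_left fun _ => ?_
        constructor <;> intro h <;> linarith
    · convert measure_empty (μ := expSeq)
      ext e
      simp [inState_zero_seqCons, hlt, h]
  -- After the first jump, the process restarts in state i + 1 with t - x/(i + 1) left to run; the
  -- induction hypothesis applies for each fixed x.
  | succ n ih =>
    rw [hinter, expSeq_apply ((measurableSet_inState (n + 1) i t).inter
      (measurableSet_forall_inState t i L (n + 1))), expSeq_apply (measurableSet_inState _ _ _),
      ← lintegral_mul_const _ (measurable_expSeq_seqCons (measurableSet_inState _ _ _))]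
    refine lintegral_congr fun x => ?_
    by_cases hx : x / (i + 1) ≤ t
    · have := ih (i + 1) (t := t - x / (i + 1)) (by linarith)
      simp only [mem_ofPred_eq, inState_succ_seqCons, hx, true_and]
      rw [show i + (n + 1) = i + 1 + n by ring, ← this]
      congr 1
      ext e
      simp only [mem_inter_iff, mem_ofPred_eq, inState_succ_seqCons, hx, true_and]
      refine and_congr_right fun _ => forall₂_congr fun p hp => ?_
      rw [show n + 1 + p.2 = n + p.2 + 1 by ring, inState_succ_seqCons,
        show t + p.1 - x / (i + 1) = t - x / (i + 1) + p.1 by ring]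
      exact and_iff_right (by linarith [hL p hp])
    · simp [mem_ofPred_eq, inState_succ_seqCons, hx]

/-- The transition probabilities of the Yule process. -/
lemma expSeq_inState (n i : ℕ) {t : ℝ} (ht : 0 ≤ t) :
    expSeq {e | inState n i e t} = ENNReal.ofReal
      (((i + n).choose n : ℝ) * Real.exp (-((i + 1) * t)) * (1 - Real.exp (-t)) ^ n) := by
  induction n generalizing i t with
  | zero =>
    have hi : (0 : ℝ) < i + 1 := by positivity
    have ha : 0 ≤ (i + 1) * t := by positivity
    rw [expSeq_apply (measurableSet_inState 0 i t)]
    have := lintegral_stdExp_memoryless (f := fun _ => 1) measurable_const ha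
    rw [lintegral_one, measure_univ, mul_one] at this
    simp only [add_zero, Nat.choose_zero_right, Nat.cast_one, one_mul, pow_zero, mul_one]
    rw [← this]
    refine lintegral_congr fun x => ?_
    simp only [mem_ofPred_eq, inState_zero_seqCons, indicator, mem_Ioi, lt_div_iff₀ hi,
      mul_comm t]
    split_ifs with h <;> simp [h]
  | succ n ih =>
    have hi : (0 : ℝ) < i + 1 := by positivity
    have ha : 0 ≤ (i + 1) * t := by positivity
    set c : ℝ := ((i + 1 + n).choose n : ℝ) * Real.exp (-((i + 1) * t))
    have hc : 0 ≤ c := by positivity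
    -- The time left after the first jump. The integrand over the first clock has an explicit
    -- antiderivative in exp(-w).
    set w : ℝ → ℝ := fun x => t - x / (i + 1)
    have hderiv : ∀ x, HasDerivAt (fun x => -(c * (i + 1) / (n + 1)) * (1 - Real.exp (-(w x))) ^ (n + 1))
        (c * (Real.exp (-(w x)) * (1 - Real.exp (-(w x))) ^ n)) x := by
      intro x
      have h1 : HasDerivAt w (-(1 / (i + 1))) x :=
        ((hasDerivAt_id x).div_const _).const_sub t
      have h2 := ((((h1.neg).exp).const_sub 1).pow (n + 1)).const_mul (-(c * (i + 1) / (n + 1)))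
      refine h2.congr_deriv ?_
      simp only [Pi.neg_apply]
      push_cast
      field_simp
    have hg : Continuous fun x => c * (Real.exp (-(w x)) * (1 - Real.exp (-(w x))) ^ n) := by
      simp only [w]; fun_prop
    have hint : ∫ x in (0 : ℝ)..(i + 1) * t, c * (Real.exp (-(w x)) * (1 - Real.exp (-(w x))) ^ n)
        = c * (i + 1) / (n + 1) * (1 - Real.exp (-t)) ^ (n + 1) := by
      rw [intervalIntegral.integral_eq_sub_of_hasDerivAt (fun x _ => hderiv x)
        (hg.intervalIntegrable _ _)]
      have hw1 : w ((i + 1) * t) = 0 := by simp only [w]; field_simp; ring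
      have hw0 : w 0 = t := by simp [w]
      rw [hw1, hw0]
      simp
    rw [expSeq_apply (measurableSet_inState _ _ _), lintegral_stdExp
      (measurable_expSeq_seqCons (measurableSet_inState _ _ _))]
    have hpt : ∀ x ∈ Ioi (0 : ℝ), ENNReal.ofReal (Real.exp (-x))
        * expSeq {e | seqCons x e ∈ {e | inState (n + 1) i e t}}
        = (Ioc 0 ((i + 1) * t)).indicator (fun x => ENNReal.ofReal
          (c * (Real.exp (-(w x)) * (1 - Real.exp (-(w x))) ^ n))) x := by
      intro x hx
      have hle : x / (i + 1) ≤ t ↔ x ≤ (i + 1) * t := by rw [div_le_iff₀ hi, mul_comm]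
      simp only [mem_ofPred_eq, inState_succ_seqCons, indicator, mem_Ioc, mem_Ioi.1 hx, true_and, hle]
      split_ifs with h
      · simp only [h, true_and]
        rw [ih (i + 1) (by rw [sub_nonneg]; exact hle.2 h), ← ENNReal.ofReal_mul (Real.exp_pos _).le]
        congr 1
        have hexp : Real.exp (-x) * Real.exp (-(((i + 1 : ℕ) + 1) * (t - x / (i + 1))))
            = Real.exp (-((i + 1) * t)) * Real.exp (-(w x)) := by
          rw [← Real.exp_add, ← Real.exp_add]
          congr 1
          simp only [w]
          push_cast
          field_simp
          ring
        simp only [c]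
        linear_combination ((i + 1 + n).choose n : ℝ) * (1 - Real.exp (-(w x))) ^ n * hexp
      · simp [h]
    rw [setLIntegral_congr_fun measurableSet_Ioi hpt, setLIntegral_indicator measurableSet_Ioc,
      inter_eq_left.2 Ioc_subset_Ioi_self, ← ofReal_integral_eq_lintegral_ofReal,
      ← intervalIntegral.integral_of_le ha, hint]
    · congr 1
      -- The integral contributes the factor (i + 1)/(n + 1), which turns one binomial coefficient
      -- into the next.
      have hch : ((i + 1 + n).choose (n + 1) : ℝ) * (n + 1) = (i + 1 + n).choose n * (i + 1) := by
        have := Nat.choose_succ_right_eq (i + 1 + n) n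
        rw [Nat.add_sub_cancel] at this
        exact_mod_cast this
      simp only [c]
      rw [show i + (n + 1) = i + 1 + n by ring]
      have : ((i + 1 + n).choose (n + 1) : ℝ) = (i + 1 + n).choose n * (i + 1) / (n + 1) := by
        rw [← hch]; field_simp
      rw [this]
      ring
    · exact (hg.integrableOn_Icc).mono_set Ioc_subset_Icc_self
    · refine (ae_restrict_iff' measurableSet_Ioc).2 (ae_of_all _ fun x hx => ?_)
      have : 0 ≤ w x := by
        have := (div_le_iff₀ hi).2 (by rw [mul_comm]; exact hx.2 : x ≤ t * (i + 1))
        exact sub_nonneg.2 this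
      have : 0 ≤ 1 - Real.exp (-(w x)) := by
        rw [sub_nonneg, Real.exp_le_one_iff]; linarith
      positivity

/-- The Yule process started in state `i` at time `0` is in state `k` at time `t`. -/
def yuleAt (i : ℕ) (e : ℕ → ℝ) (t : ℝ) (k : ℕ) : Prop := i ≤ k ∧ inState (k - i) i e t

lemma yuleAt_zero_iff {e : ℕ → ℝ} {t : ℝ} {k : ℕ} : yuleAt 0 e t k ↔ inState k 0 e t := by
  simp [yuleAt]

lemma yuleAt_mono {i j k : ℕ} {e : ℕ → ℝ} {s t : ℝ} (hst : s ≤ t) (hs : yuleAt i e s j)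
    (ht : yuleAt i e t k) : j ≤ k := by
  have := inState_mono hst hs.2 ht.2
  have := hs.1
  have := ht.1
  omega

lemma measurableSet_yuleAt (i k : ℕ) (t : ℝ) : MeasurableSet {e | yuleAt i e t k} :=
  (MeasurableSet.const _).inter (measurableSet_inState _ _ _)

lemma expSeq_yuleAt_inter (i j : ℕ) {t : ℝ} (ht : 0 ≤ t) (L : Finset (ℝ × ℕ))
    (hL : ∀ p ∈ L, 0 ≤ p.1) :
    expSeq {e | yuleAt i e t j ∧ ∀ p ∈ L, yuleAt i e (t + p.1) p.2}
      = expSeq {e | yuleAt i e t j} * expSeq {e | ∀ p ∈ L, yuleAt j e p.1 p.2} := by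
  rcases lt_or_ge j i with hij | hij
  · have : ∀ e, ¬ yuleAt i e t j := fun e h => absurd h.1 (not_le.2 hij)
    simp [this]
  -- A target below j makes both events empty; otherwise the truncated subtractions below are
  -- genuine.
  by_cases hlow : ∃ p ∈ L, p.2 < j
  · obtain ⟨p, hp, hpj⟩ := hlow
    have h1 : {e | yuleAt i e t j ∧ ∀ p ∈ L, yuleAt i e (t + p.1) p.2} = ∅ :=
      eq_empty_of_forall_notMem fun e he =>
        absurd (yuleAt_mono (by linarith [hL p hp]) he.1 (he.2 p hp)) (not_le.2 hpj)
    have h2 : {e | ∀ p ∈ L, yuleAt j e p.1 p.2} = ∅ :=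
      eq_empty_of_forall_notMem fun e he => absurd (he p hp).1 (not_le.2 hpj)
    rw [h1, h2, measure_empty, mul_zero]
  push Not at hlow
  obtain ⟨n, rfl⟩ := Nat.exists_eq_add_of_le hij
  have key := expSeq_inState_inter n i ht (L.image fun p => (p.1, p.2 - (i + n)))
    (by simp only [Finset.forall_mem_image]; exact hL)
  simp only [Finset.forall_mem_image] at key
  convert key using 2
  · ext e
    simp only [mem_ofPred_eq, yuleAt, Nat.le_add_right, Nat.add_sub_cancel_left, true_and]
    refine and_congr_right fun _ => forall₂_congr fun p hp => ?_
    have := hlow p hp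
    rw [show n + (p.2 - (i + n)) = p.2 - i by omega]
    exact and_iff_right (by omega)
  · congr 1
    ext e
    simp [yuleAt]
  · congr 1
    ext e
    exact forall₂_congr fun p hp => and_iff_right (hlow p hp)

/-- Induction on the number of times, removing the earliest time u: the process restarts from `f u`,
with all remaining times shifted by u. -/
lemma expSeq_forall_yuleAt_inter (i : ℕ) (J : Finset ℝ) (f : ℝ → ℕ) {s t : ℝ} (hs : s ∈ J)
    (hJ : ∀ r ∈ J, r ∈ Icc 0 s) (hst : s ≤ t) (b : ℕ) :
    expSeq {e | (∀ r ∈ J, yuleAt i e r (f r)) ∧ yuleAt i e t b}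
      = expSeq {e | ∀ r ∈ J, yuleAt i e r (f r)} * expSeq {e | yuleAt (f s) e (t - s) b} := by
  induction hn : J.card using Nat.strong_induction_on generalizing i J f s t with
  | _ n ih =>
    set u := J.min' ⟨s, hs⟩
    have hu : u ∈ J := J.min'_mem _
    rcases (J.min'_le s hs).eq_or_lt with hus | hus
    · have hJs : J = {s} := Finset.eq_singleton_iff_unique_mem.2 ⟨hs, fun r hr =>
        le_antisymm (hJ r hr).2 (hus ▸ J.min'_le r hr)⟩
      have key := expSeq_yuleAt_inter i (f s) (hJ s hs).1 {(t - s, b)}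
        (by simpa using hst)
      subst hJs
      simpa using key
    · set J' := (J.erase u).image fun r => r - u
      have hcard : J'.card < n := by
        refine Finset.card_image_le.trans_lt ?_
        rw [← hn]
        exact Finset.card_erase_lt_of_mem hu
      have hu0 : 0 ≤ u := (hJ u hu).1
      have hsJ : s ∈ J.erase u := Finset.mem_erase.2 ⟨hus.ne', hs⟩
      have hle : ∀ r ∈ J.erase u, u ≤ r := fun r hr => J.min'_le r (Finset.mem_of_mem_erase hr)
      have key := ih _ hcard (f u) J' (fun r => f (r + u)) (s := s - u) (t := t - u)
        (Finset.mem_image_of_mem _ hsJ)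
        (by
          simp only [J', Finset.forall_mem_image]
          exact fun r hr => ⟨sub_nonneg.2 (hle r hr),
            sub_le_sub_right (hJ r (Finset.mem_of_mem_erase hr)).2 _⟩)
        (sub_le_sub_right hst _) rfl
      simp only [J', Finset.forall_mem_image, sub_add_cancel, sub_sub_sub_cancel_right] at key
      have h1 := expSeq_yuleAt_inter i (f u) hu0 ((J.erase u).image fun r => (r - u, f r))
        (by simp only [Finset.forall_mem_image]; exact fun r hr => sub_nonneg.2 (hle r hr))
      have h2 := expSeq_yuleAt_inter i (f u) hu0
        (insert (t - u, b) ((J.erase u).image fun r => (r - u, f r)))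
        (by
          simp only [Finset.forall_mem_insert, Finset.forall_mem_image]
          exact ⟨sub_nonneg.2 (hus.le.trans hst), fun r hr => sub_nonneg.2 (hle r hr)⟩)
      simp only [Finset.forall_mem_insert, Finset.forall_mem_image, add_sub_cancel] at h1 h2
      have hins : ∀ e, (∀ r ∈ J, yuleAt i e r (f r)) ↔
          yuleAt i e u (f u) ∧ ∀ r ∈ J.erase u, yuleAt i e r (f r) := fun e => by
        conv_lhs => rw [← Finset.insert_erase hu]
        rw [Finset.forall_mem_insert]
      have e1 : {e | (∀ r ∈ J, yuleAt i e r (f r)) ∧ yuleAt i e t b}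
          = {e | yuleAt i e u (f u) ∧ yuleAt i e t b ∧ ∀ r ∈ J.erase u, yuleAt i e r (f r)} := by
        ext e
        simp only [mem_ofPred_eq, hins]
        tauto
      have e2 : {e | yuleAt (f u) e (t - u) b ∧ ∀ r ∈ J.erase u, yuleAt (f u) e (r - u) (f r)}
          = {e | (∀ r ∈ J.erase u, yuleAt (f u) e (r - u) (f r)) ∧ yuleAt (f u) e (t - u) b} := by
        ext e
        exact and_comm
      simp only [hins] at e1 ⊢
      rw [e1, h2, e2, key, h1, mul_assoc]

/-! ### Criteria for the Markov property -/

/-- Cylinders that fix the coordinate `i₀` suffice, since the others are obtained by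
marginalization. In the applications `i₀` carries the present time; for a single process this makes
the kernel constant on each cylinder. -/
lemma measure_eq_of_forall_cylinder {ι Ω : Type*} [MeasurableSpace Ω] {X : ι → Ω → ℕ}
    (hX : ∀ i, Measurable (X i)) (i₀ : ι) {m₁ m₂ : Measure Ω} [IsFiniteMeasure m₁]
    [IsFiniteMeasure m₂]
    (h : ∀ J : Finset ι, i₀ ∈ J → ∀ f : ι → ℕ,
      m₁ {ω | ∀ i ∈ J, X i ω = f i} = m₂ {ω | ∀ i ∈ J, X i ω = f i})
    {C : Set Ω} (hC : MeasurableSet[⨆ i, MeasurableSpace.comap (X i) inferInstance] C) :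
    m₁ C = m₂ C := by
  classical
  have hpath : Measurable fun ω i => X i ω := measurable_pi_iff.2 hX
  have hres : ∀ I : Finset ι, Measurable fun ω => I.restrict fun i => X i ω := fun I =>
    (Finset.measurable_restrict I).comp hpath
  have hbig : ∀ I : Finset ι, i₀ ∈ I → m₁.map (fun ω => I.restrict fun i => X i ω)
      = m₂.map (fun ω => I.restrict fun i => X i ω) := by
    intro I hI
    refine Measure.ext_of_singleton fun x => ?_
    rw [Measure.map_apply (hres I) (measurableSet_singleton x),
      Measure.map_apply (hres I) (measurableSet_singleton x)]
    have hset : (fun ω => I.restrict fun i => X i ω) ⁻¹' {x}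
        = {ω | ∀ i ∈ I, X i ω = if h : i ∈ I then x ⟨i, h⟩ else 0} := by
      ext ω
      constructor
      · intro hω i hi
        rw [dif_pos hi]
        exact congrFun hω ⟨i, hi⟩
      · intro hω
        funext i
        have := hω i i.2
        rw [dif_pos i.2] at this
        exact this
    rw [hset]
    exact h I hI _
  have hall : ∀ I : Finset ι, m₁.map (fun ω => I.restrict fun i => X i ω)
      = m₂.map (fun ω => I.restrict fun i => X i ω) := by
    intro I
    have hcomp : (fun ω => I.restrict fun i => X i ω)
        = Finset.restrict₂ (Finset.subset_insert i₀ I) ∘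
          fun ω => (insert i₀ I).restrict fun i => X i ω := rfl
    have hm := Finset.measurable_restrict₂ (X := fun _ : ι => ℕ) (Finset.subset_insert i₀ I)
    rw [hcomp, ← Measure.map_map hm (hres (insert i₀ I)),
      ← Measure.map_map hm (hres (insert i₀ I)), hbig _ (Finset.mem_insert_self _ _)]
  have h1 := isProjectiveLimit_map (P := m₁) (X := X) hpath.aemeasurable
  have h2 := isProjectiveLimit_map (P := m₂) (X := X) hpath.aemeasurable
  simp_rw [hall] at h1
  have hmap := h1.unique h2
  obtain ⟨D, hD, rfl⟩ : MeasurableSet[MeasurableSpace.comap (fun ω i => X i ω) inferInstance] C := by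
    refine (iSup_le fun i => ?_ : (⨆ i, MeasurableSpace.comap (X i) inferInstance) ≤ _) C hC
    have : X i = (fun x : ι → ℕ => x i) ∘ fun ω i => X i ω := rfl
    conv_lhs => rw [this]
    have hm : Measurable fun x : ι → ℕ => x i := measurable_pi_apply i
    exact (hm.comp (comap_measurable _)).comap_le
  rw [← Measure.map_apply hpath hD, ← Measure.map_apply hpath hD, hmap]

/-- Being G-measurable, `g` is a version of both conditional probabilities. -/
lemma condExp_indicator_ae_eq {Ω : Type*} {F G : MeasurableSpace Ω} [mΩ : MeasurableSpace Ω]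
    {P : Measure Ω} [IsProbabilityMeasure P] (hF : F ≤ mΩ) (hGF : G ≤ F) {A : Set Ω}
    (hA : MeasurableSet A) {g : Ω → ENNReal} (hg : Measurable[G] g)
    (h : ∀ C, MeasurableSet[F] C → P (C ∩ A) = ∫⁻ ω in C, g ω ∂P) :
    P⟦A | F⟧ =ᵐ[P] P⟦A | G⟧ := by
  have hgm : Measurable g := hg.mono (hGF.trans hF) le_rfl
  have hfin : ∀ C : Set Ω, ∫⁻ ω in C, g ω ∂P ≠ ⊤ := fun C => by
    refine ne_top_of_le_ne_top (measure_ne_top P (univ ∩ A)) ?_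
    rw [h univ MeasurableSet.univ]
    exact lintegral_mono_set (subset_univ _)
  have hint : Integrable (fun ω => (g ω).toReal) P :=
    integrable_toReal_of_lintegral_ne_top hgm.aemeasurable (by simpa using hfin univ)
  have hmain : ∀ m : MeasurableSpace Ω, m ≤ F → G ≤ m →
      (fun ω => (g ω).toReal) =ᵐ[P] P⟦A | m⟧ := by
    intro m hm hGm
    refine ae_eq_condExp_of_forall_setIntegral_eq (hm.trans hF)
      ((integrable_const 1).indicator hA) (fun _ _ _ => hint.integrableOn) (fun C hC _ => ?_)
      (Measurable.stronglyMeasurable ((hg.mono hGm le_rfl).ennreal_toReal)).aestronglyMeasurable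
    rw [integral_toReal hgm.aemeasurable
      (ae_lt_top hgm (hfin C)), ← h C (hm _ hC), setIntegral_indicator hA]
    simp [measureReal_def]
  exact (hmain F le_rfl hGF).symm.trans (hmain G hGF le_rfl)

lemma condExp_indicator_congr_of_piSystem {Ω E : Type*} {F G : MeasurableSpace Ω}
    [mΩ : MeasurableSpace Ω] [mE : MeasurableSpace E] {P : Measure Ω} [IsProbabilityMeasure P]
    (hF : F ≤ mΩ) (hG : G ≤ mΩ) {Z : Ω → E} (hZ : Measurable Z) {𝒜 : Set (Set E)}
    (hgen : mE = MeasurableSpace.generateFrom 𝒜) (hpi : IsPiSystem 𝒜)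
    (h : ∀ A ∈ 𝒜, P⟦Z ⁻¹' A | F⟧ =ᵐ[P] P⟦Z ⁻¹' A | G⟧) {A : Set E} (hA : MeasurableSet A) :
    P⟦Z ⁻¹' A | F⟧ =ᵐ[P] P⟦Z ⁻¹' A | G⟧ := by
  induction A, hA using MeasurableSpace.induction_on_inter hgen hpi with
  | empty => simp
  | basic A hA => exact h A hA
  | compl A hA ih =>
    have hA' : MeasurableSet (Z ⁻¹' A) := hZ hA
    have heq : (Z ⁻¹' Aᶜ).indicator (fun _ => (1 : ℝ))
        = (fun _ => 1) - (Z ⁻¹' A).indicator fun _ => (1 : ℝ) := by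
      rw [preimage_compl, indicator_compl]
    have hi : Integrable ((Z ⁻¹' A).indicator fun _ => (1 : ℝ)) P :=
      (integrable_const 1).indicator hA'
    rw [heq]
    refine (condExp_sub (integrable_const 1) hi F).trans
      (EventuallyEq.trans ?_ (condExp_sub (integrable_const 1) hi G).symm)
    rw [condExp_const hF, condExp_const hG]
    exact EventuallyEq.rfl.sub ih
  | iUnion A hd hA ih =>
    have hA' : ∀ n, MeasurableSet (Z ⁻¹' A n) := fun n => hZ (hA n)
    -- Finite partial unions follow by linearity; dominated convergence of `condExpL1` and
    -- uniqueness of limits give the countable union.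
    set fs : ℕ → Ω → ℝ := fun N => (⋃ n ∈ Finset.range N, Z ⁻¹' A n).indicator fun _ => 1
    have hms : ∀ N, MeasurableSet (⋃ n ∈ Finset.range N, Z ⁻¹' A n) := fun N =>
      Finset.measurableSet_biUnion _ fun n _ => hA' n
    have hfs : ∀ N, fs N = ∑ n ∈ Finset.range N, (Z ⁻¹' A n).indicator fun _ => (1 : ℝ) := by
      intro N
      funext ω
      simp only [fs]
      rw [Finset.indicator_biUnion_apply, Finset.sum_apply]
      intro a _ b _ hab
      exact (hd hab).preimage Z
    have hci : ∀ n, Integrable ((Z ⁻¹' A n).indicator fun _ => (1 : ℝ)) P := fun n =>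
      (integrable_const 1).indicator (hA' n)
    have hN : ∀ N, P[fs N | F] =ᵐ[P] P[fs N | G] := by
      intro N
      rw [hfs]
      refine (condExp_finsetSum (fun n _ => hci n) F).trans
        (EventuallyEq.trans ?_ (condExp_finsetSum (fun n _ => hci n) G).symm)
      have := ae_all_iff.2 ih
      filter_upwards [this] with ω hω
      simp only [Finset.sum_apply]
      exact Finset.sum_congr rfl fun n _ => hω n
    have hlim : ∀ m (hm : m ≤ mΩ), Tendsto (fun N => condExpL1 hm P (fs N)) atTop
        (𝓝 (condExpL1 hm P ((Z ⁻¹' ⋃ n, A n).indicator fun _ => (1 : ℝ)))) := by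
      intro m hm
      refine tendsto_condExpL1_of_dominated_convergence hm (fun _ => 1)
        (fun N => (aestronglyMeasurable_const.indicator (hms N))) (integrable_const 1)
        (fun N => ae_of_all _ fun ω => ?_) (ae_of_all _ fun ω => ?_)
      · simp only [fs, indicator]
        split_ifs <;> simp
      · refine tendsto_const_nhds.congr' ?_
        by_cases hω : ∃ n, ω ∈ Z ⁻¹' A n
        · obtain ⟨n, hn⟩ := hω
          filter_upwards [eventually_gt_atTop n] with N hN
          rw [indicator_of_mem (by rw [preimage_iUnion]; exact mem_iUnion.2 ⟨n, hn⟩),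
            show fs N ω = 1 from
              indicator_of_mem (mem_iUnion₂.2 ⟨n, Finset.mem_range.2 hN, hn⟩) _]
        · refine Eventually.of_forall fun N => ?_
          push Not at hω
          rw [indicator_of_notMem (by
            rw [preimage_iUnion]; intro h; obtain ⟨n, hn⟩ := mem_iUnion.1 h; exact hω n hn)]
          exact (indicator_of_notMem (by
            intro h; obtain ⟨n, -, hn⟩ := mem_iUnion₂.1 h; exact hω n hn) _).symm
    have heq : (fun N => condExpL1 hF P (fs N)) = fun N => condExpL1 hG P (fs N) := by
      funext N
      refine Lp.ext ?_
      exact (condExp_ae_eq_condExpL1 hF _).symm.trans ((hN N).trans (condExp_ae_eq_condExpL1 hG _))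
    have hl := hlim F hF
    rw [heq] at hl
    refine (condExp_ae_eq_condExpL1 hF _).trans
      (EventuallyEq.trans ?_ (condExp_ae_eq_condExpL1 hG _).symm)
    rw [tendsto_nhds_unique hl (hlim G hG)]

theorem isMarkov_of_piSystem {Ω E : Type*} [MeasurableSpace Ω] [mE : MeasurableSpace E]
    {P : Measure Ω} [IsProbabilityMeasure P] {Z : UnitTime → Ω → E} (hZ : ∀ t, Measurable (Z t))
    {𝒜 : Set (Set E)} (hgen : mE = MeasurableSpace.generateFrom 𝒜) (hpi : IsPiSystem 𝒜)
    (h : ∀ s t : UnitTime, s ≤ t → ∀ A ∈ 𝒜, ∃ g : E → ENNReal, Measurable g ∧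
      ∀ C, MeasurableSet[⨆ r : Set.Iic s, MeasurableSpace.comap (Z r) inferInstance] C →
        P (C ∩ Z t ⁻¹' A) = ∫⁻ ω in C, g (Z s ω) ∂P) :
    IsMarkov Z P := by
  refine ⟨hZ, fun s t hst A hA => ?_⟩
  have hF : (⨆ r : Set.Iic s, MeasurableSpace.comap (Z r) inferInstance) ≤ ‹MeasurableSpace Ω› :=
    iSup_le fun r => (hZ r).comap_le
  have hGF : MeasurableSpace.comap (Z s) inferInstance ≤
      ⨆ r : Set.Iic s, MeasurableSpace.comap (Z r) inferInstance :=
    le_iSup (fun r : Set.Iic s => MeasurableSpace.comap (Z r) inferInstance)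
      ⟨s, mem_Iic.2 le_rfl⟩
  refine condExp_indicator_congr_of_piSystem hF (hGF.trans hF) (hZ t) hgen hpi (fun A hA => ?_) hA
  obtain ⟨g, hg, hC⟩ := h s t hst A hA
  have hAm : MeasurableSet A := hgen ▸ MeasurableSpace.measurableSet_generateFrom hA
  exact condExp_indicator_ae_eq hF hGF (hZ t hAm) (hg.comp (comap_measurable (Z s))) hC

/-! ### The time-changed Yule process -/

/-- The time change from `[0,1)` to `[0,∞)` turning geometric birth processes into Yule
processes. -/
def logTime (t : UnitTime) : ℝ := -Real.log (1 - (t : ℝ))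

lemma one_sub_pos (t : UnitTime) : 0 < 1 - (t : ℝ) := sub_pos.2 t.2.2

lemma exp_neg_logTime (t : UnitTime) : Real.exp (-logTime t) = 1 - (t : ℝ) := by
  rw [logTime, neg_neg, Real.exp_log (one_sub_pos t)]

lemma logTime_mono : Monotone logTime := fun _ t hst =>
  neg_le_neg (Real.log_le_log (one_sub_pos t) (sub_le_sub_left (Subtype.coe_le_coe.2 hst) _))

lemma logTime_nonneg (t : UnitTime) : 0 ≤ logTime t :=
  neg_nonneg.2 (Real.log_nonpos (one_sub_pos t).le (by linarith [t.2.1]))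

lemma toUnitTime_logTime (t : UnitTime) : toUnitTime (1 - Real.exp (-logTime t)) = t := by
  rw [exp_neg_logTime, sub_sub_cancel, toUnitTime_coe]

lemma continuous_logTime : Continuous logTime :=
  ((continuous_const.sub continuous_subtype_val).log fun t => (one_sub_pos t).ne').neg

/-- The probability that the time-changed Yule process is in `D` at time `t`, given that it is in
state `a` at time `s`. -/
def yuleKernel (s t : UnitTime) (D : Set ℕ) (a : ℕ) : ENNReal :=
  expSeq {e | ∃ b ∈ D, yuleAt a e (logTime t - logTime s) b}

lemma yuleAt_unique {i j k : ℕ} {e : ℕ → ℝ} {t : ℝ} (hj : yuleAt i e t j) (hk : yuleAt i e t k) :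
    j = k :=
  le_antisymm (yuleAt_mono le_rfl hj hk) (yuleAt_mono le_rfl hk hj)

lemma yuleKernel_eq_tsum (s t : UnitTime) (D : Set ℕ) (a : ℕ) :
    yuleKernel s t D a = ∑' b : D, yuleKernel s t {(b : ℕ)} a := by
  have h1 : {e | ∃ b ∈ D, yuleAt a e (logTime t - logTime s) b}
      = ⋃ b : D, {e | yuleAt a e (logTime t - logTime s) b} := by
    ext e
    simp
  rw [yuleKernel, h1, measure_iUnion (fun b c hbc => ?_) fun b => measurableSet_yuleAt _ _ _]
  · simp [yuleKernel]
  · exact disjoint_left.2 fun e hb hc => hbc (Subtype.ext (yuleAt_unique hb hc))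

lemma yuleKernel_le_one (s t : UnitTime) (D : Set ℕ) (a : ℕ) : yuleKernel s t D a ≤ 1 := prob_le_one

/-- In logarithmic time, exp(-elapsed time) is (1 - t)/(1 - s), so the kernel is negative binomial
and rational in the original time. -/
lemma yuleKernel_singleton {s t : UnitTime} (hst : s ≤ t) (a n : ℕ) :
    yuleKernel s t {a + n} a = ENNReal.ofReal (((a + n).choose n : ℝ)
      * ((1 - (t : ℝ)) / (1 - (s : ℝ))) ^ (a + 1) * (1 - (1 - (t : ℝ)) / (1 - (s : ℝ))) ^ n) := by
  have hexp : Real.exp (-(logTime t - logTime s)) = (1 - (t : ℝ)) / (1 - (s : ℝ)) := by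
    rw [neg_sub, Real.exp_sub, ← exp_neg_logTime, ← exp_neg_logTime, Real.exp_neg, Real.exp_neg]
    field_simp
  have hset : {e | ∃ b ∈ ({a + n} : Set ℕ), yuleAt a e (logTime t - logTime s) b}
      = {e | inState n a e (logTime t - logTime s)} := by
    ext e
    simp [yuleAt]
  rw [yuleKernel, hset, expSeq_inState n a (sub_nonneg.2 (logTime_mono hst)), hexp, ← hexp,
    ← Real.exp_nat_mul]
  push_cast
  ring_nf

/-- `X` is a version of the time-changed Yule process. -/
structure IsYule {Ω : Type*} [MeasurableSpace Ω] (X : UnitTime → Ω → ℕ) (P : Measure Ω) : Prop where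
  measurable : ∀ t, Measurable (X t)
  exists_clock : ∃ E : Ω → ℕ → ℝ, MeasurePreserving E P expSeq ∧
    ∀ᵐ ω ∂P, ∀ t, yuleAt 0 (E ω) (logTime t) (X t ω)

namespace IsYule

variable {Ω : Type*} [MeasurableSpace Ω] {P : Measure Ω} {X : UnitTime → Ω → ℕ}

lemma measure_cylinder (hX : IsYule X P) (J : Finset UnitTime) (f : UnitTime → ℕ) :
    P {ω | ∀ r ∈ J, X r ω = f r} = expSeq {e | ∀ r ∈ J, yuleAt 0 e (logTime r) (f r)} := by
  obtain ⟨E, hE, h⟩ := hX.exists_clock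
  have hm : MeasurableSet {e | ∀ r ∈ J, yuleAt 0 e (logTime r) (f r)} := by
    have : {e | ∀ r ∈ J, yuleAt 0 e (logTime r) (f r)}
        = ⋂ r ∈ J, {e | yuleAt 0 e (logTime r) (f r)} := by
      ext e
      simp
    rw [this]
    exact Finset.measurableSet_biInter _ fun r _ => measurableSet_yuleAt _ _ _
  rw [← hE.measure_preimage hm.nullMeasurableSet]
  refine measure_congr (eventuallyEq_set.2 ?_)
  filter_upwards [h] with ω hω
  refine forall₂_congr fun r _ => ⟨fun hr => hr ▸ hω r, fun hr => yuleAt_unique (hω r) hr⟩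

lemma isProbabilityMeasure (hX : IsYule X P) : IsProbabilityMeasure P := by
  obtain ⟨E, hE, -⟩ := hX.exists_clock
  exact ⟨by rw [← preimage_univ (f := E), hE.measure_preimage MeasurableSet.univ.nullMeasurableSet,
    measure_univ]⟩

lemma marginal (hX : IsYule X P) (t : UnitTime) (k : ℕ) :
    P (X t ⁻¹' {k}) = ENNReal.ofReal ((1 - (t : ℝ)) * (t : ℝ) ^ k) := by
  have h := hX.measure_cylinder {t} fun _ => k
  simp only [Finset.mem_singleton, forall_eq, yuleAt_zero_iff] at h
  rw [expSeq_inState k 0 (logTime_nonneg t)] at h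
  refine h.trans ?_
  simp [exp_neg_logTime]

lemma measure_cylinder_inter (hX : IsYule X P) (J : Finset UnitTime) (f : UnitTime → ℕ)
    {s t : UnitTime} (hs : s ∈ J) (hJ : ∀ r ∈ J, r ≤ s) (hst : s ≤ t) (b : ℕ) :
    P ({ω | ∀ r ∈ J, X r ω = f r} ∩ X t ⁻¹' {b})
      = P {ω | ∀ r ∈ J, X r ω = f r} * yuleKernel s t {b} (f s) := by
  classical
  have key := expSeq_forall_yuleAt_inter 0 (J.image logTime)
    (fun x => f (toUnitTime (1 - Real.exp (-x)))) (Finset.mem_image_of_mem logTime hs)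
    (by
      simp only [Finset.forall_mem_image]
      exact fun r hr => ⟨logTime_nonneg r, logTime_mono (hJ r hr)⟩) (logTime_mono hst) b
  simp only [Finset.forall_mem_image, toUnitTime_logTime] at key
  rw [hX.measure_cylinder]
  have h2 : yuleKernel s t {b} (f s) = expSeq {e | yuleAt (f s) e (logTime t - logTime s) b} := by
    simp [yuleKernel]
  rw [h2, ← key]
  obtain ⟨E, hE, h⟩ := hX.exists_clock
  have hm : MeasurableSet {e | (∀ r ∈ J, yuleAt 0 e (logTime r) (f r))
      ∧ yuleAt 0 e (logTime t) b} := by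
    have : {e | (∀ r ∈ J, yuleAt 0 e (logTime r) (f r)) ∧ yuleAt 0 e (logTime t) b}
        = (⋂ r ∈ J, {e | yuleAt 0 e (logTime r) (f r)}) ∩ {e | yuleAt 0 e (logTime t) b} := by
      ext e
      simp
    rw [this]
    exact (Finset.measurableSet_biInter _ fun r _ => measurableSet_yuleAt _ _ _).inter
      (measurableSet_yuleAt _ _ _)
  rw [← hE.measure_preimage hm.nullMeasurableSet]
  refine measure_congr (eventuallyEq_set.2 ?_)
  filter_upwards [h] with ω hω
  have hiff : ∀ r k, X r ω = k ↔ yuleAt 0 (E ω) (logTime r) k := fun r k =>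
    ⟨fun hr => hr ▸ hω r, fun hr => yuleAt_unique (hω r) hr⟩
  exact and_congr (forall₂_congr fun r _ => hiff r _) (hiff t b)

/-- The Markov property of the Yule process, with its transition kernel. -/
lemma measure_inter_eq_lintegral (hX : IsYule X P) {s t : UnitTime} (hst : s ≤ t) (D : Set ℕ)
    {C : Set Ω} (hC : MeasurableSet[⨆ r : Set.Iic s, MeasurableSpace.comap (X r) inferInstance] C) :
    P (C ∩ X t ⁻¹' D) = ∫⁻ ω in C, yuleKernel s t D (X s ω) ∂P := by
  classical
  have := hX.isProbabilityMeasure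
  have hCm : MeasurableSet C := (iSup_le fun r : Set.Iic s => (hX.measurable r).comap_le) C hC
  have hker : ∀ D, Measurable fun ω => yuleKernel s t D (X s ω) := fun D =>
    (measurable_of_countable (yuleKernel s t D)).comp (hX.measurable s)
  have hsingle : ∀ b : ℕ, P (C ∩ X t ⁻¹' {b}) = ∫⁻ ω in C, yuleKernel s t {b} (X s ω) ∂P := by
    intro b
    have hfin : IsFiniteMeasure (P.withDensity fun ω => yuleKernel s t {b} (X s ω)) :=
      isFiniteMeasure_withDensity (ne_top_of_le_ne_top (measure_ne_top P univ) (by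
        rw [← lintegral_one]
        exact lintegral_mono fun ω => yuleKernel_le_one _ _ _ _))
    have key := measure_eq_of_forall_cylinder (X := fun r : Set.Iic s => X r)
      (fun r => hX.measurable r) ⟨s, mem_Iic.2 le_rfl⟩ (m₁ := P.restrict (X t ⁻¹' {b}))
      (m₂ := P.withDensity fun ω => yuleKernel s t {b} (X s ω)) (fun J hJ f => ?_) hC
    · rwa [Measure.restrict_apply hCm, withDensity_apply _ hCm] at key
    -- The default value 0 is never used: all times in `J` are at most `s`.
    · set F : UnitTime → ℕ := fun r => if h : r ≤ s then f ⟨r, h⟩ else 0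
      have hFr : ∀ r : Set.Iic s, F r = f r := fun r => dif_pos r.2
      have hset : {ω | ∀ r ∈ J, X r ω = f r}
          = {ω | ∀ r ∈ J.image Subtype.val, X r ω = F r} := by
        ext ω
        simp only [mem_ofPred_eq, Finset.forall_mem_image]
        exact forall₂_congr fun r _ => by rw [hFr]
      have hm : MeasurableSet {ω | ∀ r ∈ J, X r ω = f r} := by
        have : {ω | ∀ r ∈ J, X r ω = f r} = ⋂ r ∈ J, X r ⁻¹' {f r} := by
          ext ω
          simp
        rw [this]
        exact Finset.measurableSet_biInter _ fun r _ => hX.measurable r (measurableSet_singleton _)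
      have hsJ : s ∈ J.image Subtype.val := Finset.mem_image_of_mem Subtype.val hJ
      rw [Measure.restrict_apply hm, withDensity_apply _ hm]
      have hconst : ∫⁻ ω in {ω | ∀ r ∈ J, X r ω = f r}, yuleKernel s t {b} (X s ω) ∂P
          = ∫⁻ _ in {ω | ∀ r ∈ J, X r ω = f r}, yuleKernel s t {b} (F s) ∂P := by
        refine setLIntegral_congr_fun hm fun ω hω => ?_
        rw [hset] at hω
        show yuleKernel s t {b} (X s ω) = _
        rw [hω s hsJ]
      rw [hconst, setLIntegral_const, mul_comm, hset]
      refine hX.measure_cylinder_inter _ F hsJ ?_ hst b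
      simp only [Finset.forall_mem_image]
      exact fun r _ => r.2
  have hU : C ∩ X t ⁻¹' D = ⋃ b : D, C ∩ X t ⁻¹' {(b : ℕ)} := by
    ext ω
    simp
  rw [hU, measure_iUnion]
  · simp_rw [yuleKernel_eq_tsum s t D, hsingle]
    rw [lintegral_tsum fun b => (hker _).aemeasurable]
  · refine fun b c hbc => disjoint_left.2 fun ω hb hc => hbc (Subtype.ext ?_)
    exact (hb.2 : X t ω = b).symm.trans hc.2
  · exact fun b => hCm.inter (hX.measurable t (measurableSet_singleton _))

lemma isMarkov (hX : IsYule X P) : IsMarkov X P := by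
  have := hX.isProbabilityMeasure
  refine isMarkov_of_piSystem hX.measurable MeasurableSpace.generateFrom_measurableSet.symm
    MeasurableSpace.isPiSystem_measurableSet fun s t hst D _ =>
      ⟨yuleKernel s t D, measurable_of_countable _, fun C hC => ?_⟩
  exact hX.measure_inter_eq_lintegral hst D hC

lemma measure_inter (hX : IsYule X P) {s t : UnitTime} (hst : s ≤ t) (j b : ℕ) :
    P (X s ⁻¹' {j} ∩ X t ⁻¹' {b}) = P (X s ⁻¹' {j}) * yuleKernel s t {b} j := by
  have := hX.measure_cylinder_inter {s} (fun _ => j) (Finset.mem_singleton_self s) (by simp) hst b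
  simp only [Finset.mem_singleton, forall_eq] at this
  exact this

lemma transProb_eq (hX : IsYule X P) {s t : UnitTime} (hst : s ≤ t) {j : ℕ}
    (hj : P (X s ⁻¹' {j}) ≠ 0) (b : ℕ) : transProb X P s t j b = (yuleKernel s t {b} j).toReal := by
  have := hX.isProbabilityMeasure
  have h := real_mul_transProb (P := P) hX.measurable s t j b
  rw [measureReal_def, measureReal_def, hX.measure_inter hst, ENNReal.toReal_mul] at h
  exact mul_left_cancel₀ (ENNReal.toReal_ne_zero.2 ⟨hj, measure_ne_top _ _⟩) h

lemma ae_mono (hX : IsYule X P) : ∀ᵐ ω ∂P, Monotone fun t => X t ω := by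
  obtain ⟨E, -, h⟩ := hX.exists_clock
  filter_upwards [h] with ω hω s t hst
  exact yuleAt_mono (logTime_mono hst) (hω s) (hω t)

lemma ae_rightContinuous (hX : IsYule X P) :
    ∀ᵐ ω ∂P, ∀ t, ∀ᶠ u in 𝓝[≥] t, X u ω = X t ω := by
  obtain ⟨E, -, h⟩ := hX.exists_clock
  filter_upwards [h] with ω hω t
  obtain ⟨δ, hδ, H⟩ := inState_right (hω t).2
  have h1 : ∀ᶠ u in 𝓝 t, logTime u < logTime t + δ :=
    continuous_logTime.continuousAt.eventually_lt_const (by linarith)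
  filter_upwards [self_mem_nhdsWithin, nhdsWithin_le_nhds h1] with u hu hu'
  exact yuleAt_unique (hω u) ⟨Nat.zero_le _, H _ (logTime_mono hu) hu'⟩

lemma ae_isCadlagPath (hX : IsYule X P) : ∀ᵐ ω ∂P, IsCadlagPath fun t => X t ω := by
  filter_upwards [hX.ae_mono, hX.ae_rightContinuous] with ω h1 h2 t
  exact ⟨tendsto_const_nhds.congr' ((h2 t).mono fun u hu => hu.symm), _, h1.tendsto_nhdsLT t⟩

/-- For every s < t the event lies in {X_t = k} minus {X_s = X_t = k}, whose explicit probability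
tends to 0 as s increases to t. -/
lemma measure_forall_lt_ne (hX : IsYule X P) {t : UnitTime} (ht : 0 < (t : ℝ)) (k : ℕ) :
    P {ω | X t ω = k ∧ ∀ s < t, X s ω ≠ k} = 0 := by
  have := hX.isProbabilityMeasure
  set φ : ℝ → ℝ := fun x => (1 - (t : ℝ)) * ((t : ℝ) ^ k - (x * ((1 - t) / (1 - x))) ^ k)
  have ht1 := one_sub_pos t
  have hφ : Tendsto φ (𝓝[<] (t : ℝ)) (𝓝 0) := by
    have hc : ContinuousAt φ t := by
      have : (1 - (t : ℝ)) ≠ 0 := ht1.ne'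
      fun_prop (disch := assumption)
    have h0 : φ t = 0 := by
      simp only [φ, div_self ht1.ne', mul_one, sub_self, mul_zero]
    have := hc.tendsto.mono_left (nhdsWithin_le_nhds (s := Iio (t : ℝ)))
    rwa [h0] at this
  have hle : ∀ᶠ x in 𝓝[<] (t : ℝ), P {ω | X t ω = k ∧ ∀ s < t, X s ω ≠ k} ≤ ENNReal.ofReal (φ x) := by
    filter_upwards [Ioo_mem_nhdsLT ht] with x hx
    have hx1 : 0 < 1 - x := by linarith [hx.2]
    set s : UnitTime := ⟨x, hx.1.le, hx.2.trans t.2.2⟩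
    have hst : s < t := hx.2
    have hsub : {ω | X t ω = k ∧ ∀ s < t, X s ω ≠ k}
        ⊆ X t ⁻¹' {k} \ (X s ⁻¹' {k} ∩ X t ⁻¹' {k}) := fun ω hω => ⟨hω.1, fun h => hω.2 s hst h.1⟩
    refine (measure_mono hsub).trans ?_
    rw [measure_sdiff inter_subset_right ((hX.measurable s (measurableSet_singleton k)).inter
      (hX.measurable t (measurableSet_singleton k))).nullMeasurableSet (measure_ne_top _ _),
      hX.measure_inter hst.le, hX.marginal, hX.marginal]
    have hk := yuleKernel_singleton hst.le k 0
    rw [add_zero, Nat.choose_zero_right, pow_zero, Nat.cast_one, one_mul, mul_one] at hk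
    have hs0 : (0 : ℝ) ≤ (1 - (s : ℝ)) * (s : ℝ) ^ k :=
      mul_nonneg (one_sub_pos s).le (pow_nonneg s.2.1 k)
    rw [hk, ← ENNReal.ofReal_mul hs0, ← ENNReal.ofReal_sub _ (mul_nonneg hs0
      (pow_nonneg (div_nonneg ht1.le (one_sub_pos s).le) _))]
    refine ENNReal.ofReal_le_ofReal (le_of_eq ?_)
    show (1 - (t : ℝ)) * (t : ℝ) ^ k - (1 - x) * x ^ k * ((1 - t) / (1 - x)) ^ (k + 1) = φ x
    simp only [φ, mul_pow, pow_succ]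
    field_simp
  have hlim := (ENNReal.continuous_ofReal.tendsto 0).comp hφ
  rw [ENNReal.ofReal_zero] at hlim
  exact le_antisymm (ge_of_tendsto hlim hle) zero_le

/-- If X_s = X_t for some s < t, monotonicity makes the path constant on [s, t];
`measure_forall_lt_ne` supplies such an s almost surely when t > 0. -/
lemma ae_continuousAt (hX : IsYule X P) (t : UnitTime) :
    ∀ᵐ ω ∂P, ContinuousAt (fun s => X s ω) t := by
  have hleft : ∀ᵐ ω ∂P, ∀ᶠ s in 𝓝[<] t, X s ω = X t ω := by
    rcases t.2.1.eq_or_lt with h0 | h0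
    · have : 𝓝[<] t = ⊥ := by
        have : Iio t = ∅ := eq_empty_of_forall_notMem fun s hs => by
          have h1 : (s : ℝ) < t := hs
          linarith [s.2.1]
        rw [this, nhdsWithin_empty]
      simp [this]
    · have hall : ∀ᵐ ω ∂P, ∀ k, ¬ (X t ω = k ∧ ∀ s < t, X s ω ≠ k) :=
        ae_all_iff.2 fun k => by
          rw [ae_iff]
          simp only [not_not]
          exact hX.measure_forall_lt_ne h0 k
      filter_upwards [hall, hX.ae_mono] with ω hω hmono
      have := hω (X t ω)
      push Not at this
      obtain ⟨s, hs, hst⟩ := this rfl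
      filter_upwards [Ico_mem_nhdsLT hs] with r hr
      exact le_antisymm (hmono hr.2.le) (hst ▸ hmono hr.1)
  filter_upwards [hleft, hX.ae_rightContinuous] with ω h1 h2
  rw [continuousAt_iff_continuous_left'_right']
  exact ⟨tendsto_const_nhds.congr' (h1.mono fun s hs => hs.symm),
    tendsto_const_nhds.congr' (((h2 t).filter_mono (nhdsWithin_mono _ Ioi_subset_Ici_self)).mono
      fun s hs => hs.symm)⟩

lemma isLittleO_of_hasDerivAt {f : ℝ → ℝ} {f' : ℝ} {t : UnitTime} (hf : HasDerivAt f f' t) :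
    (fun u : UnitTime => f u - (f t + ((u : ℝ) - t) * f')) =o[𝓝[>] t]
      fun u : UnitTime => (u : ℝ) - t := by
  have h := (hasDerivAt_iff_isLittleO.1 hf).comp_tendsto
    ((continuous_subtype_val.tendsto t).mono_left (nhdsWithin_le_nhds (s := Ioi t)))
  refine h.congr_left fun u => ?_
  simp only [Function.comp, smul_eq_mul]
  ring

/-- The rates are the derivatives at u = t of the explicit kernel with zero and with one birth. -/
theorem exists_birth_rates (hX : IsYule X P) : IsBirthProcess X P := by
  refine ⟨fun j t => (j + 1) / (1 - (t : ℝ)), hX.isMarkov, hX.ae_isCadlagPath, hX.ae_continuousAt,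
    fun j t => div_nonneg (by positivity) (one_sub_pos t).le, fun t j hj => ?_, fun t j hj => ?_⟩
  · have ht := one_sub_pos t
    have hd : HasDerivAt (fun x : ℝ => ((1 - x) / (1 - (t : ℝ))) ^ (j + 1))
        (-((j + 1) / (1 - (t : ℝ)))) t := by
      have := ((((hasDerivAt_id (t : ℝ)).const_sub 1).div_const (1 - (t : ℝ))).fun_pow (j + 1))
      refine this.congr_deriv ?_
      simp only [id_eq, div_self ht.ne', one_pow]
      push_cast
      ring
    refine (isLittleO_of_hasDerivAt hd).congr' ?_ EventuallyEq.rfl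
    filter_upwards [self_mem_nhdsWithin] with u hu
    have hk := yuleKernel_singleton (le_of_lt hu) j 0
    rw [add_zero, Nat.choose_zero_right, pow_zero, Nat.cast_one, one_mul, mul_one] at hk
    rw [hX.transProb_eq (le_of_lt hu) hj, hk, ENNReal.toReal_ofReal
      (pow_nonneg (div_nonneg (one_sub_pos u).le ht.le) _), div_self ht.ne', one_pow]
    ring
  · have ht := one_sub_pos t
    have hd : HasDerivAt (fun x : ℝ => ((j + 1 : ℕ) : ℝ) * ((1 - x) / (1 - (t : ℝ))) ^ (j + 1)
        * (1 - (1 - x) / (1 - (t : ℝ)))) ((j + 1) / (1 - (t : ℝ))) t := by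
      have h1 := ((hasDerivAt_id (t : ℝ)).const_sub 1).div_const (1 - (t : ℝ))
      have := ((h1.fun_pow (j + 1)).const_mul ((j + 1 : ℕ) : ℝ)).mul (h1.const_sub 1)
      refine this.congr_deriv ?_
      simp only [id_eq, div_self ht.ne', one_pow]
      push_cast
      ring
    refine (isLittleO_of_hasDerivAt hd).congr' ?_ EventuallyEq.rfl
    filter_upwards [self_mem_nhdsWithin] with u hu
    have hk := yuleKernel_singleton (le_of_lt hu) j 1
    rw [Nat.choose_one_right, pow_one] at hk
    have hle : (1 - (u : ℝ)) / (1 - (t : ℝ)) ≤ 1 :=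
      (div_le_one ht).2 (sub_le_sub_left (Subtype.coe_le_coe.2 (le_of_lt hu)) _)
    rw [hX.transProb_eq (le_of_lt hu) hj, hk, ENNReal.toReal_ofReal (mul_nonneg (mul_nonneg
      (Nat.cast_nonneg _) (pow_nonneg (div_nonneg (one_sub_pos u).le ht.le) _)) (sub_nonneg.2 hle)),
      div_self ht.ne', sub_self, mul_zero, zero_add]

end IsYule

/-! ### Markov property of the permutation-valued process -/

section

variable {Ω : Type*} [MeasurableSpace Ω] {P : Measure Ω}

/-- Independence factorizes both sides over the coordinates involved; each factor is the Markov
property of a single Yule process. -/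
lemma measure_cylinder_inter_eq_lintegral {X : ℕ+ → UnitTime → Ω → ℕ} (hX : ∀ i, IsYule (X i) P)
    (hind : iIndepFun (fun i ω t => X i t ω) P) {s t : UnitTime} (hst : s ≤ t)
    (J : Finset (ℕ+ × Set.Iic s)) (f : ℕ+ × Set.Iic s → ℕ) (I : Finset ℕ+) (D : ℕ+ → Set ℕ) :
    P ({ω | ∀ p ∈ J, X p.1 p.2 ω = f p} ∩ {ω | ∀ i ∈ I, X i t ω ∈ D i})
      = ∫⁻ ω in {ω | ∀ p ∈ J, X p.1 p.2 ω = f p}, ∏ i ∈ I, yuleKernel s t (D i) (X i s ω) ∂P := by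
  classical
  set K := I ∪ J.image Prod.fst
  have hev : ∀ r : UnitTime, Measurable fun x : UnitTime → ℕ => x r := fun r =>
    measurable_pi_apply r
  -- For coordinate i, `V i` holds the past constraints and `W i` the future one; `h i` keeps the
  -- past and replaces the future by its kernel.
  set V : ℕ+ → Set (UnitTime → ℕ) := fun i => {x | ∀ p ∈ J, p.1 = i → x p.2 = f p}
  set W : ℕ+ → Set (UnitTime → ℕ) := fun i => {x | i ∈ I → x t ∈ D i}
  set h : ℕ+ → (UnitTime → ℕ) → ENNReal := fun i =>
    (V i).indicator fun x => if i ∈ I then yuleKernel s t (D i) (x s) else 1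
  have hV_eq : ∀ i, V i = ⋂ p ∈ J.filter fun p => p.1 = i, {x | x p.2 = f p} := by
    intro i
    ext x
    simp [V]
  have hVm : ∀ i, MeasurableSet (V i) := by
    intro i
    rw [hV_eq]
    exact Finset.measurableSet_biInter _ fun p _ => hev _ (measurableSet_singleton _)
  have hWm : ∀ i, MeasurableSet (W i) := by
    intro i
    by_cases hi : i ∈ I
    · simp only [W, hi, true_imp_iff]
      exact hev t (MeasurableSet.of_discrete (s := D i))
    · simp [W, hi]
  have hhm : ∀ i, Measurable (h i) := by
    intro i
    refine Measurable.indicator ?_ (hVm i)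
    split_ifs
    · exact (measurable_of_countable (yuleKernel s t (D i))).comp (hev s)
    · exact measurable_const
  have hpath : ∀ i, Measurable fun ω t => X i t ω := fun i => measurable_pi_iff.2 (hX i).measurable
  have hset : {ω | ∀ p ∈ J, X p.1 p.2 ω = f p} ∩ {ω | ∀ i ∈ I, X i t ω ∈ D i}
      = ⋂ i ∈ K, (fun ω t => X i t ω) ⁻¹' (V i ∩ W i) := by
    ext ω
    simp only [mem_inter_iff, mem_ofPred_eq, mem_iInter, mem_preimage, V, W]
    constructor
    · rintro ⟨h1, h2⟩ i _
      exact ⟨fun p hp hpi => hpi ▸ h1 p hp, fun hi => h2 i hi⟩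
    · intro H
      exact ⟨fun p hp => (H p.1 (Finset.mem_union_right _ (Finset.mem_image_of_mem _ hp))).1 p hp rfl,
        fun i hi => (H i (Finset.mem_union_left _ hi)).2 hi⟩
  have hJ_eq : {ω | ∀ p ∈ J, X p.1 p.2 ω = f p} = ⋂ p ∈ J, X p.1 p.2 ⁻¹' {f p} := by
    ext ω
    simp
  have hJm : MeasurableSet {ω | ∀ p ∈ J, X p.1 p.2 ω = f p} := by
    rw [hJ_eq]
    exact Finset.measurableSet_biInter _ fun p _ => (hX _).measurable _ (measurableSet_singleton _)
  have hfactor : ∀ i, P ((fun ω t => X i t ω) ⁻¹' (V i ∩ W i))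
      = ∫⁻ ω, h i (fun t => X i t ω) ∂P := by
    intro i
    have hind : (fun ω => h i (fun t => X i t ω)) = ((fun ω t => X i t ω) ⁻¹' V i).indicator
        fun ω => if i ∈ I then yuleKernel s t (D i) (X i s ω) else 1 := rfl
    rw [hind, lintegral_indicator (hpath i (hVm i)), preimage_inter]
    by_cases hi : i ∈ I
    · simp only [hi, if_true, W, true_imp_iff]
      refine (hX i).measure_inter_eq_lintegral hst (D i) ?_
      have : (fun ω t => X i t ω) ⁻¹' V i
          = ⋂ p ∈ J.filter fun p => p.1 = i, X i p.2 ⁻¹' {f p} := by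
        rw [hV_eq]
        ext ω
        simp
      rw [this]
      refine Finset.measurableSet_biInter _ fun p _ => ?_
      exact le_iSup (fun r : Set.Iic s => MeasurableSpace.comap (X i r) inferInstance) p.2 _
        ⟨{f p}, measurableSet_singleton _, rfl⟩
    · simp [hi, W]
  have hprod : ∀ ω, ({ω | ∀ p ∈ J, X p.1 p.2 ω = f p}.indicator
      fun ω => ∏ i ∈ I, yuleKernel s t (D i) (X i s ω)) ω = ∏ i ∈ K, h i fun t => X i t ω := by
    intro ω
    by_cases hω : ω ∈ {ω | ∀ p ∈ J, X p.1 p.2 ω = f p}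
    · rw [indicator_of_mem hω, ← Finset.prod_subset (Finset.subset_union_left (s₂ := J.image Prod.fst))]
      · refine Finset.prod_congr rfl fun i hi => ?_
        have : (fun t => X i t ω) ∈ V i := fun p hp hpi => hpi ▸ hω p hp
        simp only [h, indicator_of_mem this, hi, if_true]
      · intro i _ hi
        have : (fun t => X i t ω) ∈ V i := fun p hp hpi => hpi ▸ hω p hp
        simp only [h, indicator_of_mem this, hi, if_false]
    · rw [indicator_of_notMem hω]
      simp only [mem_ofPred_eq, not_forall] at hω
      obtain ⟨p, hp, hne⟩ := hω
      refine (Finset.prod_eq_zero (Finset.mem_union_right I (Finset.mem_image_of_mem Prod.fst hp)) ?_).symm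
      have hV : (fun t => X p.1 t ω) ∉ V p.1 := fun hV => hne (hV p hp rfl)
      exact indicator_of_notMem hV _
  rw [hset, hind.measure_inter_preimage_eq_mul K fun i _ => (hVm i).inter (hWm i),
    ← lintegral_indicator hJm, lintegral_congr hprod]
  exact (Finset.prod_congr rfl fun i _ => hfactor i).trans
    (lintegral_prod_eq_prod_lintegral_of_indepFun K _ (hind.comp h hhm)
      fun i => (hhm i).comp (hpath i)).symm

/-- The family of events specifying finitely many right-inversion counts. -/
def codeCylinders : Set (Set InfPerm) :=
  {A | ∃ B ∈ squareCylinders fun _ : ℕ+ => {D : Set ℕ | MeasurableSet D}, InfPerm.code ⁻¹' B = A}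

lemma generateFrom_codeCylinders :
    InfPerm.instMeasurableSpace = MeasurableSpace.generateFrom codeCylinders := by
  rw [InfPerm.measurableSpace_eq_comap_code, ← generateFrom_squareCylinders,
    MeasurableSpace.comap_generateFrom]
  rfl

lemma isPiSystem_codeCylinders : IsPiSystem codeCylinders :=
  (isPiSystem_squareCylinders (fun _ => MeasurableSpace.isPiSystem_measurableSet)
    fun _ => MeasurableSet.univ).comap _

/-- On a code cylinder the transition kernel is the product of the one-coordinate kernels, hence a
function of the present permutation. -/
theorem isMarkov_of_rightInv [IsProbabilityMeasure P] {S : UnitTime → Ω → InfPerm}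
    (hS : ∀ t, Measurable (S t))
    (hX : ∀ i, IsYule (fun t ω => rightInv i (S t ω)) P)
    (hind : iIndepFun (fun i ω t => rightInv i (S t ω)) P) : IsMarkov S P := by
  refine isMarkov_of_piSystem hS generateFrom_codeCylinders isPiSystem_codeCylinders ?_
  rintro s t hst _ ⟨_, ⟨I, D, -, rfl⟩, rfl⟩
  have hgm : Measurable fun σ => ∏ i ∈ I, yuleKernel s t (D i) (rightInv i σ) :=
    Finset.measurable_fun_prod _ fun i _ =>
      (measurable_of_countable (yuleKernel s t (D i))).comp (measurable_rightInv i)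
  refine ⟨fun σ => ∏ i ∈ I, yuleKernel s t (D i) (rightInv i σ), hgm, fun C hC => ?_⟩
  have hCm : MeasurableSet C := (iSup_le fun r : Set.Iic s => (hS r).comap_le) C hC
  have hC' : MeasurableSet[⨆ p : ℕ+ × Set.Iic s,
      MeasurableSpace.comap (fun ω => rightInv p.1 (S p.2 ω)) inferInstance] C := by
    refine (iSup_le fun r => ?_ : (⨆ r : Set.Iic s, MeasurableSpace.comap (S r) inferInstance) ≤ _)
      C hC
    rw [InfPerm.measurableSpace_eq_comap_code, MeasurableSpace.comap_comp, MeasurableSpace.pi,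
      MeasurableSpace.comap_iSup]
    refine iSup_le fun i => ?_
    rw [MeasurableSpace.comap_comp]
    exact le_iSup (fun p : ℕ+ × Set.Iic s =>
      MeasurableSpace.comap (fun ω => rightInv p.1 (S p.2 ω)) inferInstance) (i, r)
  have hA : S t ⁻¹' (InfPerm.code ⁻¹' (I : Set ℕ+).pi D)
      = {ω | ∀ i ∈ I, rightInv i (S t ω) ∈ D i} := rfl
  have hfin : IsFiniteMeasure (P.withDensity fun ω =>
      ∏ i ∈ I, yuleKernel s t (D i) (rightInv i (S s ω))) :=
    isFiniteMeasure_withDensity (ne_top_of_le_ne_top (measure_ne_top P univ) (by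
      rw [← lintegral_one]
      exact lintegral_mono fun ω => Finset.prod_le_one' fun i _ => yuleKernel_le_one _ _ _ _))
  rw [hA]
  have key := measure_eq_of_forall_cylinder (X := fun p : ℕ+ × Set.Iic s =>
    fun ω => rightInv p.1 (S p.2 ω)) (fun p => (hX p.1).measurable p.2) (1, ⟨s, mem_Iic.2 le_rfl⟩)
    (m₁ := P.restrict {ω | ∀ i ∈ I, rightInv i (S t ω) ∈ D i})
    (m₂ := P.withDensity fun ω => ∏ i ∈ I, yuleKernel s t (D i) (rightInv i (S s ω)))
    (fun J _ f => ?_) hC'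
  · rwa [Measure.restrict_apply hCm, withDensity_apply _ hCm] at key
  · have hm : MeasurableSet {ω | ∀ p ∈ J, rightInv p.1 (S p.2 ω) = f p} := by
      have : {ω | ∀ p ∈ J, rightInv p.1 (S p.2 ω) = f p}
          = ⋂ p ∈ J, (fun ω => rightInv p.1 (S p.2 ω)) ⁻¹' {f p} := by
        ext ω
        simp
      rw [this]
      exact Finset.measurableSet_biInter _ fun p _ =>
        (hX _).measurable _ (measurableSet_singleton _)
    rw [Measure.restrict_apply hm, withDensity_apply _ hm]
    exact measure_cylinder_inter_eq_lintegral hX hind hst J f I D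

theorem isInfMallowsProcess_of_isYule [IsProbabilityMeasure P] {S : UnitTime → Ω → InfPerm}
    (hS : ∀ t, Measurable (S t))
    (hX : ∀ i, IsYule (fun t ω => rightInv i (S t ω)) P)
    (hind : iIndepFun (fun i ω t => rightInv i (S t ω)) P) : IsInfMallowsProcess S P where
  markov := isMarkov_of_rightInv hS hX hind
  birth i := (hX i).exists_birth_rates
  indep := hind
  marginal t := by
    refine ⟨?_, fun i k => ?_⟩
    · have h := hind.comp (fun _ x => x t) fun _ => measurable_pi_apply t
      rw [iIndepFun_iff_measure_inter_preimage_eq_mul] at h ⊢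
      intro I D hD
      have hm : ∀ i ∈ I, MeasurableSet (rightInv i ⁻¹' D i) := fun i hi =>
        measurable_rightInv i (hD i hi)
      rw [Measure.map_apply (hS t) (Finset.measurableSet_biInter _ hm),
        Finset.prod_congr rfl fun i hi => Measure.map_apply (hS t) (hm i hi)]
      simp only [preimage_iInter]
      exact h I hD
    · exact (Measure.map_apply (hS t) (measurable_rightInv i (measurableSet_singleton k))).trans
        ((hX i).marginal t k)

end

/-! ### Construction -/

/-- The state at time `t` of the time-changed Yule process driven by `e`. -/
def yuleCount (e : ℕ → ℝ) (t : UnitTime) : ℕ :=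
  open Classical in if h : ∃ n, inState n 0 e (logTime t) then h.choose else 0

lemma inState_yuleCount {e : ℕ → ℝ} {t : UnitTime} (h : ∃ n, inState n 0 e (logTime t)) :
    inState (yuleCount e t) 0 e (logTime t) := by
  rw [yuleCount, dif_pos h]
  exact h.choose_spec

lemma measurable_yuleCount (t : UnitTime) : Measurable fun e => yuleCount e t := by
  refine measurable_to_countable' fun k => ?_
  -- Clocks that explode before the given time receive the default 0, hence the extra piece for k =
  -- 0.
  have hset : (fun e => yuleCount e t) ⁻¹' {k} = {e | inState k 0 e (logTime t)} ∪
      ({_e | k = 0} ∩ ⋂ n, {e | inState n 0 e (logTime t)}ᶜ) := by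
    ext e
    simp only [mem_preimage, mem_singleton_iff, mem_union, mem_inter_iff, mem_iInter, mem_compl_iff,
      mem_ofPred_eq]
    by_cases h : ∃ n, inState n 0 e (logTime t)
    · have h1 := inState_yuleCount h
      constructor
      · rintro rfl
        exact Or.inl h1
      · rintro (h2 | ⟨-, h2⟩)
        · exact inState_unique h1 h2
        · exact absurd h1 (h2 _)
    · rw [yuleCount, dif_neg h]
      push Not at h
      constructor
      · rintro rfl
        exact Or.inr ⟨rfl, h⟩
      · rintro (h2 | ⟨rfl, -⟩)
        · exact absurd h2 (h _)
        · rfl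
  rw [hset]
  exact (measurableSet_inState _ _ _).union ((MeasurableSet.const _).inter
    (MeasurableSet.iInter fun n => (measurableSet_inState _ _ _).compl))

lemma expSeq_inState_logTime (t : UnitTime) (n : ℕ) :
    expSeq {e | inState n 0 e (logTime t)} = ENNReal.ofReal ((1 - (t : ℝ)) * (t : ℝ) ^ n) := by
  rw [expSeq_inState n 0 (logTime_nonneg t)]
  simp [exp_neg_logTime]

/-- Non-explosion: the masses (1 - t) t^n sum to 1. -/
lemma ae_exists_inState (t : UnitTime) : ∀ᵐ e ∂expSeq, ∃ n, inState n 0 e (logTime t) := by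
  have hset : {e | ∃ n, inState n 0 e (logTime t)} = ⋃ n, {e | inState n 0 e (logTime t)} := by
    ext e
    simp
  have hm : MeasurableSet {e | ∃ n, inState n 0 e (logTime t)} := by
    rw [hset]
    exact MeasurableSet.iUnion fun n => measurableSet_inState _ _ _
  have h1 : expSeq {e | ∃ n, inState n 0 e (logTime t)} = 1 := by
    have hdisj : Pairwise (Function.onFun Disjoint fun n => {e | inState n 0 e (logTime t)}) :=
      fun m n hmn => disjoint_left.2 fun e hm hn => hmn (inState_unique hm hn)
    rw [hset, measure_iUnion hdisj fun n => measurableSet_inState _ _ _]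
    simp_rw [expSeq_inState_logTime]
    have hsum := (hasSum_geometric_of_lt_one t.2.1 t.2.2).mul_left (1 - (t : ℝ))
    rw [mul_inv_cancel₀ (one_sub_pos t).ne'] at hsum
    rw [← ENNReal.ofReal_tsum_of_nonneg (fun n => mul_nonneg (one_sub_pos t).le
      (pow_nonneg t.2.1 n)) hsum.summable, hsum.tsum_eq, ENNReal.ofReal_one]
  exact (mem_ae_iff_prob_eq_one hm).2 h1

/-- A sequence of times increasing to `1`. -/
def lateTime (m : ℕ) : UnitTime :=
  ⟨1 - 1 / (m + 1), sub_nonneg.2 (by rw [div_le_one (by positivity)]; linarith [m.cast_nonneg (α := ℝ)]),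
    sub_lt_self _ (by positivity)⟩

lemma exists_le_lateTime (t : UnitTime) : ∃ m, t ≤ lateTime m := by
  obtain ⟨m, hm⟩ := exists_nat_one_div_lt (one_sub_pos t)
  refine ⟨m, Subtype.coe_le_coe.1 ?_⟩
  show (t : ℝ) ≤ 1 - 1 / (m + 1)
  linarith

/-- The law of an i.i.d. family of driving sequences. -/
def clockLaw : Measure (ℕ+ → ℕ → ℝ) := Measure.infinitePi fun _ => expSeq

instance : IsProbabilityMeasure clockLaw := by unfold clockLaw; infer_instance

lemma measurePreserving_clock (i : ℕ+) :
    MeasurePreserving (fun ω : ℕ+ → ℕ → ℝ => ω i) clockLaw expSeq :=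
  measurePreserving_eval_infinitePi (fun _ : ℕ+ => expSeq) i

/-- Second Borel–Cantelli: the events are independent with the same positive probability 1 - t. -/
lemma ae_frequently_inState_zero (t : UnitTime) :
    ∀ᵐ ω ∂clockLaw, ∃ᶠ n in atTop, inState 0 0 (ω (Nat.succPNat n)) (logTime t) := by
  set s : ℕ → Set (ℕ+ → ℕ → ℝ) := fun n =>
    (fun ω => ω (Nat.succPNat n)) ⁻¹' {e | inState 0 0 e (logTime t)}
  have hsm : ∀ n, MeasurableSet (s n) := fun n =>
    (measurePreserving_clock _).measurable (measurableSet_inState 0 0 _)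
  have hind : iIndepFun (fun (n : ℕ) (ω : ℕ+ → ℕ → ℝ) => ω (Nat.succPNat n)) clockLaw :=
    (iIndepFun_infinitePi (P := fun _ : ℕ+ => expSeq) (X := fun _ e => e)
      fun _ => measurable_id).precomp Nat.succPNat_injective
  have hs : iIndepSet s clockLaw := by
    rw [iIndepSet_iff_meas_biInter hsm]
    intro I
    exact hind.measure_inter_preimage_eq_mul I fun n _ => measurableSet_inState 0 0 _
  have hmeas : ∀ n, clockLaw (s n) = ENNReal.ofReal (1 - (t : ℝ)) := by
    intro n
    rw [(measurePreserving_clock _).measure_preimage (measurableSet_inState 0 0 _).nullMeasurableSet,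
      expSeq_inState_logTime, pow_zero, mul_one]
  have h1 := measure_limsup_eq_one hsm hs (by
    simp_rw [hmeas]
    exact ENNReal.tsum_const_eq_top_of_ne_zero (ENNReal.ofReal_pos.2 (one_sub_pos t)).ne')
  filter_upwards [(mem_ae_iff_prob_eq_one (MeasurableSet.measurableSet_limsup hsm)).2 h1] with ω hω
  exact mem_limsup_iff_frequently_mem.1 hω

/-- The driving sequences for which all Yule processes are non-explosive and, at all times,
infinitely many of them are in state `0`. -/
def goodClocks : Set (ℕ+ → ℕ → ℝ) :=
  {ω | ∀ m, (∀ i, ∃ n, inState n 0 (ω i) (logTime (lateTime m))) ∧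
    ∃ᶠ n in atTop, inState 0 0 (ω (Nat.succPNat n)) (logTime (lateTime m))}

lemma measurableSet_goodClocks : MeasurableSet goodClocks := by
  have hm : ∀ (i : ℕ+) n m, MeasurableSet {ω : ℕ+ → ℕ → ℝ | inState n 0 (ω i) (logTime (lateTime m))} :=
    fun i n m => (measurePreserving_clock i).measurable (measurableSet_inState n 0 _)
  have hset : goodClocks = ⋂ m, ((⋂ i, ⋃ n, {ω | inState n 0 (ω i) (logTime (lateTime m))}) ∩
      limsup (fun n => {ω | inState 0 0 (ω (Nat.succPNat n)) (logTime (lateTime m))}) atTop) := by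
    ext ω
    simp only [goodClocks, mem_ofPred_eq, mem_iInter, mem_inter_iff, mem_iUnion,
      mem_limsup_iff_frequently_mem]
  rw [hset]
  exact MeasurableSet.iInter fun m => (MeasurableSet.iInter fun i => MeasurableSet.iUnion fun n =>
    hm i n m).inter (MeasurableSet.measurableSet_limsup fun n => hm _ 0 m)

lemma ae_mem_goodClocks : ∀ᵐ ω ∂clockLaw, ω ∈ goodClocks := by
  refine ae_all_iff.2 fun m => ?_
  have h1 : ∀ᵐ ω ∂clockLaw, ∀ i, ∃ n, inState n 0 (ω i) (logTime (lateTime m)) :=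
    ae_all_iff.2 fun i => (measurePreserving_clock i).quasiMeasurePreserving.ae (ae_exists_inState _)
  exact h1.and (ae_frequently_inState_zero _)

lemma inState_yuleCount_of_mem {ω : ℕ+ → ℕ → ℝ} (hω : ω ∈ goodClocks) (i : ℕ+) (t : UnitTime) :
    inState (yuleCount (ω i) t) 0 (ω i) (logTime t) := by
  obtain ⟨m, hm⟩ := exists_le_lateTime t
  obtain ⟨n, hn⟩ := (hω m).1 i
  exact inState_yuleCount (exists_inState_of_le (logTime_mono hm) hn)

/-- A process in state 0 at a later time is in state 0 now, so the countably many times `lateTime m`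
control all times. -/
lemma frequently_yuleCount_eq_zero {ω : ℕ+ → ℕ → ℝ} (hω : ω ∈ goodClocks) (t : UnitTime) :
    ∃ᶠ n in atTop, yuleCount (ω (Nat.succPNat n)) t = 0 := by
  obtain ⟨m, hm⟩ := exists_le_lateTime t
  refine (hω m).2.mono fun n hn => Nat.eq_zero_of_le_zero ?_
  exact inState_mono (logTime_mono hm) (inState_yuleCount_of_mem hω _ t) hn

/-- The process of infinite permutations whose right-inversion counts are the Yule processes
driven by `ω`. -/
def yulePerm (t : UnitTime) (ω : ℕ+ → ℕ → ℝ) : InfPerm :=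
  open Classical in if ω ∈ goodClocks then permOfCode fun i => yuleCount (ω i) t else 1

lemma rightInv_yulePerm {ω : ℕ+ → ℕ → ℝ} (hω : ω ∈ goodClocks) (i : ℕ+) (t : UnitTime) :
    rightInv i (yulePerm t ω) = yuleCount (ω i) t := by
  rw [yulePerm, if_pos hω]
  exact rightInv_permOfCode (frequently_yuleCount_eq_zero hω t) i

lemma measurable_rightInv_yulePerm (i : ℕ+) (t : UnitTime) :
    Measurable fun ω => rightInv i (yulePerm t ω) := by
  classical
  have heq : (fun ω => rightInv i (yulePerm t ω))
      = fun ω => if ω ∈ goodClocks then yuleCount (ω i) t else rightInv i 1 := by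
    funext ω
    split_ifs with hω
    · exact rightInv_yulePerm hω i t
    · rw [yulePerm, if_neg hω]
  rw [heq]
  exact Measurable.ite measurableSet_goodClocks
    ((measurable_yuleCount t).comp (measurePreserving_clock i).measurable) measurable_const

lemma measurable_yulePerm (t : UnitTime) : Measurable (yulePerm t) := by
  rw [measurable_iff_comap_le, InfPerm.measurableSpace_eq_comap_code, MeasurableSpace.comap_comp,
    ← measurable_iff_comap_le]
  exact measurable_pi_iff.2 fun i => measurable_rightInv_yulePerm i t

lemma isYule_rightInv_yulePerm (i : ℕ+) :
    IsYule (fun t ω => rightInv i (yulePerm t ω)) clockLaw := by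
  refine ⟨measurable_rightInv_yulePerm i, fun ω => ω i, measurePreserving_clock i, ?_⟩
  filter_upwards [ae_mem_goodClocks] with ω hω t
  rw [rightInv_yulePerm hω, yuleAt_zero_iff]
  exact inState_yuleCount_of_mem hω i t

lemma iIndepFun_rightInv_yulePerm :
    iIndepFun (fun i ω t => rightInv i (yulePerm t ω)) clockLaw := by
  have h : iIndepFun (fun (i : ℕ+) (ω : ℕ+ → ℕ → ℝ) t => yuleCount (ω i) t) clockLaw :=
    iIndepFun_infinitePi (P := fun _ : ℕ+ => expSeq) (X := fun _ e t => yuleCount e t)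
      fun _ => measurable_pi_iff.2 measurable_yuleCount
  -- Off one null set the two paths agree at all times at once, so independence of the whole paths
  -- transfers.
  refine h.congr fun i => ?_
  filter_upwards [ae_mem_goodClocks] with ω hω
  funext t
  exact (rightInv_yulePerm hω i t).symm

theorem isInfMallowsProcess_yulePerm : IsInfMallowsProcess yulePerm clockLaw :=
  isInfMallowsProcess_of_isYule measurable_yulePerm isYule_rightInv_yulePerm
    iIndepFun_rightInv_yulePerm

end

theorem mainTheorem9 :
    -- existence
    (∃ (Ω : Type) (_ : MeasurableSpace Ω) (P : Measure Ω) (_ : IsProbabilityMeasure P)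
      (S : UnitTime → Ω → InfPerm), IsInfMallowsProcess S P) ∧
    -- uniqueness of the law of the process
    (∀ (Ω : Type u) (_ : MeasurableSpace Ω) (P : Measure Ω) (_ : IsProbabilityMeasure P)
      (S : UnitTime → Ω → InfPerm)
      (Ω' : Type v) (_ : MeasurableSpace Ω') (P' : Measure Ω') (_ : IsProbabilityMeasure P')
      (S' : UnitTime → Ω' → InfPerm),
      IsInfMallowsProcess S P → IsInfMallowsProcess S' P' →
        P.map (fun ω t => S t ω) = P'.map (fun ω t => S' t ω)) ∧
    -- the right-inversion counts, shifted by one, are i.i.d. geometric birth processes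
    (∀ (Ω : Type u) (_ : MeasurableSpace Ω) (P : Measure Ω) (_ : IsProbabilityMeasure P)
      (S : UnitTime → Ω → InfPerm), IsInfMallowsProcess S P →
        ∃ R : ℕ+ → UnitTime → Ω → ℕ,
          (∀ i t ω, R i t ω = rightInv i (S t ω) + 1) ∧
          (∀ i, IsGeometricBirthProcess (R i) P) ∧
          iIndepFun (fun i ω t => R i t ω) P ∧
          (∀ i j, P.map (fun ω t => R i t ω) = P.map (fun ω t => R j t ω))) := by
  refine ⟨⟨ℕ+ → ℕ → ℝ, inferInstance, clockLaw, inferInstance, yulePerm,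
    isInfMallowsProcess_yulePerm⟩, ?_, ?_⟩
  · intro Ω _ P _ S Ω' _ P' _ S' hS hS'
    exact hS.map_eq hS'
  · intro Ω _ P _ S hS
    exact ⟨fun i t ω => rightInv i (S t ω) + 1, fun _ _ _ => rfl, hS.isGeometricBirthProcess,
      hS.iIndepFun_add_one, hS.map_add_one_eq⟩
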